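/- Let $\mathbb{K}\subset\mathbb{C}$ be an imaginary quadratic field, let $\mathcal{O}$ be an order in $\mathbb{K}$ of discriminant $-d$, and put $\mathcal{D}^{-1}:=\frac{1}{\sqrt{-d}}\mathcal{O}$. Let $V$ be a finite-dimensional $\mathbb{K}$-vector space with a non-degenerate Hermitian pairing $\langle\cdot,\cdot\rangle:V\times V\to\mathbb{K}$ (linear in the first variable, conjugate-linear in the second, $\langle\mu,\lambda\rangle=\overline{\langle\lambda,\mu\rangle}$) of signature $(b_+,b_-)$; write $|\lambda|^2=\langle\lambda,\lambda\rangle$ and $(\lambda,\mu)=\operatorname{Tr}^{\mathbb{K}}_{\mathbb{Q}}\langle\lambda,\mu\rangle$. Let $M\subset V$ be an even $\mathcal{O}$-lattice, i.e., a projective $\mathcal{O}$-submodule spanning $V$ with $\langle M,M\rangle\subseteq\mathcal{D}^{-1}$ and $|\lambda|^2\in\mathbb{Z}$ for all $\lambda\in M$; let $M^*=\{y\in V:\langle y,M\rangle\subseteq\mathcal{D}^{-1}\}$ and $D_M=M^*/M$, and let $(\mathfrak{e}_\gamma)_{\gamma\in D_M}$ be the standard basis of $\mathbb{C}[D_M]$.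 Write $\mathbf{e}(z)=e^{2\pi i z}$. Extend $\langle\cdot,\cdot\rangle$ to a $\mathbb{C}$-bilinear map on $V\otimes_{\mathbb{Q}}\mathbb{C}=V_{\mathbb{C}}\oplus V_{\overline{\mathbb{C}}}$, where $a\in\mathbb{K}$ acts as the scalar $a$ on $V_{\mathbb{C}}$ and as the scalar $\overline{a}$ on $V_{\overline{\mathbb{C}}}$. Let $\operatorname{Gr}^J(V_{\mathbb{R}})$ be the set of orthogonal decompositions $v:V\otimes_{\mathbb{Q}}\mathbb{R}=v_+\oplus v_-$ into $\mathbb{K}$-stable subspaces, $v_+$ positive definite and $v_-$ negative definite, and denote by $x\mapsto x_{v_\pm}$ the corresponding projections, extended to $V\otimes_{\mathbb{Q}}\mathbb{C}$. For $\tau\in\mathcal{H}$ (the upper half-plane), $\zeta\in V_{\mathbb{C}}$, $\omega\in V_{\overline{\mathbb{C}}}$, and $v\in\operatorname{Gr}^J(V_{\mathbb{R}})$ put $$\Theta_M(\tau,\zeta,\omega;v)=\sum_{\gamma\in D_M}\Big[\sum_{\lambda\in M+\gamma}\mathbf{e}\big(\tau|\lambda_{v_+}|^2+\overline{\tau}|\lambda_{v_-}|^2+\langle\zeta,\lambda\rangle+\langle\lambda,\omega\rangle\big)\Big]\mathfrak{e}_\gamma.$$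 Let $\operatorname{U}(1,1)(\mathbb{Z})$ be the group of matrices $A\in\operatorname{GL}_2(\mathcal{O})$ with $A\binom{0\ -1}{1\ \ \ 0}\overline{A}^t=\binom{0\ -1}{1\ \ \ 0}$. For $A=\binom{a\ b}{c\ d}$ in this group put $A\tau=\frac{a\tau+b}{c\tau+d}\in\mathcal{H}$, $j(A,\tau)=c\tau+d$, $j^c(A,\tau)=\overline{c}\tau+\overline{d}$, and $j'_A=c$. Then the series defining $\Theta_M$ converges absolutely, and there is a unique representation $\rho_M$ of $\operatorname{U}(1,1)(\mathbb{Z})$ on $\mathbb{C}[D_M]$ (the extended Weil representation) with $$\rho_M\tbinom{1\ 1}{0\ 1}\mathfrak{e}_\gamma=\mathbf{e}\big(\tfrac{\gamma^2}{2}\big)\mathfrak{e}_\gamma,\qquad \rho_M\tbinom{0\ -1}{1\ \ \ 0}\mathfrak{e}_\gamma=\frac{i^{b_--b_+}}{\sqrt{|D_M|}}\sum_{\delta\in D_M}\mathbf{e}\big(-(\gamma,\delta)\big)\mathfrak{e}_\delta,$$ and $\rho_M(\xi I)\mathfrak{e}_\gamma=\xi^{b_--b_+}\mathfrak{e}_{\overline{\xi}\gamma}$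 for every root of unity $\xi\in\mathcal{O}$, where $\frac{\gamma^2}{2}\in\mathbb{Q}/\mathbb{Z}$ is the class of $|\lambda|^2$ for $\lambda\in M+\gamma$. Moreover, for all $A\in\operatorname{U}(1,1)(\mathbb{Z})$, $\tau\in\mathcal{H}$, $\zeta\in V_{\mathbb{C}}$, $\omega\in V_{\overline{\mathbb{C}}}$, and $v\in\operatorname{Gr}^J(V_{\mathbb{R}})$, $$\Theta_M\Big(A\tau,\tfrac{\zeta_{v_+}}{j(A,\tau)}+\tfrac{\zeta_{v_-}}{\overline{j^c(A,\tau)}},\tfrac{\omega_{v_+}}{j^c(A,\tau)}+\tfrac{\omega_{v_-}}{\overline{j(A,\tau)}};v\Big)=$$ $$=j(A,\tau)^{b_+}\,\overline{j(A,\tau)}^{\,b_-}\,\mathbf{e}\Big(\tfrac{j'_A\langle\zeta_{v_+},\omega_{v_+}\rangle}{j(A,\tau)}+\tfrac{\overline{j'_A}\langle\zeta_{v_-},\omega_{v_-}\rangle}{\overline{j(A,\tau)}}\Big)\,\rho_M(A)\,\Theta_M(\tau,\zeta,\omega;v).$$ -/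

import Mathlib

open scoped TensorProduct UpperHalfPlane MatrixGroups ComplexConjugate

namespace HermitianJacobi

noncomputable section

/-- The normalized exponential `e(z) = exp(2 π i z)`. -/
def e (z : ℂ) : ℂ := Complex.exp (2 * Real.pi * Complex.I * z)

/-! ### Orders in an imaginary quadratic field -/

section Order

variable {K : Type*} [Field K]

/-- A subring of a quadratic field is an order when it is a free `ℤ`-module of rank two. -/
def IsQuadraticOrder (O : Subring K) : Prop := Nonempty (Module.Basis (Fin 2) ℤ O)

open Classical in
/-- The discriminant of an order: the discriminant of any of its `ℤ`-bases
(it does not depend on the choice). -/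
def orderDiscr (O : Subring K) : ℤ :=
  if h : Nonempty (Module.Basis (Fin 2) ℤ O) then Algebra.discr ℤ h.some else 0

/-- The complex number `√D := i √|D|`, for `D` the (negative) discriminant of the order. -/
def sqrtDiscr (O : Subring K) : ℂ := Complex.I * (Real.sqrt (-(orderDiscr O : ℝ)) : ℂ)

/-- The inverse different `𝒟⁻¹ = (1 / √D) O` of the order `O`, as an `O`-submodule of `K`. -/
def inverseDifferent (φ : K →+* ℂ) (O : Subring K) : Submodule O K where
  carrier := {r | ∃ s : O, φ r * sqrtDiscr O = φ s}
  zero_mem' := ⟨0, by simp⟩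
  add_mem' := by
    rintro a b ⟨s, hs⟩ ⟨t, ht⟩
    exact ⟨s + t, by simp [add_mul, hs, ht]⟩
  smul_mem' := by
    rintro c a ⟨s, hs⟩
    refine ⟨c * s, ?_⟩
    have : c • a = (c : K) * a := rfl
    rw [this, map_mul, mul_assoc, hs]
    simp

end Order

/-! ### Hermitian spaces -/

section Hermitian

variable {K : Type*} [Field K] [NumberField K]

/-- A Hermitian pairing `V × V → K`, where complex conjugation on `K` is the one that
the embedding `φ : K → ℂ` induces. -/
structure HermitianPairing (φ : K →+* ℂ) (V : Type*) [AddCommGroup V] [Module K V] where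
  toFun : V → V → K
  add_left : ∀ x y z, toFun (x + y) z = toFun x z + toFun y z
  smul_left : ∀ (a : K) x y, toFun (a • x) y = a * toFun x y
  add_right : ∀ x y z, toFun x (y + z) = toFun x y + toFun x z
  smul_right : ∀ (a : K) x y, φ (toFun x (a • y)) = conj (φ a) * φ (toFun x y)
  conj_symm : ∀ x y, φ (toFun y x) = conj (φ (toFun x y))

namespace HermitianPairing

variable {φ : K →+* ℂ} {V : Type*} [AddCommGroup V] [Module K V]

/-- The Hermitian space is non-degenerate of signature `(bp, bm)`: it has an orthogonal `K`-basis
made of `bp` vectors of positive norm and `bm` vectors of negative norm. -/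
def HasSignature (h : HermitianPairing φ V) (bp bm : ℕ) : Prop :=
  ∃ b : Module.Basis (Fin bp ⊕ Fin bm) K V,
    (∀ i j, i ≠ j → h.toFun (b i) (b j) = 0) ∧
    (∀ i, 0 < (φ (h.toFun (b (Sum.inl i)) (b (Sum.inl i)))).re) ∧
    (∀ i, (φ (h.toFun (b (Sum.inr i)) (b (Sum.inr i)))).re < 0)

variable [Module ℚ V]

theorem map_rat_left (h : HermitianPairing φ V) (q : ℚ) (x y : V) :
    h.toFun (q • x) y = q • h.toFun x y :=
  map_rat_smul (AddMonoidHom.mk' (fun x => h.toFun x y) (fun a b => h.add_left a b y)) q x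

theorem map_rat_right (h : HermitianPairing φ V) (q : ℚ) (x y : V) :
    h.toFun x (q • y) = q • h.toFun x y :=
  map_rat_smul (AddMonoidHom.mk' (fun y => h.toFun x y) (fun a b => h.add_right x a b)) q y

/-- The orthogonal pairing `(x, y) = Tr ⟨x, y⟩` on `V` as a rational vector space. -/
def traceForm (h : HermitianPairing φ V) : LinearMap.BilinForm ℚ V :=
  LinearMap.mk₂ ℚ (fun x y => Algebra.trace ℚ K (h.toFun x y))
    (fun x y z => by simp [h.add_left]) (fun q x y => by simp [h.map_rat_left])
    (fun x y z => by simp [h.add_right]) (fun q x y => by simp [h.map_rat_right])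

/-- The Hermitian pairing, seen as a `ℚ`-bilinear map with values in `ℂ` through `φ`. -/
def toBilin (h : HermitianPairing φ V) : V →ₗ[ℚ] V →ₗ[ℚ] ℂ :=
  LinearMap.mk₂ ℚ (fun x y => φ (h.toFun x y))
    (fun x y z => by simp [h.add_left]) (fun q x y => by rw [h.map_rat_left, map_rat_smul])
    (fun x y z => by simp [h.add_right]) (fun q x y => by rw [h.map_rat_right, map_rat_smul])

/-- The `ℂ`-bilinear extension of `⟨·,·⟩` to the complexification `ℂ ⊗ V` over `ℚ`
(the extension is linear in both variables with respect to the new scalars). -/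
def pairC (h : HermitianPairing φ V) : (ℂ ⊗[ℚ] V) →ₗ[ℂ] (ℂ ⊗[ℚ] V) →ₗ[ℂ] ℂ :=
  LinearMap.liftBaseChange ℂ
    (((LinearMap.liftBaseChangeEquiv (R := ℚ) (M := V) (N := ℂ) ℂ).toLinearMap.restrictScalars ℚ)
      ∘ₗ h.toBilin)

theorem pairC_tmul (h : HermitianPairing φ V) (z w : ℂ) (x y : V) :
    h.pairC (z ⊗ₜ x) (w ⊗ₜ y) = z * w * φ (h.toFun x y) := by
  simp [pairC, toBilin, mul_assoc]

end HermitianPairing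

end Hermitian

/-! ### Complexifications and the Grassmannian -/

section Grassmannian

variable {K : Type*} [Field K] [NumberField K]
variable {V : Type*} [AddCommGroup V] [Module K V] [Module ℚ V]

/-- The action of `a : K` on `V`, as a `ℚ`-linear map. -/
def scalarEnd (V : Type*) [AddCommGroup V] [Module K V] [Module ℚ V] (a : K) : V →ₗ[ℚ] V :=
  Module.toModuleEnd ℚ V a

/-- `V_ℂ = V ⊗_K ℂ`, as the summand of `V ⊗_ℚ ℂ` on which `a ∈ K` acts
through the scalar `φ a`. -/
def VC (φ : K →+* ℂ) (V : Type*) [AddCommGroup V] [Module K V] [Module ℚ V] :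
    Submodule ℂ (ℂ ⊗[ℚ] V) :=
  ⨅ a : K, LinearMap.ker ((scalarEnd V a).baseChange ℂ - φ a • LinearMap.id)

/-- `V_ℂ̄`, the tensor product of `V` with `ℂ` over `K` through the conjugate embedding, as the
summand of `V ⊗_ℚ ℂ` on which `a ∈ K` acts through the scalar `conj (φ a)`. -/
def VCbar (φ : K →+* ℂ) (V : Type*) [AddCommGroup V] [Module K V] [Module ℚ V] :
    Submodule ℂ (ℂ ⊗[ℚ] V) :=
  ⨅ a : K, LinearMap.ker ((scalarEnd V a).baseChange ℂ - conj (φ a) • LinearMap.id)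

/-- The embedding of `V_ℝ = V ⊗_ℚ ℝ` into `V ⊗_ℚ ℂ`. -/
def realToComplex (V : Type*) [AddCommGroup V] [Module ℚ V] : (ℝ ⊗[ℚ] V) →ₗ[ℚ] (ℂ ⊗[ℚ] V) :=
  LinearMap.rTensor V (Complex.ofRealAm.toLinearMap.restrictScalars ℚ)

/-- The embedding of `V` into `V ⊗_ℚ ℂ`. -/
def toC (x : V) : ℂ ⊗[ℚ] V := (1 : ℂ) ⊗ₜ[ℚ] x

/-- The Grassmannian `Gr^J(V_ℝ)`: orthogonal decompositions of `V_ℝ` into a positive definite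
and a negative definite subspace, both of them stable under the action of `K`. -/
structure GrJ {φ : K →+* ℂ} (h : HermitianPairing φ V) where
  pos : Submodule ℝ (ℝ ⊗[ℚ] V)
  neg : Submodule ℝ (ℝ ⊗[ℚ] V)
  isCompl : IsCompl pos neg
  pos_def : ∀ x ∈ pos, x ≠ 0 → 0 < h.traceForm.baseChange ℝ x x
  neg_def : ∀ x ∈ neg, x ≠ 0 → h.traceForm.baseChange ℝ x x < 0
  orthogonal : ∀ x ∈ pos, ∀ y ∈ neg, h.traceForm.baseChange ℝ x y = 0
  pos_stable : ∀ a : K, ∀ x ∈ pos, (scalarEnd V a).baseChange ℝ x ∈ pos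
  neg_stable : ∀ a : K, ∀ x ∈ neg, (scalarEnd V a).baseChange ℝ x ∈ neg

/-- The `ℂ`-linear extension to `V ⊗_ℚ ℂ` of an endomorphism of `V_ℝ`. -/
def complexify (p : (ℝ ⊗[ℚ] V) →ₗ[ℝ] (ℝ ⊗[ℚ] V)) : (ℂ ⊗[ℚ] V) →ₗ[ℂ] (ℂ ⊗[ℚ] V) :=
  LinearMap.liftBaseChange ℂ
    (realToComplex V ∘ₗ p.restrictScalars ℚ ∘ₗ TensorProduct.mk ℚ ℝ V 1)

namespace GrJ

variable {φ : K →+* ℂ} {h : HermitianPairing φ V}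

/-- The projection `x ↦ x_{v₊}` on `V ⊗_ℚ ℂ`. -/
def projPos (v : GrJ h) : (ℂ ⊗[ℚ] V) →ₗ[ℂ] (ℂ ⊗[ℚ] V) :=
  complexify (Submodule.projection v.pos v.neg v.isCompl)

/-- The projection `x ↦ x_{v₋}` on `V ⊗_ℚ ℂ`. -/
def projNeg (v : GrJ h) : (ℂ ⊗[ℚ] V) →ₗ[ℂ] (ℂ ⊗[ℚ] V) :=
  complexify (Submodule.projection v.neg v.pos v.isCompl.symm)

end GrJ

end Grassmannian

/-! ### Hermitian lattices, their discriminant groups and theta functions -/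

section Lattice

variable {K : Type*} [Field K] [NumberField K] {φ : K →+* ℂ} {O : Subring K}
variable {V : Type*} [AddCommGroup V] [Module K V]

/-- `M` is an even `O`-lattice in `V`. -/
structure IsEvenLattice (h : HermitianPairing φ V) (M : Submodule O V) : Prop where
  span_eq_top : Submodule.span K (M : Set V) = ⊤
  pairing_mem : ∀ x ∈ M, ∀ y ∈ M, h.toFun x y ∈ inverseDifferent φ O
  projective : Module.Projective O M
  even : ∀ x ∈ M, ∃ n : ℤ, h.toFun x x = n

/-- The dual lattice `M^* = {y | ⟨y, M⟩ ⊆ 𝒟⁻¹}`. -/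
def dual (h : HermitianPairing φ V) (M : Submodule O V) : Submodule O V where
  carrier := {y | ∀ x ∈ M, h.toFun y x ∈ inverseDifferent φ O}
  zero_mem' := by
    intro x _
    have h0 : h.toFun 0 x = 0 := by simpa using h.smul_left 0 0 x
    rw [h0]
    exact Submodule.zero_mem _
  add_mem' := by
    intro a b ha hb x hx
    rw [h.add_left]
    exact Submodule.add_mem _ (ha x hx) (hb x hx)
  smul_mem' := by
    intro c a ha x hx
    have : h.toFun (c • a) x = c • h.toFun a x := h.smul_left (c : K) a x
    rw [this]
    exact Submodule.smul_mem _ c (ha x hx)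

/-- The discriminant group `D_M = M^* / M`. -/
abbrev Disc (h : HermitianPairing φ V) (M : Submodule O V) : Type _ :=
  (dual h M) ⧸ (M.submoduleOf (dual h M))

/-- The class in `D_M` of an element of `M^*`. -/
def cls (h : HermitianPairing φ V) (M : Submodule O V) (x : dual h M) : Disc h M :=
  (M.submoduleOf (dual h M)).mkQ x

/-- The space `ℂ[D_M]`. As `D_M` is finite, its elements `∑ c_γ 𝔢_γ` are the same as
the functions `γ ↦ c_γ`. -/
abbrev GroupSpace (h : HermitianPairing φ V) (M : Submodule O V) : Type _ := Disc h M → ℂ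

open Classical in
/-- The basis vector `𝔢_γ` of `ℂ[D_M]`. -/
def basisVec (h : HermitianPairing φ V) (M : Submodule O V) (γ : Disc h M) : GroupSpace h M :=
  Pi.single γ 1

variable [Module ℚ V]

/-- The summand `e(τ |x_{v₊}|² + conj τ |x_{v₋}|² + ⟨ζ, x⟩ + ⟨x, ω⟩)` of the theta series. -/
def thetaTerm {h : HermitianPairing φ V} (v : GrJ h) (τ : ℍ) (ζ ω : ℂ ⊗[ℚ] V) (x : V) : ℂ :=
  e ((τ : ℂ) * h.pairC (v.projPos (toC x)) (v.projPos (toC x))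
    + conj (τ : ℂ) * h.pairC (v.projNeg (toC x)) (v.projNeg (toC x))
    + h.pairC ζ (toC x) + h.pairC (toC x) ω)

/-- The Hermitian Jacobi–Siegel theta function `Θ_M(τ, ζ, ω; v)`, with values in `ℂ[D_M]`. Its
component at `γ` is the sum over all the elements of the coset `M + γ`. -/
def Theta (h : HermitianPairing φ V) (M : Submodule O V) (v : GrJ h) (τ : ℍ) (ζ ω : ℂ ⊗[ℚ] V) :
    GroupSpace h M :=
  fun γ => ∑' x : {x : dual h M // cls h M x = γ}, thetaTerm v τ ζ ω (x : dual h M)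

end Lattice

/-! ### The group `U(1,1)` -/

section Unitary

/-- The matrix `(0, -1; 1, 0)`. -/
def Jmat : Matrix (Fin 2) (Fin 2) ℂ := !![0, -1; 1, 0]

/-- The real points of `U(1,1)`: complex matrices `A` with `A J A^* = J`. -/
def U11Real : Subgroup (GL (Fin 2) ℂ) where
  carrier := {A | A.val * Jmat * A.val.conjTranspose = Jmat}
  one_mem' := by simp
  mul_mem' := by
    intro A B hA hB
    change (A * B).val * Jmat * (A * B).val.conjTranspose = Jmat
    change A.val * Jmat * A.val.conjTranspose = Jmat at hA
    change B.val * Jmat * B.val.conjTranspose = Jmat at hB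
    rw [Units.val_mul, Matrix.conjTranspose_mul]
    calc A.val * B.val * Jmat * (B.val.conjTranspose * A.val.conjTranspose)
        = A.val * (B.val * Jmat * B.val.conjTranspose) * A.val.conjTranspose := by
          simp only [Matrix.mul_assoc]
      _ = Jmat := by rw [hB, hA]
  inv_mem' := by
    intro A hA
    change A.val * Jmat * A.val.conjTranspose = Jmat at hA
    change A⁻¹.val * Jmat * A⁻¹.val.conjTranspose = Jmat
    have h1 : A⁻¹.val * A.val = 1 := A.inv_mul
    have h2 : A.val.conjTranspose * A⁻¹.val.conjTranspose = 1 := by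
      rw [← Matrix.conjTranspose_mul, h1, Matrix.conjTranspose_one]
    calc A⁻¹.val * Jmat * A⁻¹.val.conjTranspose
        = A⁻¹.val * (A.val * Jmat * A.val.conjTranspose) * A⁻¹.val.conjTranspose := by rw [hA]
      _ = (A⁻¹.val * A.val) * Jmat * (A.val.conjTranspose * A⁻¹.val.conjTranspose) := by
          simp only [Matrix.mul_assoc]
      _ = Jmat := by rw [h1, h2]; simp

variable {K : Type*} [Field K]

/-- `U(1,1)(ℤ)`, with respect to the order `O`: the matrices of `GL₂(O)` that lie in `U(1,1)`. -/
def U11 (φ : K →+* ℂ) (O : Subring K) : Subgroup (GL (Fin 2) O) :=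
  U11Real.comap (Matrix.GeneralLinearGroup.map (φ.comp O.subtype))

namespace U11

variable {φ : K →+* ℂ} {O : Subring K}

/-- The `(i, j)` entry of a matrix in `U(1,1)(ℤ)`, as a complex number. -/
def entry (A : U11 φ O) (i j : Fin 2) : ℂ := φ (A.val.val i j)

/-- The matrix of complex numbers that underlies an element of `U(1,1)(ℤ)`. -/
def mat (A : U11 φ O) : Matrix (Fin 2) (Fin 2) ℂ :=
  (Matrix.GeneralLinearGroup.map (φ.comp O.subtype) A.val).val

theorem mat_apply (A : U11 φ O) (i j : Fin 2) : mat A i j = entry A i j := rfl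

theorem mat_relation (A : U11 φ O) : mat A * Jmat * (mat A).conjTranspose = Jmat := A.property

theorem mat_relation' (A : U11 φ O) : (mat A).conjTranspose * Jmat * mat A = Jmat := by
  have hJ : Jmat * Jmat = -1 := by
    ext i j
    fin_cases i <;> fin_cases j <;> simp [Jmat]
  have h1 : mat A * (-(Jmat * (mat A).conjTranspose * Jmat)) = 1 := by
    calc mat A * (-(Jmat * (mat A).conjTranspose * Jmat))
        = -((mat A * Jmat * (mat A).conjTranspose) * Jmat) := by
          simp only [Matrix.mul_assoc, mul_neg]
      _ = 1 := by rw [mat_relation, hJ, neg_neg]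
  have h2 : -(Jmat * (mat A).conjTranspose * Jmat) * mat A = 1 := mul_eq_one_comm.1 h1
  calc (mat A).conjTranspose * Jmat * mat A
      = -(Jmat * Jmat) * ((mat A).conjTranspose * Jmat * mat A) := by rw [hJ]; simp
    _ = Jmat * (-(Jmat * (mat A).conjTranspose * Jmat) * mat A) := by
        simp only [Matrix.mul_assoc, neg_mul, mul_neg]
    _ = Jmat := by rw [h2, mul_one]

/-- The factor of automorphy `j(A, τ) = c τ + d`. -/
def j (A : U11 φ O) (τ : ℍ) : ℂ := entry A 1 0 * τ + entry A 1 1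

/-- The factor `j^c(A, τ) = conj c τ + conj d`. -/
def jc (A : U11 φ O) (τ : ℍ) : ℂ := conj (entry A 1 0) * τ + conj (entry A 1 1)

/-- The derivative `j_A' = c` of `j(A, τ)` with respect to `τ`. -/
def jDeriv (A : U11 φ O) : ℂ := entry A 1 0

theorem im_num_mul_conj_j (A : U11 φ O) (τ : ℍ) :
    ((entry A 0 0 * τ + entry A 0 1) * conj (j A τ)).im = τ.im := by
  have r01 := congrFun (congrFun (mat_relation A) 0) 1
  have s00 := congrFun (congrFun (mat_relation' A) 0) 0
  have s01 := congrFun (congrFun (mat_relation' A) 0) 1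
  have s11 := congrFun (congrFun (mat_relation' A) 1) 1
  simp only [Matrix.mul_apply, Fin.sum_univ_two, Jmat, Matrix.conjTranspose_apply, mat_apply,
    Matrix.of_apply, Matrix.cons_val', Matrix.cons_val_zero, Matrix.cons_val_one,
    Matrix.cons_val_fin_one, RCLike.star_def] at r01 s00 s01 s11
  have key : (entry A 0 0 * τ + entry A 0 1) * conj (j A τ)
      - conj ((entry A 0 0 * τ + entry A 0 1) * conj (j A τ)) = (τ : ℂ) - conj (τ : ℂ) := by
    have r01c := congrArg conj r01
    have s01c := congrArg conj s01
    simp only [j, map_add, map_mul, Complex.conj_conj, map_neg, map_one, map_zero] at *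
    linear_combination (τ : ℂ) * conj (τ : ℂ) * s00 + s11 - (τ : ℂ) * s01c
      + conj (τ : ℂ) * s01
  have := congrArg Complex.im key
  simp only [Complex.sub_im, Complex.conj_im, UpperHalfPlane.coe_im] at this
  linarith

theorem j_ne_zero (A : U11 φ O) (τ : ℍ) : j A τ ≠ 0 := by
  intro h0
  have h := im_num_mul_conj_j A τ
  rw [h0] at h
  simp only [map_zero, mul_zero, Complex.zero_im] at h
  exact τ.im_pos.ne h

/-- The action `A τ = (a τ + b) / (c τ + d)` on the upper half-plane. -/
def act (A : U11 φ O) (τ : ℍ) : ℍ :=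
  ⟨(entry A 0 0 * τ + entry A 0 1) / (entry A 1 0 * τ + entry A 1 1), by
    have h : (entry A 0 0 * τ + entry A 0 1) / (entry A 1 0 * τ + entry A 1 1)
        = (((Complex.normSq (j A τ))⁻¹ : ℝ) : ℂ)
          * ((entry A 0 0 * τ + entry A 0 1) * conj (j A τ)) := by
      change _ / j A τ = _
      rw [div_eq_mul_inv, Complex.inv_def]
      ring
    rw [h, Complex.im_ofReal_mul, im_num_mul_conj_j]
    exact mul_pos (inv_pos.2 (Complex.normSq_pos.2 (j_ne_zero A τ))) τ.im_pos⟩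

/-- The inclusion of `SL₂(ℤ)` into `U(1,1)(ℤ)`. -/
def ofSL2 (φ : K →+* ℂ) (O : Subring K) : SL(2, ℤ) →* U11 φ O :=
  ((Matrix.SpecialLinearGroup.toGL).comp
    (Matrix.SpecialLinearGroup.map (Int.castRingHom O))).codRestrict (U11 φ O) (by
      intro B
      have hdet := B.det_coe
      rw [Matrix.det_fin_two] at hdet
      have hdet' : (B 0 0 : ℂ) * B 1 1 - B 0 1 * B 1 0 = 1 := by exact_mod_cast hdet
      change (Matrix.GeneralLinearGroup.map (φ.comp O.subtype) _).val * Jmat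
        * (Matrix.GeneralLinearGroup.map (φ.comp O.subtype) _).val.conjTranspose = Jmat
      ext i j
      fin_cases i <;> fin_cases j <;>
        simp [Matrix.mul_apply, Fin.sum_univ_two, Jmat] <;>
        first
          | ring1
          | linear_combination hdet'
          | linear_combination -hdet')

/-- A root of unity `ξ` in `O`, as a scalar matrix in `U(1,1)(ℤ)`. -/
def scalar (φ : K →+* ℂ) (O : Subring K) (ξ : CommGroup.torsion Oˣ) : U11 φ O :=
  ⟨Matrix.GeneralLinearGroup.scalar (Fin 2) ξ.val, by
    have hn : φ ((ξ : Oˣ) : O) * conj (φ ((ξ : Oˣ) : O)) = 1 := by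
      obtain ⟨n, hn, hξ⟩ := isOfFinOrder_iff_pow_eq_one.1 ξ.property
      have h1 : φ ((ξ : Oˣ) : O) ^ n = 1 := by
        rw [← map_pow]
        have := congrArg (fun u : Oˣ => ((u : O) : K)) hξ
        simpa using congrArg φ this
      have h2 : ‖φ ((ξ : Oˣ) : O)‖ = 1 := Complex.norm_eq_one_of_pow_eq_one h1 hn.ne'
      rw [Complex.mul_conj, Complex.normSq_eq_norm_sq, h2]
      simp
    change (Matrix.GeneralLinearGroup.map (φ.comp O.subtype) _).val * Jmat
      * (Matrix.GeneralLinearGroup.map (φ.comp O.subtype) _).val.conjTranspose = Jmat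
    ext i j
    fin_cases i <;> fin_cases j <;>
      simp [Matrix.mul_apply, Fin.sum_univ_two, Jmat, Matrix.GeneralLinearGroup.scalar, hn]⟩

end U11

end Unitary

/-! ### The Weil representation -/

section Weil

variable {K : Type*} [Field K] [NumberField K] {φ : K →+* ℂ} {O : Subring K}
variable {V : Type*} [AddCommGroup V] [Module K V] [Module ℚ V]

/-- The defining formulae of the (extended) Weil representation `ρ_M` of `U(1,1)(ℤ)` on `ℂ[D_M]`,
for a lattice `M` in a Hermitian space of signature `(bp, bm)`:
* `ρ_M(T) 𝔢_γ = e(γ² / 2) 𝔢_γ`, where `γ² / 2` is the class of `|x|²` for `x ∈ M + γ`;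
* `ρ_M(S) 𝔢_γ = i ^ (bm - bp) / √|D_M| ∑_δ e(-(γ, δ)) 𝔢_δ`;
* `ρ_M(ξ) 𝔢_γ = ξ ^ (bm - bp) 𝔢_{conj ξ γ}` for the roots of unity `ξ` of `O`, for which
  `conj ξ = ξ⁻¹`.

As `S` and `T` generate `SL₂(ℤ)`, which generates `U(1,1)(ℤ)` together with the scalar matrices,
at most one representation satisfies these formulae. -/
structure IsWeilRep (h : HermitianPairing φ V) (M : Submodule O V) (bp bm : ℕ)
    (ρ : Representation ℂ (U11 φ O) (GroupSpace h M)) : Prop where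
  map_T : ∀ x : dual h M,
    ρ (U11.ofSL2 φ O ModularGroup.T) (basisVec h M (cls h M x))
      = e (φ (h.toFun x x)) • basisVec h M (cls h M x)
  map_S : ∀ x y : dual h M,
    ρ (U11.ofSL2 φ O ModularGroup.S) (basisVec h M (cls h M x)) (cls h M y)
      = Complex.I ^ ((bm : ℤ) - (bp : ℤ)) / (Real.sqrt (Nat.card (Disc h M)) : ℂ)
        * e (-(h.traceForm x y : ℂ))
  map_scalar : ∀ (ξ : CommGroup.torsion Oˣ) (x : dual h M),
    ρ (U11.scalar φ O ξ) (basisVec h M (cls h M x))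
      = φ ((ξ : Oˣ) : O) ^ ((bm : ℤ) - (bp : ℤ))
        • basisVec h M (cls h M ((((ξ : Oˣ)⁻¹ : Oˣ) : O) • x))

end Weil

end

end HermitianJacobi

/-! The representation is read off from the theta function instead of being built from generators
and relations. An endomorphism R of ℂ[D_M] is said to transform A (`Transforms`) when the theta
identity holds for A, with R in the place of ρ_M(A), for all v, τ, ζ and ω.

Cocycle. The factor j^{b₊} · conj(j)^{b₋} · e(…) and the changes of τ, ζ and ω are compatible with
products (`autFactor_mul`, `zetaAct_mul`, `omegaAct_mul`). Hence, if R transforms A and S transforms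
B, then RS transforms AB (`Transforms.mul`).

Rigidity. All components of Θ(i, 0, 0) are positive. If ζ + ω = -x with x ∈ M^*, the component at δ
is multiplied by the character e(-(x, δ)). By orthogonality of characters the values of Θ span
ℂ[D_M], so A determines R (`Transforms.unique`). Multiplicativity of A ↦ R is then automatic, and no
relation among generators has to be verified.

Generators. Every entry of A is det A times its own conjugate, so the entries are integral multiples
of one element of O. That element turns out to be a root of unity, and A is this root of unity times
a matrix of SL₂(ℤ) (`U11.exists_eq_scalar_mul_ofSL2`). For T and for scalars the identity holds term
by term; for S it is Poisson summation (`exists_thetaInversion`).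

Poisson summation is accessible because ⟨·,·⟩ vanishes when V_ℂ stands on the right or V_ℂ̄ on the
left. So ζ and ω enter only through ζ + ω, and in a real basis adapted to v each summand is a
diagonal Gaussian in 2b₊ + 2b₋ variables. Since 𝒟⁻¹ is the trace dual of O, the lattice dual to M
for the trace form is M^*. The number of variables of each sign is even, so no choice of square root
survives. The volume constant is carried along only as some C > 0; it is found afterwards by
evaluating at the fixed point i of S, where positivity and character orthogonality force C² |D_M| =
1 (`transforms_S`).

Uniqueness of ρ_M needs no theta function: the prescribed values on generators suffice
(`IsWeilRep.unique`). -/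

namespace HermitianJacobi

noncomputable section

/-! ### Poisson summation on ℝ^ι through Fourier series on the torus. -/

section Poisson

open MeasureTheory Complex Set

variable {ι : Type*}

/-- An integral vector, as a real vector. -/
def intVec (m : ι → ℤ) : ι → ℝ := fun i => m i

theorem intVec_add (m n : ι → ℤ) : intVec (m + n) = intVec m + intVec n := by
  ext i; simp [intVec]

/-- A uniform summability condition for the translates of `f` by integral vectors. -/
def LatticeSummable [Fintype ι] (f : (ι → ℝ) → ℂ) : Prop :=
  ∀ R : ℝ, ∃ u : (ι → ℤ) → ℝ, Summable u ∧ ∀ m x, ‖x‖ ≤ R → ‖f (x + intVec m)‖ ≤ u m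

/-- The periodization of a function on `ℝ^ι`. -/
def periodize (f : (ι → ℝ) → ℂ) (x : ι → ℝ) : ℂ := ∑' m : ι → ℤ, f (x + intVec m)

theorem LatticeSummable.continuous_periodize [Fintype ι] {f : (ι → ℝ) → ℂ} (hb : LatticeSummable f)
    (hf : Continuous f) : Continuous (periodize f) := by
  rw [continuous_iff_continuousAt]
  intro x₀
  obtain ⟨u, hu, hfu⟩ := hb (‖x₀‖ + 1)
  have : ContinuousOn (periodize f) (Metric.ball 0 (‖x₀‖ + 1)) := by
    refine continuousOn_tsum (fun m => (hf.comp (continuous_add_const _)).continuousOn) hu ?_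
    intro m x hx
    exact hfu m x (by simpa using (mem_ball_zero_iff.1 hx).le)
  exact this.continuousAt (Metric.isOpen_ball.mem_nhds (by simp))

theorem periodize_add_intVec (f : (ι → ℝ) → ℂ) (x : ι → ℝ) (n : ι → ℤ) :
    periodize f (x + intVec n) = periodize f x := by
  unfold periodize
  rw [← (Equiv.addLeft n).tsum_eq (fun m => f (x + intVec m))]
  simp [intVec_add, add_assoc]

/-- The projection of `ℝ^ι` to the torus. -/
def toTorus (x : ι → ℝ) : UnitAddTorus ι := fun i => (x i : UnitAddCircle)

theorem isOpenQuotientMap_toTorus : IsOpenQuotientMap (toTorus (ι := ι)) :=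
  IsOpenQuotientMap.piMap (f := fun _ : ι => fun t : ℝ => (t : UnitAddCircle))
    (fun _ => QuotientAddGroup.isOpenQuotientMap_mk)

theorem exists_eq_add_intVec_of_toTorus_eq {x y : ι → ℝ} (h : toTorus x = toTorus y) :
    ∃ n, x = y + intVec n := by
  have h1 : ∀ i, ∃ n : ℤ, x i = y i + n := by
    intro i
    have := congrFun h i
    simp only [toTorus] at this
    rw [QuotientAddGroup.eq_iff_sub_mem, AddSubgroup.mem_zmultiples_iff] at this
    obtain ⟨k, hk⟩ := this
    exact ⟨k, by simp at hk; linarith⟩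
  choose n hn using h1
  exact ⟨n, funext fun i => by simp [intVec, hn]⟩

theorem factorsThrough_periodize (f : (ι → ℝ) → ℂ) :
    Function.FactorsThrough (periodize f) toTorus := by
  intro x y hxy
  obtain ⟨n, rfl⟩ := exists_eq_add_intVec_of_toTorus_eq hxy
  exact periodize_add_intVec f y n

/-- The continuous function on the torus that a summable function on `ℝ^ι` induces. -/
def LatticeSummable.torusFun [Fintype ι] {f : (ι → ℝ) → ℂ} (hb : LatticeSummable f)
    (hf : Continuous f) : C(UnitAddTorus ι, ℂ) :=
  Topology.IsQuotientMap.lift (f := ⟨toTorus, isOpenQuotientMap_toTorus.continuous⟩)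
    isOpenQuotientMap_toTorus.isQuotientMap ⟨periodize f, hb.continuous_periodize hf⟩
    (factorsThrough_periodize f)

theorem LatticeSummable.torusFun_toTorus [Fintype ι] {f : (ι → ℝ) → ℂ} (hb : LatticeSummable f)
    (hf : Continuous f) (x : ι → ℝ) : hb.torusFun hf (toTorus x) = periodize f x :=
  congrArg (fun g : C(ι → ℝ, ℂ) => g x)
    (Topology.IsQuotientMap.lift_comp
      (f := ⟨toTorus, isOpenQuotientMap_toTorus.continuous⟩)
      isOpenQuotientMap_toTorus.isQuotientMap ⟨periodize f, hb.continuous_periodize hf⟩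
      (factorsThrough_periodize f))

/-- The half-open unit cube with lowest vertex `m`. -/
def cube (m : ι → ℤ) : Set (ι → ℝ) := {x | ∀ i, x i ∈ Ioc (m i : ℝ) (m i + 1)}

theorem cube_eq_pi (m : ι → ℤ) : cube m = Set.pi univ (fun i => Ioc (m i : ℝ) (m i + 1)) := by
  ext; simp [cube]

theorem measurableSet_cube [Fintype ι] (m : ι → ℤ) : MeasurableSet (cube m) := by
  rw [cube_eq_pi]
  exact MeasurableSet.univ_pi fun i => measurableSet_Ioc

theorem iUnion_cube : ⋃ m : ι → ℤ, cube m = univ := by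
  refine eq_univ_of_forall fun x => mem_iUnion.2 ⟨fun i => ⌈x i⌉ - 1, fun i => ?_⟩
  push_cast
  constructor
  · linarith [Int.ceil_lt_add_one (x i)]
  · linarith [Int.le_ceil (x i)]

theorem pairwise_disjoint_cube : Pairwise (Function.onFun Disjoint (cube (ι := ι))) := by
  intro m n hmn
  refine disjoint_left.2 fun x hx hy => hmn (funext fun i => ?_)
  have h1 := hx i
  have h2 := hy i
  have h3 : (m i : ℝ) < n i + 1 := h1.1.trans_le h2.2
  have h4 : (n i : ℝ) < m i + 1 := h2.1.trans_le h1.2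
  norm_cast at h3 h4
  omega

theorem setIntegral_cube [Fintype ι] (g : (ι → ℝ) → ℂ) (m : ι → ℤ) :
    ∫ x in cube m, g x = ∫ x in cube 0, g (x + intVec m) := by
  rw [← (measurePreserving_add_right volume (intVec m)).setIntegral_preimage_emb
    (MeasurableEquiv.addRight (intVec m)).measurableEmbedding]
  congr 2
  ext x
  simp only [cube, intVec, mem_preimage, mem_ofPred_eq, Pi.add_apply, Pi.zero_apply, Int.cast_zero,
    zero_add, mem_Ioc]
  refine forall_congr' fun i => and_congr ?_ ?_ <;> constructor <;> intro h <;> linarith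

theorem volume_cube_zero [Fintype ι] : volume (cube (0 : ι → ℤ)) = 1 := by
  rw [cube_eq_pi, volume_pi_pi]
  simp

theorem norm_le_one_of_mem_cube_zero [Fintype ι] {x : ι → ℝ} (hx : x ∈ cube (0 : ι → ℤ)) : ‖x‖ ≤ 1 := by
  refine (pi_norm_le_iff_of_nonneg zero_le_one).2 fun i => ?_
  have := hx i
  simp only [Pi.zero_apply, Int.cast_zero, zero_add, mem_Ioc] at this
  rw [Real.norm_eq_abs, abs_of_pos this.1]
  exact this.2

/-- Unfolding: the translates of the unit cube tile the space. The uniform majorant, together with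
the unit volume of the cube, allows sum and integral to be exchanged. -/
theorem LatticeSummable.integral_eq [Fintype ι] {g : (ι → ℝ) → ℂ} (hb : LatticeSummable g)
    (hint : Integrable g) : ∫ x, g x = ∫ x in cube 0, periodize g x := by
  obtain ⟨u, hu, hgu⟩ := hb 1
  have hfin : IsFiniteMeasure (volume.restrict (cube (0 : ι → ℤ))) :=
    ⟨by simp [volume_cube_zero]⟩
  have hle : ∀ m, ∀ᵐ x ∂(volume.restrict (cube (0 : ι → ℤ))), ‖g (x + intVec m)‖ ≤ u m := by
    intro m
    filter_upwards [ae_restrict_mem (measurableSet_cube 0)] with x hx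
    exact hgu m x (norm_le_one_of_mem_cube_zero hx)
  have hI : ∀ m, Integrable (fun x => g (x + intVec m)) (volume.restrict (cube (0 : ι → ℤ))) :=
    fun m => (hint.comp_add_right _).restrict
  have h1 := hasSum_integral_iUnion (μ := volume) (f := g) (fun m => measurableSet_cube (ι := ι) m)
    pairwise_disjoint_cube (by rw [iUnion_cube]; exact hint.integrableOn)
  rw [iUnion_cube, setIntegral_univ] at h1
  rw [← h1.tsum_eq]
  rw [tsum_congr fun m => setIntegral_cube g m]
  refine integral_tsum_of_summable_integral_norm hI ?_
  refine Summable.of_nonneg_of_le (fun m => integral_nonneg fun x => norm_nonneg _) (fun m => ?_) hu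
  refine (integral_mono_ae (hI m).norm (integrable_const (u m)) (hle m)).trans ?_
  simp [Measure.real, volume_cube_zero]

theorem mFourier_toTorus [Fintype ι] (n : ι → ℤ) (x : ι → ℝ) :
    UnitAddTorus.mFourier n (toTorus x) = cexp (2 * Real.pi * I * ∑ i, (n i : ℂ) * x i) := by
  simp only [UnitAddTorus.mFourier, ContinuousMap.coe_mk, toTorus, fourier_coe_apply,
    ← Complex.exp_sum, Finset.mul_sum]
  congr 1
  refine Finset.sum_congr rfl fun i _ => ?_
  simp; ring

theorem mFourier_toTorus_add [Fintype ι] (n m : ι → ℤ) (x : ι → ℝ) :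
    UnitAddTorus.mFourier n (toTorus (x + intVec m)) = UnitAddTorus.mFourier n (toTorus x) := by
  congr 1
  ext i
  simp only [toTorus, intVec, Pi.add_apply, AddCircle.coe_add]
  rw [show ((m i : ℝ) : UnitAddCircle) = 0 from by
    rw [AddCircle.coe_eq_zero_iff]; exact ⟨m i, by simp⟩, add_zero]

/-- The Poisson summation formula in several variables. -/
theorem LatticeSummable.tsum_eq_tsum_integral [Fintype ι] {f : (ι → ℝ) → ℂ} (hb : LatticeSummable f)
    (hf : Continuous f) (hint : Integrable f)
    (hs : Summable fun n : ι → ℤ =>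
      ∫ x, cexp (-(2 * Real.pi * I * ∑ i, (n i : ℂ) * x i)) * f x) :
    ∑' m : ι → ℤ, f (intVec m)
      = ∑' n : ι → ℤ, ∫ x, cexp (-(2 * Real.pi * I * ∑ i, (n i : ℂ) * x i)) * f x := by
  have hchar : ∀ (n : ι → ℤ) (x : ι → ℝ),
      cexp (-(2 * Real.pi * I * ∑ i, (n i : ℂ) * x i))
        = UnitAddTorus.mFourier (-n) (toTorus x) := by
    intro n x
    rw [mFourier_toTorus]
    simp [Finset.sum_neg_distrib]
  have hnorm : ∀ (n : ι → ℤ) (x : ι → ℝ), ‖UnitAddTorus.mFourier n (toTorus x)‖ ≤ 1 := by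
    intro n x
    have := (UnitAddTorus.mFourier n).norm_coe_le_norm (toTorus x)
    rwa [UnitAddTorus.mFourier_norm] at this
  have hcont : ∀ n : ι → ℤ, Continuous fun x : ι → ℝ => UnitAddTorus.mFourier n (toTorus x) :=
    fun n => (UnitAddTorus.mFourier n).continuous.comp isOpenQuotientMap_toTorus.continuous
  -- A Fourier coefficient of the periodization is a Fourier transform of `f`: the character is
  -- invariant under integral translations, so it moves inside the periodization, and unfolding
  -- applies to the product.
  have hcoef : ∀ n : ι → ℤ, UnitAddTorus.mFourierCoeff (hb.torusFun hf) n
      = ∫ x, cexp (-(2 * Real.pi * I * ∑ i, (n i : ℂ) * x i)) * f x := by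
    intro n
    simp_rw [hchar]
    have hb' : LatticeSummable fun x => UnitAddTorus.mFourier (-n) (toTorus x) * f x := by
      intro R
      obtain ⟨u, hu, hfu⟩ := hb R
      refine ⟨u, hu, fun m x hx => ?_⟩
      rw [norm_mul]
      exact (mul_le_of_le_one_left (norm_nonneg _) (hnorm _ _)).trans (hfu m x hx)
    rw [hb'.integral_eq
      (hint.bdd_mul (hcont _).aestronglyMeasurable (Filter.Eventually.of_forall (hnorm (-n)))),
      UnitAddTorus.mFourierCoeff_eq_integral _ _ 0]
    have hset : {x : ι → ℝ | ∀ i, x i ∈ Ioc ((0 : ι → ℝ) i) ((0 : ι → ℝ) i + 1)} = cube 0 := by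
      ext; simp [cube]
    rw [hset]
    congr 1
    ext x
    change UnitAddTorus.mFourier (-n) (toTorus x) • hb.torusFun hf (toTorus x) = _
    rw [hb.torusFun_toTorus, smul_eq_mul, periodize, periodize, ← tsum_mul_left]
    simp_rw [mFourier_toTorus_add]
  -- With summable coefficients the Fourier series converges pointwise to the continuous
  -- periodization; the formula is its value at the origin.
  have h := UnitAddTorus.hasSum_mFourier_series_apply_of_summable (f := hb.torusFun hf)
    (by simpa only [funext hcoef] using hs) (toTorus 0)
  rw [hb.torusFun_toTorus] at h
  simp_rw [hcoef, mFourier_toTorus] at h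
  simp only [Pi.zero_apply, ofReal_zero, mul_zero, Finset.sum_const_zero, Complex.exp_zero,
    smul_eq_mul, mul_one] at h
  rw [h.tsum_eq, periodize]
  simp

end Poisson

/-! ### Gaussian sums over a lattice and over its dual. -/

section Gaussian

open MeasureTheory Complex Set

variable {ι κ : Type*} [Fintype ι] [Fintype κ]

/-- The exponential of a diagonal quadratic polynomial. -/
def gauss (β c : κ → ℂ) (y : κ → ℝ) : ℂ :=
  cexp (-∑ k, β k * (y k : ℂ) ^ 2 + ∑ k, c k * y k)

theorem continuous_gauss (β c : κ → ℂ) : Continuous (gauss β c) := by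
  unfold gauss; fun_prop

theorem norm_gauss (β c : κ → ℂ) (y : κ → ℝ) :
    ‖gauss β c y‖ = ∏ k, Real.exp (-(β k).re * y k ^ 2 + (c k).re * y k) := by
  rw [gauss, Complex.norm_exp, ← Real.exp_sum, Finset.sum_add_distrib]
  congr 1
  rw [add_re, neg_re, re_sum, re_sum, ← Finset.sum_neg_distrib]
  congr 1
  · refine Finset.sum_congr rfl fun k _ => ?_
    rw [← ofReal_pow, re_mul_ofReal]; ring
  · exact Finset.sum_congr rfl fun k _ => re_mul_ofReal _ _

/-- The power is at most N! · exp(1 + |t|), and completing the square in |t| bounds the resulting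
exponent. -/
theorem exp_quadratic_mul_pow_le {b : ℝ} (hb : 0 < b) (c : ℝ) (N : ℕ) (t : ℝ) :
    Real.exp (-b * t ^ 2 + c * t) * (1 + |t|) ^ N
      ≤ N.factorial * Real.exp (1 + (|c| + 1) ^ 2 / (4 * b)) := by
  have h1 : (1 + |t|) ^ N ≤ N.factorial * Real.exp (1 + |t|) := by
    have := Real.pow_div_factorial_le_exp (1 + |t|) (by positivity) N
    rwa [div_le_iff₀' (by positivity)] at this
  have h2 : -b * t ^ 2 + c * t + (1 + |t|) ≤ 1 + (|c| + 1) ^ 2 / (4 * b) := by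
    have h3 : c * t ≤ |c| * |t| := by rw [← abs_mul]; exact le_abs_self _
    have h4 : -b * |t| ^ 2 + (|c| + 1) * |t| ≤ (|c| + 1) ^ 2 / (4 * b) := by
      rw [le_div_iff₀ (by positivity)]
      nlinarith [sq_nonneg (2 * b * |t| - (|c| + 1))]
    rw [sq_abs] at h4
    linarith
  calc _ ≤ Real.exp (-b * t ^ 2 + c * t) * (N.factorial * Real.exp (1 + |t|)) := by gcongr
    _ = N.factorial * Real.exp (-b * t ^ 2 + c * t + (1 + |t|)) := by rw [Real.exp_add _ (1 + |t|)]; ring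
    _ ≤ _ := by gcongr

theorem one_add_norm_le_prod (y : κ → ℝ) : 1 + ‖y‖ ≤ ∏ k, (1 + |y k|) := by
  classical
  have h1 : ∀ s : Finset κ, 1 ≤ ∏ k ∈ s, (1 + |y k|) := fun s =>
    Finset.one_le_prod fun k _ => by linarith [abs_nonneg (y k)]
  have : ‖y‖ ≤ ∏ k, (1 + |y k|) - 1 := by
    refine (pi_norm_le_iff_of_nonneg (by linarith [h1 Finset.univ])).2 fun k => ?_
    rw [← Finset.mul_prod_erase _ _ (Finset.mem_univ k), Real.norm_eq_abs]
    nlinarith [h1 (Finset.univ.erase k), abs_nonneg (y k)]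
  linarith

theorem norm_gauss_mul_pow_le {β : κ → ℂ} (hβ : ∀ k, 0 < (β k).re) (c : κ → ℂ) (N : ℕ) :
    ∃ A : ℝ, ∀ y, ‖gauss β c y‖ * (1 + ‖y‖) ^ N ≤ A := by
  refine ⟨∏ k, (N.factorial * Real.exp (1 + (|(c k).re| + 1) ^ 2 / (4 * (β k).re))), fun y => ?_⟩
  calc _ ≤ ‖gauss β c y‖ * (∏ k, (1 + |y k|)) ^ N := by
        gcongr; exact one_add_norm_le_prod y
    _ = ∏ k, (Real.exp (-(β k).re * y k ^ 2 + (c k).re * y k) * (1 + |y k|) ^ N) := by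
        rw [norm_gauss, ← Finset.prod_pow, Finset.prod_mul_distrib]
    _ ≤ _ := Finset.prod_le_prod (fun k _ => by positivity)
        fun k _ => exp_quadratic_mul_pow_le (hβ k) _ N _

theorem summable_prod_of_nonneg {g : ℤ → ℝ} (hg : Summable g) (h0 : ∀ n, 0 ≤ g n) :
    Summable fun m : ι → ℤ => ∏ i, g (m i) := by
  classical
  refine summable_of_sum_le (c := (∑' n, g n) ^ Fintype.card ι)
    (fun m => Finset.prod_nonneg fun i _ => h0 _) fun s => ?_
  calc _ ≤ ∑ m ∈ Fintype.piFinset fun i => s.image fun m => m i, ∏ i, g (m i) := by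
        refine Finset.sum_le_sum_of_subset_of_nonneg ?_
          fun m _ _ => Finset.prod_nonneg fun i _ => h0 _
        intro m hm
        exact Fintype.mem_piFinset.2 fun i => Finset.mem_image_of_mem _ hm
    _ = ∏ i : ι, ∑ n ∈ s.image fun m => m i, g n := (Finset.prod_univ_sum _ _).symm
    _ ≤ ∏ _i : ι, ∑' n, g n := Finset.prod_le_prod
        (fun i _ => Finset.sum_nonneg fun n _ => h0 n)
        fun i _ => hg.sum_le_tsum _ fun n _ => h0 n
    _ = _ := by simp

theorem summable_inv_one_add_abs_sq : Summable fun n : ℤ => ((1 + |(n : ℝ)|) ^ 2)⁻¹ := by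
  have h : Summable fun n : ℕ => ((1 + (n : ℝ)) ^ 2)⁻¹ := by
    have := (summable_nat_add_iff 1).2 (Real.summable_nat_pow_inv.2 one_lt_two)
    simpa [add_comm] using this
  refine Summable.of_nat_of_neg ?_ ?_ <;> simpa using h

variable (E : (ι → ℝ) ≃ₗ[ℝ] (κ → ℝ))

/-- The Gaussian decays faster than any power of the norm. With exponent twice the dimension, this
power dominates the product of all (1 + |m_i|)², whose inverse is summable over ℤ^ι. -/
theorem latticeSummable_gauss {β : κ → ℂ} (hβ : ∀ k, 0 < (β k).re) (c : κ → ℂ) (a : κ → ℝ) :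
    LatticeSummable fun x => gauss β c (a + E x) := by
  intro R
  set N := 2 * Fintype.card ι
  obtain ⟨A, hA⟩ := norm_gauss_mul_pow_le hβ c N
  let E' := LinearMap.toContinuousLinearMap E.symm.toLinearMap
  set D := 1 + ‖E'‖ * (1 + ‖a‖) + |R|
  have hD : 0 < D := by positivity
  refine ⟨fun m => A * D ^ N * ∏ i, ((1 + |(m i : ℝ)|) ^ 2)⁻¹,
    (summable_prod_of_nonneg summable_inv_one_add_abs_sq fun n => by positivity).mul_left _,
    fun m x hx => ?_⟩
  set y := a + E (x + intVec m)
  have h1 : ‖intVec m‖ ≤ ‖E'‖ * (‖y‖ + ‖a‖) + |R| := by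
    have h2 : intVec m = E' (y - a) - x := by simp [y, E']
    rw [h2]
    refine (norm_sub_le _ _).trans (add_le_add ?_ (hx.trans (le_abs_self _)))
    exact (E'.le_opNorm _).trans (by gcongr; exact norm_sub_le _ _)
  have h2 : 1 + ‖intVec m‖ ≤ D * (1 + ‖y‖) := by
    have e1 := norm_nonneg E'
    have e2 := norm_nonneg y
    have e3 := norm_nonneg a
    have e4 := abs_nonneg R
    have e5 : 0 ≤ ‖E'‖ * ‖a‖ * ‖y‖ := by positivity
    have e6 : 0 ≤ |R| * ‖y‖ := by positivity
    simp only [D]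
    nlinarith
  have h3 : ∏ i, (1 + |(m i : ℝ)|) ^ 2 ≤ (D * (1 + ‖y‖)) ^ N := by
    calc _ ≤ ∏ _i : ι, (D * (1 + ‖y‖)) ^ 2 := by
          refine Finset.prod_le_prod (fun i _ => by positivity) fun i _ => ?_
          have := norm_le_pi_norm (intVec m) i
          rw [Real.norm_eq_abs] at this
          gcongr
          exact (add_le_add_right this 1).trans h2
      _ = _ := by rw [Finset.prod_const, ← pow_mul, Finset.card_univ]
  have hy : 0 < (1 + ‖y‖) ^ N := by positivity
  have hP : 0 < ∏ i, (1 + |(m i : ℝ)|) ^ 2 := Finset.prod_pos fun i _ => by positivity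
  change ‖gauss β c y‖ ≤ A * D ^ N * ∏ i, ((1 + |(m i : ℝ)|) ^ 2)⁻¹
  rw [Finset.prod_inv_distrib, ← div_eq_mul_inv, le_div_iff₀ hP]
  calc _ ≤ ‖gauss β c y‖ * (D * (1 + ‖y‖)) ^ N := by gcongr
    _ = (‖gauss β c y‖ * (1 + ‖y‖) ^ N) * D ^ N := by rw [mul_pow]; ring
    _ ≤ _ := by gcongr; exact hA y

theorem summable_norm_gauss {β : κ → ℂ} (hβ : ∀ k, 0 < (β k).re) (c : κ → ℂ) (a : κ → ℝ) :
    Summable fun m : ι → ℤ => ‖gauss β c (a + E (intVec m))‖ := by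
  obtain ⟨u, hu, h⟩ := latticeSummable_gauss E hβ c a 0
  exact Summable.of_nonneg_of_le (fun m => norm_nonneg _)
    (fun m => by simpa using h m 0 (by simp)) hu

/-- Uniqueness of Haar measure. The constant is the inverse of the absolute determinant of `E`, but
only its positivity is retained, because its effect on theta functions is computed later by
normalization. -/
theorem exists_integral_comp_eq :
    ∃ C : ℝ, 0 < C ∧ ∀ g : (κ → ℝ) → ℂ, Integrable g →
      Integrable (fun x => g (E x)) ∧ ∫ x, g (E x) = C * ∫ y, g y := by
  let E' := E.toContinuousLinearEquiv
  have : (Measure.map E' (volume : Measure (ι → ℝ))).IsAddHaarMeasure :=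
    E'.isAddHaarMeasure_map volume
  set c := Measure.addHaarScalarFactor (Measure.map E' (volume : Measure (ι → ℝ))) volume
  have hc : Measure.map E' volume = c • (volume : Measure (κ → ℝ)) :=
    Measure.isAddLeftInvariant_eq_smul _ _
  have hpos : 0 < c := Measure.addHaarScalarFactor_pos_of_isAddHaarMeasure _ _
  refine ⟨c, hpos, fun g hg => ⟨?_, ?_⟩⟩
  · have : Integrable g (Measure.map E' volume) := by
      rw [hc]; exact hg.smul_measure_nnreal
    exact (E'.toHomeomorph.measurableEmbedding.integrable_map_iff).1 this
  · have := E'.toHomeomorph.measurableEmbedding.integral_map (μ := volume) g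
    change ∫ y, g y ∂(Measure.map E' volume) = ∫ x, g (E x) at this
    rw [← this, hc, integral_smul_nnreal_measure, NNReal.smul_def, Complex.real_smul]

/-- The transformation formula of the Gaussian sums over a lattice and over its dual. -/
theorem exists_tsum_gauss_eq (E' : (ι → ℝ) ≃ₗ[ℝ] (κ → ℝ))
    (hE : ∀ s t, ∑ i, s i * t i = ∑ k, E' s k * E t k) :
    ∃ C : ℝ, 0 < C ∧ ∀ (β c : κ → ℂ) (a : κ → ℝ), (∀ k, 0 < (β k).re) →
      ∑' m : ι → ℤ, gauss β c (a + E (intVec m))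
        = C * ∑' n : ι → ℤ, (∏ k, (Real.pi / β k) ^ (1 / 2 : ℂ)) *
          cexp (∑ k, (c k - 2 * Real.pi * I * E' (intVec n) k) ^ 2 / (4 * β k)
            + 2 * Real.pi * I * ∑ k, (E' (intVec n) k : ℂ) * a k) := by
  obtain ⟨C, hC, hint⟩ := exists_integral_comp_eq E
  refine ⟨C, hC, fun β c a hβ => ?_⟩
  have hβ0 : ∀ k, β k ≠ 0 := fun k h => by have := hβ k; simp [h] at this
  have hgi : ∀ d : κ → ℂ, Integrable (gauss β d) := fun d =>
    GaussianFourier.integrable_cexp_neg_sum_mul_add hβ d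
  have hI : ∀ n : ι → ℤ,
      ∫ x : ι → ℝ, cexp (-(2 * Real.pi * I * ∑ i, (n i : ℂ) * x i)) * gauss β c (a + E x)
        = C * ((∏ k, (Real.pi / β k) ^ (1 / 2 : ℂ)) *
          cexp (∑ k, (c k - 2 * Real.pi * I * E' (intVec n) k) ^ 2 / (4 * β k)
            + 2 * Real.pi * I * ∑ k, (E' (intVec n) k : ℂ) * a k)) := by
    intro n
    -- By duality of `E` and `E'` the character is linear in `E x`. It is absorbed into the linear
    -- coefficient, and the shift by `a` leaves a constant phase behind.
    set d : κ → ℂ := fun k => c k - 2 * Real.pi * I * E' (intVec n) k with hd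
    have h1 : ∀ x : ι → ℝ,
        cexp (-(2 * Real.pi * I * ∑ i, (n i : ℂ) * x i)) * gauss β c (a + E x)
          = cexp (2 * Real.pi * I * ∑ k, (E' (intVec n) k : ℂ) * a k) * gauss β d (a + E x) := by
      intro x
      have h2 : ∑ i, (n i : ℂ) * x i = ∑ k, (E' (intVec n) k : ℂ) * E x k := by
        have := congrArg (fun r : ℝ => (r : ℂ)) (hE (intVec n) x)
        simpa [intVec] using this
      rw [h2, gauss, gauss, ← Complex.exp_add, ← Complex.exp_add]
      congr 1
      simp only [hd, sub_mul, Finset.sum_sub_distrib, Pi.add_apply, ofReal_add, mul_add,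
        Finset.sum_add_distrib, Finset.mul_sum, mul_assoc]
      ring
    simp_rw [h1]
    rw [integral_const_mul, (hint (fun y => gauss β d (a + y)) ((hgi d).comp_add_left a)).2,
      integral_add_left_eq_self (gauss β d) a]
    unfold gauss
    rw [GaussianFourier.integral_cexp_neg_sum_mul_add hβ, Finset.prod_mul_distrib,
      ← Complex.exp_sum, Complex.exp_add]
    ring
  -- Expanding the square shows that the dual series is again Gaussian, with quadratic coefficients
  -- π²/β, whose real parts are positive too.
  have hS : Summable fun n : ι → ℤ =>
      cexp (∑ k, (c k - 2 * Real.pi * I * E' (intVec n) k) ^ 2 / (4 * β k)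
            + 2 * Real.pi * I * ∑ k, (E' (intVec n) k : ℂ) * a k) := by
    have hβ' : ∀ k, 0 < ((Real.pi : ℂ) ^ 2 / β k).re := by
      intro k
      rw [← ofReal_pow, div_eq_mul_inv, re_ofReal_mul, inv_re]
      have := hβ k
      have := normSq_pos.2 (hβ0 k)
      positivity
    have h3 := (summable_norm_gauss E' hβ'
      (fun k => -(Real.pi * I * c k / β k) + 2 * Real.pi * I * a k) 0).of_norm
    refine (h3.mul_left (cexp (∑ k, c k ^ 2 / (4 * β k)))).congr fun n => ?_
    rw [gauss, ← Complex.exp_add]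
    congr 1
    simp only [zero_add, Finset.mul_sum, ← Finset.sum_add_distrib, ← Finset.sum_neg_distrib]
    refine Finset.sum_congr rfl fun k _ => ?_
    field_simp [hβ0 k]
    ring_nf
    simp only [I_sq]
    ring
  have hb := latticeSummable_gauss E hβ c a
  rw [hb.tsum_eq_tsum_integral ((continuous_gauss β c).comp (by
      have := (LinearMap.continuous_of_finiteDimensional E.toLinearMap)
      exact continuous_const.add this))
    (hint (fun y => gauss β c (a + y)) ((hgi c).comp_add_left a)).1]
  · simp_rw [hI]
    rw [tsum_mul_left]
  · simp_rw [hI]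
    exact (hS.mul_left _).mul_left _

end Gaussian

/-! ### Orders in imaginary quadratic fields; the inverse different as a trace dual. -/

section QuadraticField

variable {K : Type*} [Field K]

theorem conj_embedding_ne [NumberField.IsTotallyComplex K] (φ : K →+* ℂ) :
    (starRingEnd ℂ).comp φ ≠ φ := by
  intro hφ
  have h1 : NumberField.ComplexEmbedding.IsReal φ := by
    rw [NumberField.ComplexEmbedding.isReal_iff]
    exact hφ
  have h2 := NumberField.IsTotallyComplex.isComplex (NumberField.InfinitePlace.mk φ)
  rw [NumberField.InfinitePlace.isComplex_mk_iff] at h2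
  exact h2 h1

theorem embedding_eq_or [NumberField K] [NumberField.IsTotallyComplex K] (hK : Module.finrank ℚ K = 2)
    (φ ψ : K →+* ℂ) : ψ = φ ∨ ψ = (starRingEnd ℂ).comp φ := by
  classical
  have hcard : Fintype.card (K →+* ℂ) = 2 := by rw [NumberField.Embeddings.card, hK]
  have h2 : ({φ, (starRingEnd ℂ).comp φ} : Finset (K →+* ℂ)) = Finset.univ := by
    apply Finset.eq_univ_of_card
    rw [hcard, Finset.card_pair (conj_embedding_ne φ).symm]
  have : ψ ∈ ({φ, (starRingEnd ℂ).comp φ} : Finset (K →+* ℂ)) := h2 ▸ Finset.mem_univ ψ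
  simpa using this

theorem coe_trace_eq [NumberField K] [NumberField.IsTotallyComplex K] (hK : Module.finrank ℚ K = 2)
    (φ : K →+* ℂ) (x : K) : (Algebra.trace ℚ K x : ℂ) = φ x + conj (φ x) := by
  classical
  have h1 := trace_eq_sum_embeddings (K := ℚ) (L := K) ℂ (x := x)
  rw [eq_ratCast] at h1
  rw [h1]
  have hcard : Fintype.card (K →ₐ[ℚ] ℂ) = 2 := by rw [AlgHom.card, hK]
  have hne : φ.toRatAlgHom ≠ ((starRingEnd ℂ).comp φ).toRatAlgHom := by
    intro h
    apply conj_embedding_ne φ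
    ext y
    exact (DFunLike.congr_fun h y).symm
  have h2 : ({φ.toRatAlgHom, ((starRingEnd ℂ).comp φ).toRatAlgHom} : Finset (K →ₐ[ℚ] ℂ))
      = Finset.univ := by
    apply Finset.eq_univ_of_card
    rw [hcard, Finset.card_pair hne]
  rw [← h2, Finset.sum_pair hne]
  rfl

theorem exists_rat_of_conj_eq [NumberField K] [NumberField.IsTotallyComplex K] (hK : Module.finrank ℚ K = 2)
    (φ : K →+* ℂ) {x : K} (hx : conj (φ x) = φ x) : ∃ q : ℚ, x = q := by
  refine ⟨Algebra.trace ℚ K x / 2, φ.injective ?_⟩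
  rw [map_ratCast]
  push_cast
  rw [coe_trace_eq hK φ, hx]
  ring

variable {O : Subring K}

theorem IsQuadraticOrder.isIntegral (hO : IsQuadraticOrder O) (x : O) : IsIntegral ℤ (x : K) := by
  obtain ⟨b⟩ := hO
  have : Module.Finite ℤ O := Module.Finite.of_basis b
  exact (IsIntegral.of_finite ℤ x).map (O.subtype.toIntAlgHom)

theorem IsQuadraticOrder.exists_int_trace [NumberField K] (hO : IsQuadraticOrder O) (x : O) :
    ∃ n : ℤ, Algebra.trace ℚ K (x : K) = n := by
  have := Algebra.isIntegral_trace (L := ℚ) (hO.isIntegral x)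
  obtain ⟨n, hn⟩ := IsIntegrallyClosed.isIntegral_iff.1 this
  exact ⟨n, by simpa using hn.symm⟩

theorem IsQuadraticOrder.exists_conj [NumberField K] [NumberField.IsTotallyComplex K]
    (hO : IsQuadraticOrder O) (hK : Module.finrank ℚ K = 2) (φ : K →+* ℂ) (x : O) :
    ∃ y : O, φ y = conj (φ x) := by
  obtain ⟨n, hn⟩ := hO.exists_int_trace x
  refine ⟨n - x, ?_⟩
  have := coe_trace_eq hK φ x
  rw [hn] at this
  push_cast at this
  rw [AddSubgroupClass.coe_sub, Subring.coe_intCast, map_sub, map_intCast, this]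
  ring

theorem IsQuadraticOrder.exists_int_of_conj_eq [NumberField K] [NumberField.IsTotallyComplex K]
    (hO : IsQuadraticOrder O) (hK : Module.finrank ℚ K = 2) (φ : K →+* ℂ) {x : O}
    (hx : conj (φ x) = φ x) : ∃ n : ℤ, (x : K) = n := by
  obtain ⟨q, hq⟩ := exists_rat_of_conj_eq hK φ hx
  have h1 := hO.isIntegral x
  rw [hq] at h1
  have h2 : IsIntegral ℤ q := by
    rw [← isIntegral_algebraMap_iff (algebraMap ℚ K).injective]
    simpa using h1
  obtain ⟨n, hn⟩ := IsIntegrallyClosed.isIntegral_iff.1 h2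
  refine ⟨n, ?_⟩
  rw [hq, ← hn]
  simp

/-- A `ℤ`-basis of an order is a `ℚ`-basis of the field. -/
theorem exists_rat_basis [NumberField K] (hK : Module.finrank ℚ K = 2) (b : Module.Basis (Fin 2) ℤ O) :
    ∃ bK : Module.Basis (Fin 2) ℚ K, ∀ i, bK i = b i := by
  have hli : LinearIndependent ℤ (fun i => (b i : K)) :=
    b.linearIndependent.map' (O.subtype.toAddMonoidHom.toIntLinearMap)
      (LinearMap.ker_eq_bot.2 Subtype.val_injective)
  rw [LinearIndependent.iff_fractionRing (R := ℤ) (K := ℚ)] at hli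
  refine ⟨basisOfLinearIndependentOfCardEqFinrank hli (by simp [hK]), fun i => by simp⟩

theorem trace_int_eq [NumberField K] (hK : Module.finrank ℚ K = 2) (b : Module.Basis (Fin 2) ℤ O) (x : O) :
    (Algebra.trace ℤ O x : ℚ) = Algebra.trace ℚ K (x : K) := by
  obtain ⟨bK, hbK⟩ := exists_rat_basis hK b
  rw [Algebra.trace_eq_matrix_trace b, Algebra.trace_eq_matrix_trace bK, Matrix.trace,
    Matrix.trace, Int.cast_sum]
  refine Finset.sum_congr rfl fun i _ => ?_
  rw [Matrix.diag_apply, Matrix.diag_apply, Algebra.leftMulMatrix_eq_repr_mul,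
    Algebra.leftMulMatrix_eq_repr_mul]
  have h1 : (x : K) * bK i = ∑ j, ((b.repr (x * b i) j : ℤ) : ℚ) • bK j := by
    have := congrArg (fun y : O => (y : K)) (b.sum_repr (x * b i))
    simp only [Subring.coe_mul] at this
    rw [hbK, ← this]
    push_cast
    refine Finset.sum_congr rfl fun j _ => ?_
    rw [hbK, Int.cast_smul_eq_zsmul]
  rw [h1, bK.repr_sum_self]

/-- The determinant of the embeddings of a basis of an order. -/
def basisDet (φ : K →+* ℂ) (b : Module.Basis (Fin 2) ℤ O) : ℂ :=
  φ (b 0) * conj (φ (b 1)) - φ (b 1) * conj (φ (b 0))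

theorem discr_eq_basisDet_sq [NumberField K] [NumberField.IsTotallyComplex K] (hK : Module.finrank ℚ K = 2)
    (φ : K →+* ℂ) (b : Module.Basis (Fin 2) ℤ O) :
    (Algebra.discr ℤ b : ℂ) = basisDet φ b ^ 2 := by
  have ht : ∀ x : O, (Algebra.trace ℤ O x : ℂ) = φ x + conj (φ x) := by
    intro x
    rw [← coe_trace_eq hK φ, ← trace_int_eq hK b]
    simp
  rw [Algebra.discr_def, Matrix.det_fin_two]
  simp only [Algebra.traceMatrix_apply, Algebra.traceForm_apply]
  push_cast
  simp only [ht, basisDet]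
  push_cast
  simp only [map_mul]
  ring

theorem conj_basisDet (φ : K →+* ℂ) (b : Module.Basis (Fin 2) ℤ O) :
    conj (basisDet φ b) = -basisDet φ b := by
  simp only [basisDet, map_sub, map_mul, Complex.conj_conj]; ring

/-- If it vanished, the quotient of the two basis elements would be real, hence rational, against
linear independence over ℚ. -/
theorem basisDet_ne_zero [NumberField K] [NumberField.IsTotallyComplex K] (hK : Module.finrank ℚ K = 2)
    (φ : K →+* ℂ) (b : Module.Basis (Fin 2) ℤ O) : basisDet φ b ≠ 0 := by
  intro h0
  obtain ⟨bK, hbK⟩ := exists_rat_basis hK b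
  have hb1 : (b 1 : K) ≠ 0 := by rw [← hbK]; exact bK.ne_zero 1
  have h1 : φ (b 1) ≠ 0 := (map_ne_zero φ).2 hb1
  have h2 : conj (φ (b 1)) ≠ 0 := (map_ne_zero _).2 h1
  obtain ⟨q, hq⟩ := exists_rat_of_conj_eq hK φ (x := (b 0 : K) / b 1) (by
    rw [map_div₀, map_div₀, div_eq_div_iff h2 h1]
    rw [basisDet] at h0
    linear_combination -h0)
  have h3 : bK 0 = q • bK 1 := by
    rw [hbK, hbK, Rat.smul_def, ← hq, div_mul_cancel₀ _ hb1]
  have h4 := congrArg (fun y => bK.repr y 0) h3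
  simp at h4

/-- The determinant of the embeddings squares to the discriminant and is purely imaginary, so the
discriminant is not positive and the real square root in `sqrtDiscr` is genuine. The sign depends on
the orientation of the basis. -/
theorem sqrtDiscr_eq_or [NumberField K] [NumberField.IsTotallyComplex K] (hK : Module.finrank ℚ K = 2)
    (φ : K →+* ℂ) (hO : IsQuadraticOrder O) : ∃ b : Module.Basis (Fin 2) ℤ O,
      sqrtDiscr O = basisDet φ b ∨ sqrtDiscr O = -basisDet φ b := by
  have h : Nonempty (Module.Basis (Fin 2) ℤ O) := hO
  refine ⟨h.some, sq_eq_sq_iff_eq_or_eq_neg.1 ?_⟩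
  have h1 := discr_eq_basisDet_sq hK φ h.some
  have h2 : orderDiscr O = Algebra.discr ℤ h.some := by rw [orderDiscr, dif_pos h]
  have h3 : (0 : ℝ) ≤ -(orderDiscr O : ℝ) := by
    have h4 : ((orderDiscr O : ℝ) : ℂ) = -(Complex.normSq (basisDet φ h.some) : ℂ) := by
      rw [← Complex.mul_conj, conj_basisDet, h2, Complex.ofReal_intCast, h1]
      ring
    have h5 : (orderDiscr O : ℝ) = -Complex.normSq (basisDet φ h.some) := by exact_mod_cast h4
    rw [h5, neg_neg]
    exact Complex.normSq_nonneg _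
  rw [← h1, ← h2, sqrtDiscr, mul_pow, Complex.I_sq, ← Complex.ofReal_pow, Real.sq_sqrt h3]
  simp

/-- The inverse different is the trace dual of the order. -/
theorem mem_inverseDifferent_iff [NumberField K] [NumberField.IsTotallyComplex K] (hK : Module.finrank ℚ K = 2)
    (φ : K →+* ℂ) (hO : IsQuadraticOrder O) (y : K) :
    y ∈ inverseDifferent φ O ↔ ∀ o : O, ∃ n : ℤ, Algebra.trace ℚ K (o * y) = n := by
  obtain ⟨b, hb⟩ := sqrtDiscr_eq_or hK φ hO
  have hδ := basisDet_ne_zero hK φ b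
  have hmem : y ∈ inverseDifferent φ O ↔ ∃ s : O, φ y * basisDet φ b = φ s := by
    change (∃ s : O, φ y * sqrtDiscr O = φ s) ↔ _
    rcases hb with hb | hb <;> rw [hb]
    constructor <;> rintro ⟨s, hs⟩ <;> exact ⟨-s, by push_cast; rw [map_neg, ← hs]; ring⟩
  rw [hmem]
  constructor
  · rintro ⟨s, hs⟩ o
    -- `w - conj w` is an integral multiple of `basisDet` for every `w ∈ O`
    have hw : ∀ w : O, ∃ n : ℤ, φ w - conj (φ w) = n * basisDet φ b := by
      intro w
      have e1 := congrArg (fun z : O => φ z) (b.sum_repr 1)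
      have e2 := congrArg (fun z : O => φ z) (b.sum_repr w)
      simp only [Fin.sum_univ_two, Subring.coe_add, zsmul_eq_mul, Subring.coe_mul,
        Subring.coe_intCast, map_add, map_mul, map_intCast, Subring.coe_one, map_one] at e1 e2
      have e1' := congrArg conj e1
      simp only [map_add, map_mul, map_intCast, map_one] at e1'
      -- The difference w - conj w is the determinant of the embeddings of the pair (w, 1), so the
      -- integer is the determinant of the coordinates of that pair.
      refine ⟨b.repr w 0 * b.repr 1 1 - b.repr w 1 * b.repr 1 0, ?_⟩
      rw [← e2, basisDet]
      push_cast
      simp only [map_add, map_mul, map_intCast]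
      linear_combination (-(b.repr w 0 : ℂ) * φ (b 0) - (b.repr w 1 : ℂ) * φ (b 1)) * e1'
        + ((b.repr w 0 : ℂ) * conj (φ (b 0)) + (b.repr w 1 : ℂ) * conj (φ (b 1))) * e1
    obtain ⟨n, hn⟩ := hw (o * s)
    refine ⟨n, ?_⟩
    have : (Algebra.trace ℚ K (o * y) : ℂ) = n := by
      rw [coe_trace_eq hK φ]
      have hs' := congrArg conj hs
      rw [map_mul, conj_basisDet] at hs'
      apply mul_right_cancel₀ hδ
      rw [← hn]
      push_cast
      simp only [map_mul]
      linear_combination φ o * hs - conj (φ o) * hs'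
    exact_mod_cast this
  · intro h
    obtain ⟨n0, h0⟩ := h (b 0)
    obtain ⟨n1, h1⟩ := h (b 1)
    obtain ⟨c0, hc0⟩ := hO.exists_conj hK φ (b 0)
    obtain ⟨c1, hc1⟩ := hO.exists_conj hK φ (b 1)
    have t0 := coe_trace_eq hK φ (b 0 * y)
    have t1 := coe_trace_eq hK φ (b 1 * y)
    rw [h0] at t0
    rw [h1] at t1
    simp only [map_mul, Rat.cast_intCast] at t0 t1
    -- Cramer's rule for the two equations Tr(b_i y) = n_i in the unknowns y and conj y.
    refine ⟨n0 * c1 - n1 * c0, ?_⟩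
    push_cast
    simp only [map_sub, map_mul, map_intCast, hc0, hc1, basisDet]
    rw [t0, t1]
    ring

theorem IsQuadraticOrder.exists_int_mul_mem [NumberField K] (hO : IsQuadraticOrder O)
    (hK : Module.finrank ℚ K = 2) (a : K) : ∃ n : ℤ, n ≠ 0 ∧ (n : K) * a ∈ O := by
  obtain ⟨b⟩ := hO
  obtain ⟨bK, hbK⟩ := exists_rat_basis hK b
  obtain ⟨n, hn⟩ := IsLocalization.exist_integer_multiples_of_finset (nonZeroDivisors ℤ)
    (Finset.univ.image fun i => bK.repr a i)
  refine ⟨n, nonZeroDivisors.coe_ne_zero n, ?_⟩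
  rw [← bK.sum_repr a, Finset.mul_sum]
  refine O.sum_mem fun i _ => ?_
  obtain ⟨m, hm⟩ := hn (bK.repr a i) (Finset.mem_image_of_mem _ (Finset.mem_univ i))
  have : ((n : ℤ) : K) * bK.repr a i • bK i = ((m * b i : O) : K) := by
    rw [hbK, Rat.smul_def, ← mul_assoc]
    push_cast
    congr 1
    have := congrArg (fun q : ℚ => (q : K)) hm
    simpa [Algebra.smul_def] using this.symm
  rw [this]
  exact SetLike.coe_mem _

end QuadraticField

set_option linter.unusedSectionVars false

/-! ### The trace form, the lattice M and its dual. -/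

section Lattice

variable {K : Type*} [Field K] [NumberField K] {φ : K →+* ℂ} {O : Subring K}
variable {V : Type*} [AddCommGroup V] [Module K V] [Module ℚ V]

namespace HermitianPairing

variable (h : HermitianPairing φ V)

theorem toFun_sum_left {ι : Type*} (s : Finset ι) (f : ι → V) (y : V) :
    h.toFun (∑ i ∈ s, f i) y = ∑ i ∈ s, h.toFun (f i) y :=
  map_sum (AddMonoidHom.mk' (fun x => h.toFun x y) (fun a b => h.add_left a b y)) f s

theorem toFun_sum_right {ι : Type*} (s : Finset ι) (f : ι → V) (x : V) :
    h.toFun x (∑ i ∈ s, f i) = ∑ i ∈ s, h.toFun x (f i) :=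
  map_sum (AddMonoidHom.mk' (fun y => h.toFun x y) (fun a b => h.add_right x a b)) f s

theorem traceForm_apply (x y : V) : h.traceForm x y = Algebra.trace ℚ K (h.toFun x y) := rfl

variable [NumberField.IsTotallyComplex K] (hK : Module.finrank ℚ K = 2)

include hK

theorem coe_traceForm (x y : V) :
    (h.traceForm x y : ℂ) = φ (h.toFun x y) + φ (h.toFun y x) := by
  rw [traceForm_apply, coe_trace_eq hK φ, ← h.conj_symm]

theorem traceForm_comm (x y : V) : h.traceForm x y = h.traceForm y x := by
  have : (h.traceForm x y : ℂ) = h.traceForm y x := by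
    rw [h.coe_traceForm hK, h.coe_traceForm hK, add_comm]
  exact_mod_cast this

theorem coe_traceForm_self (x : V) : (h.traceForm x x : ℂ) = 2 * φ (h.toFun x x) := by
  rw [h.coe_traceForm hK, two_mul]

theorem eq_zero_of_toFun_eq_zero {bp bm : ℕ} (hsig : h.HasSignature bp bm) {x : V}
    (hx : ∀ y, h.toFun x y = 0) : x = 0 := by
  obtain ⟨b, horth, hpos, hneg⟩ := hsig
  rw [← b.sum_repr x]
  refine Finset.sum_eq_zero fun i _ => ?_
  have h1 := hx (b i)
  rw [← b.sum_repr x, h.toFun_sum_left, Finset.sum_eq_single i, h.smul_left] at h1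
  · have h2 : h.toFun (b i) (b i) ≠ 0 := by
      intro h0
      cases i with
      | inl i => have := hpos i; rw [h0] at this; simp at this
      | inr i => have := hneg i; rw [h0] at this; simp at this
    rw [(mul_eq_zero.1 h1).resolve_right h2, zero_smul]
  · intro j _ hji
    rw [h.smul_left, horth j i hji, mul_zero]
  · simp

/-- Pairing x with ⟨x, y⟩ y gives 2 |⟨x, y⟩|², so the trace form detects the vanishing of the
Hermitian form. -/
theorem eq_zero_of_traceForm_eq_zero {bp bm : ℕ} (hsig : h.HasSignature bp bm) {x : V}
    (hx : ∀ y, h.traceForm x y = 0) : x = 0 := by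
  refine h.eq_zero_of_toFun_eq_zero hK hsig fun y => ?_
  have h1 := hx (h.toFun x y • y)
  have h2 : (h.traceForm x (h.toFun x y • y) : ℂ)
      = 2 * (Complex.normSq (φ (h.toFun x y)) : ℂ) := by
    rw [h.coe_traceForm hK, h.smul_left, h.smul_right, map_mul, h.conj_symm x y,
      ← Complex.mul_conj]
    ring
  rw [h1] at h2
  have h3 : Complex.normSq (φ (h.toFun x y)) = 0 := by
    have : (Complex.normSq (φ (h.toFun x y)) : ℂ) = 0 := by
      rw [Rat.cast_zero] at h2; linear_combination -h2 / 2
    exact_mod_cast this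
  exact (map_eq_zero φ).1 (Complex.normSq_eq_zero.1 h3)

theorem traceForm_nondegenerate {bp bm : ℕ} (hsig : h.HasSignature bp bm) :
    h.traceForm.Nondegenerate :=
  ⟨fun _ hx => h.eq_zero_of_traceForm_eq_zero hK hsig hx,
    fun _ hx => h.eq_zero_of_traceForm_eq_zero hK hsig fun y => by
      rw [h.traceForm_comm hK]; exact hx y⟩

/-- The Hermitian dual with respect to 𝒟⁻¹ is the ordinary integral dual for the trace form, because
𝒟⁻¹ is the trace dual of O and M is stable under O. This is what lets Poisson summation produce M^*.
-/
theorem mem_dual_iff (hO : IsQuadraticOrder O) (M : Submodule O V) (x : V) :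
    x ∈ dual h M ↔ ∀ y ∈ M, ∃ n : ℤ, h.traceForm x y = n := by
  change (∀ y ∈ M, h.toFun x y ∈ inverseDifferent φ O) ↔ _
  simp_rw [mem_inverseDifferent_iff hK φ hO]
  constructor
  · intro H y hy
    obtain ⟨n, hn⟩ := H y hy 1
    exact ⟨n, by rw [← hn, h.traceForm_apply]; simp⟩
  · intro H y hy o
    obtain ⟨c, hc⟩ := hO.exists_conj hK φ o
    obtain ⟨n, hn⟩ := H (c • y) (M.smul_mem c hy)
    refine ⟨n, ?_⟩
    rw [← hn, h.traceForm_apply]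
    congr 1
    apply φ.injective
    change _ = φ (h.toFun x ((c : K) • y))
    rw [h.smul_right, hc, Complex.conj_conj, map_mul]

theorem le_dual {M : Submodule O V} (hM : IsEvenLattice h M) : M ≤ dual h M :=
  fun x hx y hy => hM.pairing_mem x hx y hy

theorem finite_of_signature {bp bm : ℕ} (hsig : h.HasSignature bp bm) : Module.Finite ℚ V := by
  obtain ⟨b, -⟩ := hsig
  have : Module.Finite K V := Module.Finite.of_basis b
  exact Module.Finite.trans K V

/-- Each scalar of K becomes an element of O after multiplication by a nonzero integer, so the
rational span of M is already stable under K. -/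
theorem span_rat_eq_top (hO : IsQuadraticOrder O) {M : Submodule O V}
    (hM : IsEvenLattice h M) : Submodule.span ℚ (M : Set V) = ⊤ := by
  have hstab : ∀ (a : K) (x : V), x ∈ Submodule.span ℚ (M : Set V) →
      a • x ∈ Submodule.span ℚ (M : Set V) := by
    intro a x hx
    induction hx using Submodule.span_induction with
    | mem x hx =>
      obtain ⟨n, hn, hna⟩ := hO.exists_int_mul_mem hK a
      have h1 : a • x = ((n : ℚ)⁻¹) • ((⟨_, hna⟩ : O) • x) := by
        have h2 : ((⟨_, hna⟩ : O) • x) = ((n : K) * a) • x := rfl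
        have h3 : (n : K) ≠ 0 := by exact_mod_cast hn
        rw [h2, ← Rat.cast_smul_eq_qsmul K, smul_smul]
        congr 1
        push_cast
        rw [inv_mul_cancel_left₀ h3]
      rw [h1]
      exact Submodule.smul_mem _ _ (Submodule.subset_span (M.smul_mem _ hx))
    | zero => simp
    | add x y _ _ hx hy => rw [smul_add]; exact add_mem hx hy
    | smul q x _ hx => rw [smul_comm]; exact Submodule.smul_mem _ _ hx
  let W : Submodule K V :=
    { Submodule.span ℚ (M : Set V) with smul_mem' := fun a x hx => hstab a x hx }
  have hW : W = ⊤ := by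
    rw [eq_top_iff, ← hM.span_eq_top, Submodule.span_le]
    exact fun x hx => Submodule.subset_span (R := ℚ) hx
  rw [eq_top_iff]
  intro x _
  have : x ∈ W := hW ▸ Submodule.mem_top
  exact this

theorem exists_lattice_basis {bp bm : ℕ} (hsig : h.HasSignature bp bm) (hO : IsQuadraticOrder O)
    {M : Submodule O V} (hM : IsEvenLattice h M) :
    ∃ (n : ℕ) (b b' : Module.Basis (Fin n) ℚ V),
      (∀ x, x ∈ M ↔ ∃ m : Fin n → ℤ, x = ∑ i, (m i : ℚ) • b i) ∧
      (∀ x, x ∈ dual h M ↔ ∃ m : Fin n → ℤ, x = ∑ i, (m i : ℚ) • b' i) ∧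
      ∀ i j, h.traceForm (b' i) (b j) = if j = i then 1 else 0 := by
  classical
  have hfin := h.finite_of_signature hK hsig
  have hnd := h.traceForm_nondegenerate hK hsig
  have hspan := h.span_rat_eq_top hK hO hM
  let MZ : Submodule ℤ V := M.toAddSubgroup.toIntSubmodule
  have hMZ : ∀ x, x ∈ MZ ↔ x ∈ M := fun x => Iff.rfl
  -- Finite generation comes from integrality: M lies in the integral dual of the lattice spanned by
  -- a rational basis chosen inside M, and that dual is Noetherian over ℤ.
  have hfg : MZ.FG := by
    let b₀ := Module.Basis.ofSpan hspan.ge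
    have hb₀ : ∀ i, b₀ i ∈ M := fun i =>
      Module.Basis.ofSpan_subset hspan.ge ⟨i, rfl⟩
    have : Finite _ := Module.Finite.finite_basis b₀
    have hle : MZ ≤ h.traceForm.dualSubmodule (Submodule.span ℤ (Set.range b₀)) := by
      intro x hx y hy
      have hy' : y ∈ MZ :=
        (Submodule.span_le (p := MZ)).2 (by rintro _ ⟨i, rfl⟩; exact hb₀ i) hy
      obtain ⟨n, hn⟩ := (h.mem_dual_iff hK hO M x).1 (h.le_dual hK hM hx) y hy'
      exact Submodule.mem_one.2 ⟨n, by simpa using hn.symm⟩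
    rw [LinearMap.BilinForm.dualSubmodule_span_of_basis _ hnd] at hle
    have : IsNoetherian ℤ
        (Submodule.span ℤ (Set.range (h.traceForm.dualBasis hnd b₀))) :=
      isNoetherian_span_of_finite ℤ (Set.finite_range _)
    have := isNoetherian_of_le hle
    exact Module.Finite.iff_fg.1 inferInstance
  have hlat : MZ.IsLattice ℚ := ⟨hfg, hspan⟩
  have hfree := Submodule.IsLattice.free (K := ℚ) MZ
  let c := Module.finBasis ℤ MZ
  let b := c.extendOfIsLattice ℚ
  have hb : ∀ i, b i = c i := fun i => Module.Basis.extendOfIsLattice_apply ℚ c i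
  let b' := h.traceForm.dualBasis hnd b
  have hdual : ∀ i j, h.traceForm (b' i) (b j) = if j = i then 1 else 0 :=
    h.traceForm.apply_dualBasis_left hnd b
  have hmem : ∀ x, x ∈ M ↔ ∃ m : Fin (Module.finrank ℤ MZ) → ℤ, x = ∑ i, (m i : ℚ) • b i := by
    intro x
    constructor
    · intro hx
      refine ⟨c.repr ⟨x, hx⟩, ?_⟩
      have := congrArg (fun y : MZ => (y : V)) (c.sum_repr ⟨x, hx⟩)
      refine this.symm.trans ?_
      push_cast
      exact Finset.sum_congr rfl fun i _ => by rw [hb, Int.cast_smul_eq_zsmul]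
    · rintro ⟨m, rfl⟩
      rw [← hMZ]
      refine MZ.sum_mem fun i _ => ?_
      rw [hb, Int.cast_smul_eq_zsmul]
      exact MZ.smul_mem _ (c i).2
  refine ⟨_, b, b', hmem, fun x => ?_, hdual⟩
  rw [h.mem_dual_iff hK hO]
  constructor
  · intro H
    choose m hm using fun i => H (b i) ((hmem _).2 ⟨Pi.single i 1, by
      simp [Pi.single_apply, Finset.sum_ite_eq']⟩)
    refine ⟨m, ?_⟩
    rw [← b'.sum_repr x]
    refine Finset.sum_congr rfl fun i _ => ?_
    congr 1
    rw [h.traceForm.dualBasis_repr_apply hnd b, hm]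
  · rintro ⟨m, rfl⟩ y hy
    obtain ⟨l, rfl⟩ := (hmem y).1 hy
    refine ⟨∑ i, m i * l i, ?_⟩
    simp [hdual, map_sum, LinearMap.sum_apply, mul_comm]

end HermitianPairing

end Lattice

/-! ### Bases and base change for definite forms. -/

section Definite

open Module

/-- A positive definite symmetric form has a basis of vectors of norm `2`. -/
theorem exists_basis_of_posDef {E : Type*} [AddCommGroup E] [Module ℝ E] [FiniteDimensional ℝ E]
    (B : LinearMap.BilinForm ℝ E) (hB : B.IsSymm) (W : Submodule ℝ E)
    (hpos : ∀ x ∈ W, x ≠ 0 → 0 < B x x) {n : ℕ} (hn : finrank ℝ W = n) :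
    ∃ f : Basis (Fin n) ℝ W, ∀ i j, B (f i) (f j) = if i = j then 2 else 0 := by
  subst hn
  obtain ⟨f, hf⟩ := LinearMap.BilinForm.exists_orthogonal_basis (B := B.restrict W)
    (LinearMap.BilinForm.isSymm_iff.1 (hB.restrict W))
  have hp : ∀ i, 0 < B (f i) (f i) := fun i =>
    hpos _ (f i).2 (by simpa using f.ne_zero i)
  have hne : ∀ i, Real.sqrt (2 / B (f i) (f i)) ≠ 0 := fun i =>
    (Real.sqrt_pos.2 (div_pos two_pos (hp i))).ne'
  refine ⟨f.isUnitSMul (fun i => (hne i).isUnit), fun i j => ?_⟩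
  simp only [Basis.isUnitSMul_apply, Submodule.coe_smul, map_smul, LinearMap.smul_apply,
    smul_eq_mul]
  split_ifs with hij
  · subst hij
    rw [← mul_assoc, Real.mul_self_sqrt (div_pos two_pos (hp i)).le, div_mul_cancel₀ _ (hp i).ne']
  · have : B (f i) (f j) = 0 := hf hij
    rw [this, mul_zero, mul_zero]

variable {V : Type*} [AddCommGroup V] [Module ℚ V]

/-- Positive definiteness of a rational form is preserved by the extension of scalars to `ℝ`. -/
theorem posDef_baseChange (C : LinearMap.BilinForm ℚ V) (hC : C.IsSymm)
    (B : LinearMap.BilinForm ℝ (ℝ ⊗[ℚ] V))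
    (hB : ∀ x y : V, B ((1 : ℝ) ⊗ₜ x) ((1 : ℝ) ⊗ₜ y) = C x y)
    (U : Submodule ℚ V) [FiniteDimensional ℚ U] (hpos : ∀ x ∈ U, x ≠ 0 → 0 < C x x) :
    ∀ x ∈ U.baseChange ℝ, x ≠ 0 → 0 < B x x := by
  intro x hx hx0
  -- Approximating by rational vectors would give semidefiniteness only. Diagonalizing over ℚ first
  -- gives positive coefficients, which remain diagonal coefficients over ℝ.
  obtain ⟨f, hf⟩ := LinearMap.BilinForm.exists_orthogonal_basis (B := C.restrict U)
    (LinearMap.BilinForm.isSymm_iff.1 (hC.restrict U))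
  obtain ⟨r, hr⟩ : ∃ r : Fin (finrank ℚ U) → ℝ, x = ∑ i, r i • ((1 : ℝ) ⊗ₜ[ℚ] (f i : V)) := by
    obtain ⟨y, hy⟩ := Submodule.toBaseChange_surjective ℝ U ⟨x, hx⟩
    refine ⟨(f.baseChange ℝ).repr y, ?_⟩
    have h1 := congrArg (fun z => ((Submodule.toBaseChange ℝ U z : U.baseChange ℝ) : ℝ ⊗[ℚ] V))
      ((f.baseChange ℝ).sum_repr y)
    simp only [hy] at h1
    rw [← h1]
    simp
  have hBx : B x x = ∑ i, r i ^ 2 * (C (f i) (f i) : ℝ) := by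
    rw [hr]
    simp only [map_sum, LinearMap.sum_apply, map_smul, LinearMap.smul_apply, smul_eq_mul, hB]
    refine Finset.sum_congr rfl fun i _ => ?_
    rw [Finset.sum_eq_single i]
    · ring
    · intro j _ hji
      have : C (f j) (f i) = 0 := hf hji
      rw [this]; simp
    · simp
  have hp : ∀ i, (0 : ℝ) < C (f i) (f i) := fun i => by
    exact_mod_cast hpos _ (f i).2 (by simpa using f.ne_zero i)
  rw [hBx]
  obtain ⟨i, hi⟩ : ∃ i, r i ≠ 0 := by
    by_contra! hall
    exact hx0 (by rw [hr]; simp [hall])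
  refine Finset.sum_pos' (fun j _ => by have := (hp j).le; positivity) ⟨i, Finset.mem_univ _, ?_⟩
  have := hp i
  positivity

theorem finrank_baseChange_le (U : Submodule ℚ V) [FiniteDimensional ℚ U] :
    finrank ℝ (U.baseChange ℝ) ≤ finrank ℚ U := by
  have := LinearMap.finrank_le_finrank_of_surjective (f := U.toBaseChange ℝ)
    (Submodule.toBaseChange_surjective ℝ U)
  rwa [Module.finrank_baseChange] at this

end Definite

set_option linter.unusedSectionVars false

/-! ### Dimensions and adapted bases for points of the Grassmannian. -/

section Grassmannian

open Module

variable {K : Type*} [Field K] [NumberField K] {φ : K →+* ℂ}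
variable {V : Type*} [AddCommGroup V] [Module K V] [Module ℚ V]

theorem HermitianPairing.map_toFun_sum_self (h : HermitianPairing φ V) {ι : Type*} [Fintype ι]
    (g : ι → V) (hg : ∀ i j, i ≠ j → h.toFun (g i) (g j) = 0) (a : ι → K) :
    φ (h.toFun (∑ i, a i • g i) (∑ i, a i • g i))
      = ∑ i, (Complex.normSq (φ (a i)) : ℂ) * φ (h.toFun (g i) (g i)) := by
  rw [h.toFun_sum_left, map_sum]
  refine Finset.sum_congr rfl fun i _ => ?_
  rw [h.toFun_sum_right, map_sum, Finset.sum_eq_single i]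
  · rw [h.smul_left, map_mul, h.smul_right, ← Complex.mul_conj]; ring
  · intro j _ hji
    rw [h.smul_left, map_mul, h.smul_right, hg i j hji.symm]; simp
  · simp

theorem HermitianPairing.coe_traceForm_self_re [NumberField.IsTotallyComplex K]
    (h : HermitianPairing φ V) (hK : finrank ℚ K = 2) (x : V) :
    (h.traceForm x x : ℝ) = 2 * (φ (h.toFun x x)).re := by
  have := congrArg Complex.re (h.coe_traceForm_self hK x)
  simpa using this

theorem HermitianPairing.traceForm_isSymm [NumberField.IsTotallyComplex K]
    (h : HermitianPairing φ V) (hK : finrank ℚ K = 2) : h.traceForm.IsSymm :=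
  ⟨fun x y => h.traceForm_comm hK x y⟩

theorem HermitianPairing.exists_traceForm_self_eq [NumberField.IsTotallyComplex K]
    (h : HermitianPairing φ V) (hK : finrank ℚ K = 2) {ι : Type*} [Finite ι]
    (g : ι → V) (hg : ∀ i j, i ≠ j → h.toFun (g i) (g j) = 0) (s : ℝ)
    (hs : ∀ i, 0 < s * (φ (h.toFun (g i) (g i))).re) (x : V)
    (hx : x ∈ Submodule.span K (Set.range g)) (hx0 : x ≠ 0) : 0 < s * (h.traceForm x x : ℝ) := by
  have := Fintype.ofFinite ι
  obtain ⟨a, rfl⟩ := (Submodule.mem_span_range_iff_exists_fun K).1 hx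
  rw [h.coe_traceForm_self_re hK, h.map_toFun_sum_self g hg, Complex.re_sum]
  obtain ⟨i, hi⟩ : ∃ i, a i ≠ 0 := by
    by_contra! hall
    exact hx0 (by simp [hall])
  rw [← mul_assoc, mul_comm s 2, mul_assoc, Finset.mul_sum]
  refine mul_pos two_pos (Finset.sum_pos' (fun j _ => ?_) ⟨i, Finset.mem_univ _, ?_⟩)
  · rw [Complex.re_ofReal_mul, ← mul_assoc, mul_comm s, mul_assoc]
    exact mul_nonneg (Complex.normSq_nonneg _) (hs j).le
  · rw [Complex.re_ofReal_mul, ← mul_assoc, mul_comm s, mul_assoc]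
    exact mul_pos (Complex.normSq_pos.2 ((map_ne_zero φ).2 hi)) (hs i)

theorem scalarEnd_mem_baseChange (U : Submodule K V) (a : K) {x : ℝ ⊗[ℚ] V}
    (hx : x ∈ (U.restrictScalars ℚ).baseChange ℝ) :
    (scalarEnd V a).baseChange ℝ x ∈ (U.restrictScalars ℚ).baseChange ℝ := by
  rw [Submodule.baseChange_eq_span] at hx
  induction hx using Submodule.span_induction with
  | mem x hx =>
    obtain ⟨u, hu, rfl⟩ := hx
    exact Submodule.tmul_mem_baseChange_of_mem _ (U.smul_mem a hu)
  | zero => simp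
  | add x y _ _ hx hy => rw [map_add]; exact add_mem hx hy
  | smul r x _ hx => rw [map_smul]; exact Submodule.smul_mem _ _ hx

theorem baseChange_traceForm_tmul (h : HermitianPairing φ V) (x y : V) :
    h.traceForm.baseChange ℝ ((1 : ℝ) ⊗ₜ x) ((1 : ℝ) ⊗ₜ y) = h.traceForm x y := by
  rw [LinearMap.BilinForm.baseChange_tmul]
  simp

theorem finrank_restrictScalars_span_le (hK : finrank ℚ K = 2) {m : ℕ} (g : Fin m → V) :
    finrank ℚ ((Submodule.span K (Set.range g)).restrictScalars ℚ) ≤ 2 * m := by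
  have h1 : finrank K (Submodule.span K (Set.range g)) ≤ m := by
    simpa only [Set.finrank, Fintype.card_fin] using finrank_range_le_card (R := K) g
  have h2 : finrank ℚ (Submodule.span K (Set.range g)) ≤ 2 * m := by
    rw [← finrank_mul_finrank ℚ K, hK]
    omega
  exact h2

/-- The Grassmannian is not empty, and its base point has subspaces of the expected dimension. -/
theorem exists_grJ [NumberField.IsTotallyComplex K] (h : HermitianPairing φ V)
    (hK : finrank ℚ K = 2) {bp bm : ℕ} (hsig : h.HasSignature bp bm) :
    ∃ v : GrJ h, finrank ℝ v.pos = 2 * bp ∧ finrank ℝ v.neg = 2 * bm := by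
  have hfin := h.finite_of_signature hK hsig
  obtain ⟨b, horth, hpos, hneg⟩ := hsig
  have hVdim : finrank ℝ (ℝ ⊗[ℚ] V) = 2 * (bp + bm) := by
    rw [Module.finrank_baseChange, ← finrank_mul_finrank ℚ K, hK, finrank_eq_card_basis b]
    simp
  let Up : Submodule K V := Submodule.span K (Set.range fun i => b (Sum.inl i))
  let Um : Submodule K V := Submodule.span K (Set.range fun i => b (Sum.inr i))
  have hUp : ∀ x ∈ Up, x ≠ 0 → 0 < h.traceForm x x := fun x hx hx0 => by
    have := h.exists_traceForm_self_eq hK (fun i => b (Sum.inl i))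
      (fun i j hij => horth _ _ (by simpa using hij)) 1 (fun i => by simpa using hpos i) x hx hx0
    rw [one_mul] at this
    exact_mod_cast this
  have hUm : ∀ x ∈ Um, x ≠ 0 → 0 < (-h.traceForm) x x := fun x hx hx0 => by
    have := h.exists_traceForm_self_eq hK (fun i => b (Sum.inr i))
      (fun i j hij => horth _ _ (by simpa using hij)) (-1)
      (fun i => by have := hneg i; linarith) x hx hx0
    simp only [LinearMap.neg_apply]
    have h2 : (0 : ℝ) < ((-(h.traceForm x x) : ℚ) : ℝ) := by push_cast; linarith
    exact_mod_cast h2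
  have horthU : ∀ x ∈ Up, ∀ y ∈ Um, h.toFun x y = 0 := by
    intro x hx y hy
    obtain ⟨a, rfl⟩ := (Submodule.mem_span_range_iff_exists_fun K).1 hx
    obtain ⟨c, rfl⟩ := (Submodule.mem_span_range_iff_exists_fun K).1 hy
    rw [h.toFun_sum_left]
    refine Finset.sum_eq_zero fun i _ => ?_
    rw [h.toFun_sum_right]
    refine Finset.sum_eq_zero fun j _ => φ.injective ?_
    rw [h.smul_right, h.smul_left, horth _ _ (by simp)]
    simp
  have hsup : Up ⊔ Um = ⊤ := by
    rw [eq_top_iff, ← b.span_eq, Submodule.span_le]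
    rintro _ ⟨i | i, rfl⟩
    · exact Submodule.mem_sup_left (Submodule.subset_span ⟨i, rfl⟩)
    · exact Submodule.mem_sup_right (Submodule.subset_span ⟨i, rfl⟩)
  set P := (Up.restrictScalars ℚ).baseChange ℝ with hP
  set N := (Um.restrictScalars ℚ).baseChange ℝ with hN
  have hsymm := h.traceForm_isSymm hK
  have hPpos : ∀ x ∈ P, x ≠ 0 → 0 < h.traceForm.baseChange ℝ x x :=
    posDef_baseChange h.traceForm hsymm _ (baseChange_traceForm_tmul h) _ hUp
  have hNneg : ∀ x ∈ N, x ≠ 0 → h.traceForm.baseChange ℝ x x < 0 := by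
    intro x hx hx0
    have := posDef_baseChange (-h.traceForm) hsymm.neg (-h.traceForm.baseChange ℝ)
      (fun x y => by
        simp only [LinearMap.neg_apply, baseChange_traceForm_tmul]
        push_cast; rfl) (Um.restrictScalars ℚ) hUm x hx hx0
    simpa using this
  have hcompl : IsCompl P N := by
    constructor
    · rw [Submodule.disjoint_def]
      intro x hx hy
      by_contra hx0
      exact lt_asymm (hPpos x hx hx0) (hNneg x hy hx0)
    · rw [codisjoint_iff, eq_top_iff]
      intro x _
      induction x using TensorProduct.induction_on with
      | zero => exact zero_mem _
      | tmul r x =>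
        obtain ⟨y, hy, z, hz, rfl⟩ := Submodule.mem_sup.1 (hsup ▸ Submodule.mem_top : x ∈ Up ⊔ Um)
        rw [TensorProduct.tmul_add]
        exact add_mem (Submodule.mem_sup_left (Submodule.tmul_mem_baseChange_of_mem _ hy))
          (Submodule.mem_sup_right (Submodule.tmul_mem_baseChange_of_mem _ hz))
      | add x y hx hy => exact add_mem (hx trivial) (hy trivial)
  have horthB : ∀ x ∈ P, ∀ y ∈ N, h.traceForm.baseChange ℝ x y = 0 := by
    intro x hx y hy
    rw [hP, Submodule.baseChange_eq_span] at hx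
    induction hx using Submodule.span_induction with
    | mem x hx =>
      obtain ⟨u, hu, rfl⟩ := hx
      rw [hN, Submodule.baseChange_eq_span] at hy
      induction hy using Submodule.span_induction with
      | mem y hy =>
        obtain ⟨w, hw, rfl⟩ := hy
        rw [TensorProduct.mk_apply, TensorProduct.mk_apply, baseChange_traceForm_tmul,
          h.traceForm_apply, horthU u hu w hw, map_zero, Rat.cast_zero]
      | zero => simp
      | add y z _ _ hy hz => rw [map_add, hy, hz, add_zero]
      | smul r y _ hy => rw [map_smul, hy, smul_zero]
    | zero => simp
    | add x z _ _ hx hz => rw [map_add, LinearMap.add_apply, hx, hz, add_zero]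
    | smul r x _ hx => rw [map_smul, LinearMap.smul_apply, hx, smul_zero]
  refine ⟨⟨P, N, hcompl, hPpos, hNneg, horthB, fun a x hx => scalarEnd_mem_baseChange Up a hx,
    fun a x hx => scalarEnd_mem_baseChange Um a hx⟩, ?_⟩
  -- Upper bounds are enough, since the two dimensions add up to 2(b₊ + b₋).
  have h1 : finrank ℝ P ≤ 2 * bp := (finrank_baseChange_le _).trans
    (finrank_restrictScalars_span_le hK fun i => b (Sum.inl i))
  have h2 : finrank ℝ N ≤ 2 * bm := (finrank_baseChange_le _).trans
    (finrank_restrictScalars_span_le hK fun i => b (Sum.inr i))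
  have h3 := Submodule.finrank_add_eq_of_isCompl hcompl
  rw [hVdim] at h3
  change finrank ℝ P = _ ∧ finrank ℝ N = _
  omega

theorem GrJ.disjoint_pos_neg {h : HermitianPairing φ V} (v w : GrJ h) : Disjoint v.pos w.neg := by
  rw [Submodule.disjoint_def]
  intro x hx hy
  by_contra hx0
  exact lt_asymm (v.pos_def x hx hx0) (w.neg_def x hy hx0)

/-- The law of inertia. -/
theorem GrJ.finrank_eq [NumberField.IsTotallyComplex K] {h : HermitianPairing φ V}
    (hK : finrank ℚ K = 2) {bp bm : ℕ} (hsig : h.HasSignature bp bm) (v : GrJ h) :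
    finrank ℝ v.pos = 2 * bp ∧ finrank ℝ v.neg = 2 * bm := by
  have hfin := h.finite_of_signature hK hsig
  obtain ⟨w, hp, hn⟩ := exists_grJ h hK hsig
  -- A positive definite space meets a negative definite one only in 0. Comparing `v` with the base
  -- point `w` in both ways forces equal dimensions.
  have h1 := Submodule.finrank_add_finrank_le_of_disjoint (v.disjoint_pos_neg w)
  have h2 := Submodule.finrank_add_finrank_le_of_disjoint (w.disjoint_pos_neg v)
  have h3 := Submodule.finrank_add_eq_of_isCompl v.isCompl
  have h4 := Submodule.finrank_add_eq_of_isCompl w.isCompl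
  omega

/-- The sign of a coordinate. -/
def sgn {m n : Type*} : m ⊕ n → ℝ := Sum.elim (fun _ => 1) (fun _ => -1)

/-- A basis of `V_ℝ` that is adapted to an element of the Grassmannian. -/
theorem GrJ.exists_basis [NumberField.IsTotallyComplex K] {h : HermitianPairing φ V}
    (hK : finrank ℚ K = 2) {bp bm : ℕ} (hsig : h.HasSignature bp bm) (v : GrJ h) :
    ∃ e : Basis (Fin (2 * bp) ⊕ Fin (2 * bm)) ℝ (ℝ ⊗[ℚ] V),
      (∀ i, e (Sum.inl i) ∈ v.pos) ∧ (∀ i, e (Sum.inr i) ∈ v.neg) ∧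
      ∀ k l, h.traceForm.baseChange ℝ (e k) (e l) = if k = l then 2 * sgn k else 0 := by
  have hfin := h.finite_of_signature hK hsig
  obtain ⟨hp, hn⟩ := v.finrank_eq hK hsig
  have hsymm : (h.traceForm.baseChange ℝ).IsSymm :=
    LinearMap.BilinForm.isSymm_iff.2 (LinearMap.BilinForm.IsSymm.baseChange ℝ
      (LinearMap.BilinForm.isSymm_iff.1 (h.traceForm_isSymm hK)))
  -- The norm is 2 because the trace form is twice |·|²; in these coordinates |x_{v₊}|² is a plain
  -- sum of squares.
  obtain ⟨f, hf⟩ := exists_basis_of_posDef (h.traceForm.baseChange ℝ) hsymm v.pos v.pos_def hp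
  obtain ⟨g, hg⟩ := exists_basis_of_posDef (-h.traceForm.baseChange ℝ) hsymm.neg v.neg
    (fun x hx hx0 => by simpa using v.neg_def x hx hx0) hn
  refine ⟨(f.prod g).map (Submodule.prodEquivOfIsCompl _ _ v.isCompl), fun i => ?_, fun i => ?_, ?_⟩
  · simp
  · simp
  · rintro (i | i) (j | j)
    · simpa [sgn] using hf i j
    · simpa using v.orthogonal _ (f i).2 _ (g j).2
    · have := v.orthogonal _ (f j).2 _ (g i).2
      rw [hsymm.eq] at this
      simpa using this
    · have := hg i j
      simp only [LinearMap.neg_apply] at this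
      simp only [Basis.map_apply, Submodule.coe_prodEquivOfIsCompl', Basis.prod_apply_inr_fst,
        Basis.prod_apply_inr_snd, Submodule.coe_zero, zero_add, Sum.inr.injEq, sgn, Sum.elim_inr,
        mul_neg, mul_one]
      split_ifs at this ⊢ <;> linarith

end Grassmannian

set_option linter.unusedSectionVars false

/-! ### Projections, eigenspaces and coordinates on V ⊗ ℂ. -/

section Complexification

open Module

variable {K : Type*} [Field K] [NumberField K] {φ : K →+* ℂ}
variable {V : Type*} [AddCommGroup V] [Module K V] [Module ℚ V]

theorem realToComplex_tmul (r : ℝ) (x : V) :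
    realToComplex V (r ⊗ₜ[ℚ] x) = (r : ℂ) ⊗ₜ[ℚ] x := rfl

theorem realToComplex_smul (r : ℝ) (w : ℝ ⊗[ℚ] V) :
    realToComplex V (r • w) = (r : ℂ) • realToComplex V w := by
  induction w using TensorProduct.induction_on with
  | zero => simp
  | tmul s x => simp [TensorProduct.smul_tmul', realToComplex_tmul]
  | add x y hx hy => simp [hx, hy]

theorem complexify_tmul (p : (ℝ ⊗[ℚ] V) →ₗ[ℝ] (ℝ ⊗[ℚ] V)) (z : ℂ) (x : V) :
    complexify p (z ⊗ₜ x) = z • realToComplex V (p ((1 : ℝ) ⊗ₜ x)) := by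
  simp [complexify]

theorem complexify_realToComplex (p : (ℝ ⊗[ℚ] V) →ₗ[ℝ] (ℝ ⊗[ℚ] V)) (w : ℝ ⊗[ℚ] V) :
    complexify p (realToComplex V w) = realToComplex V (p w) := by
  induction w using TensorProduct.induction_on with
  | zero => simp
  | tmul r x =>
    rw [realToComplex_tmul, complexify_tmul, ← realToComplex_smul, ← map_smul,
      TensorProduct.smul_tmul', smul_eq_mul, mul_one]
  | add x y hx hy => simp [hx, hy]

theorem complexify_comp (p q : (ℝ ⊗[ℚ] V) →ₗ[ℝ] (ℝ ⊗[ℚ] V)) (z : ℂ ⊗[ℚ] V) :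
    complexify p (complexify q z) = complexify (p ∘ₗ q) z := by
  induction z using TensorProduct.induction_on with
  | zero => simp
  | tmul r x =>
    rw [complexify_tmul, complexify_tmul, map_smul, complexify_realToComplex, LinearMap.comp_apply]
  | add x y hx hy => simp [hx, hy]

theorem complexify_scalarEnd (a : K) (z : ℂ ⊗[ℚ] V) :
    complexify ((scalarEnd V a).baseChange ℝ) z = (scalarEnd V a).baseChange ℂ z := by
  induction z using TensorProduct.induction_on with
  | zero => simp
  | tmul r x => simp [complexify_tmul, realToComplex_tmul, TensorProduct.smul_tmul']
  | add x y hx hy => simp [hx, hy]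

theorem mem_VC {z : ℂ ⊗[ℚ] V} :
    z ∈ VC φ V ↔ ∀ a : K, (scalarEnd V a).baseChange ℂ z = φ a • z := by
  simp [VC, Submodule.mem_iInf, sub_eq_zero]

theorem mem_VCbar {z : ℂ ⊗[ℚ] V} :
    z ∈ VCbar φ V ↔ ∀ a : K, (scalarEnd V a).baseChange ℂ z = conj (φ a) • z := by
  simp [VCbar, Submodule.mem_iInf, sub_eq_zero]

namespace GrJ

variable {h : HermitianPairing φ V} (v : GrJ h)

/-- Both summands are stable under K. Consequently the projections preserve V_ℂ and V_ℂ̄. -/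
theorem projection_scalarEnd_comm (a : K) :
    Submodule.projection v.pos v.neg v.isCompl ∘ₗ (scalarEnd V a).baseChange ℝ
      = (scalarEnd V a).baseChange ℝ ∘ₗ Submodule.projection v.pos v.neg v.isCompl := by
  ext1
  ext x
  have hx : (1 : ℝ) ⊗ₜ[ℚ] x ∈ v.pos ⊔ v.neg := v.isCompl.sup_eq_top ▸ Submodule.mem_top
  obtain ⟨y, hy, z, hz, hyz⟩ := Submodule.mem_sup.1 hx
  simp only [TensorProduct.AlgebraTensorModule.curry_apply, LinearMap.restrictScalars_comp,
    TensorProduct.curry_apply, LinearMap.coe_comp, LinearMap.coe_restrictScalars,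
    Function.comp_apply, ← hyz, map_add,
    Submodule.projection_apply_of_mem_left v.isCompl hy,
    Submodule.projection_apply_of_mem_left v.isCompl (v.pos_stable a y hy),
    (Submodule.projection_apply_eq_zero_iff v.isCompl).2 hz,
    (Submodule.projection_apply_eq_zero_iff v.isCompl).2 (v.neg_stable a z hz), map_zero, add_zero]

theorem projPos_scalarEnd (a : K) (z : ℂ ⊗[ℚ] V) :
    v.projPos ((scalarEnd V a).baseChange ℂ z) = (scalarEnd V a).baseChange ℂ (v.projPos z) := by
  rw [← complexify_scalarEnd, ← complexify_scalarEnd, projPos, complexify_comp, complexify_comp,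
    projection_scalarEnd_comm]

theorem projPos_add_projNeg (z : ℂ ⊗[ℚ] V) : v.projPos z + v.projNeg z = z := by
  induction z using TensorProduct.induction_on with
  | zero => simp
  | tmul r x =>
    rw [projPos, projNeg, complexify_tmul, complexify_tmul, ← smul_add, ← map_add,
      Submodule.projection_add_projection_eq_self, realToComplex_tmul, TensorProduct.smul_tmul']
    simp
  | add x y hx hy => rw [map_add, map_add, add_add_add_comm, hx, hy]

theorem projPos_projPos (z : ℂ ⊗[ℚ] V) : v.projPos (v.projPos z) = v.projPos z := by
  rw [projPos, complexify_comp]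
  congr 2
  ext1
  ext x
  simp

theorem projPos_projNeg (z : ℂ ⊗[ℚ] V) : v.projPos (v.projNeg z) = 0 := by
  have h1 := congrArg v.projPos (v.projPos_add_projNeg z)
  rw [map_add, projPos_projPos] at h1
  simpa using h1

theorem projNeg_projPos (z : ℂ ⊗[ℚ] V) : v.projNeg (v.projPos z) = 0 := by
  have h1 := v.projPos_add_projNeg (v.projPos z)
  rw [projPos_projPos] at h1
  simpa using h1

theorem projNeg_projNeg (z : ℂ ⊗[ℚ] V) : v.projNeg (v.projNeg z) = v.projNeg z := by
  have h1 := v.projPos_add_projNeg (v.projNeg z)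
  rwa [projPos_projNeg, zero_add] at h1

theorem projPos_mem_VC {z : ℂ ⊗[ℚ] V} (hz : z ∈ VC φ V) : v.projPos z ∈ VC φ V := by
  rw [mem_VC] at hz ⊢
  intro a
  rw [← projPos_scalarEnd, hz, map_smul]

theorem projNeg_mem_VC {z : ℂ ⊗[ℚ] V} (hz : z ∈ VC φ V) : v.projNeg z ∈ VC φ V := by
  have h1 : v.projNeg z = z - v.projPos z := eq_sub_of_add_eq' (v.projPos_add_projNeg z)
  rw [h1]
  exact sub_mem hz (v.projPos_mem_VC hz)

theorem projPos_mem_VCbar {z : ℂ ⊗[ℚ] V} (hz : z ∈ VCbar φ V) : v.projPos z ∈ VCbar φ V := by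
  rw [mem_VCbar] at hz ⊢
  intro a
  rw [← projPos_scalarEnd, hz, map_smul]

theorem projNeg_mem_VCbar {z : ℂ ⊗[ℚ] V} (hz : z ∈ VCbar φ V) : v.projNeg z ∈ VCbar φ V := by
  have h1 : v.projNeg z = z - v.projPos z := eq_sub_of_add_eq' (v.projPos_add_projNeg z)
  rw [h1]
  exact sub_mem hz (v.projPos_mem_VCbar hz)

end GrJ

namespace HermitianPairing

variable (h : HermitianPairing φ V)

theorem pairC_scalarEnd_left (a : K) (z w : ℂ ⊗[ℚ] V) :
    h.pairC ((scalarEnd V a).baseChange ℂ z) w = φ a * h.pairC z w := by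
  induction z using TensorProduct.induction_on with
  | zero => simp
  | tmul r x =>
    induction w using TensorProduct.induction_on with
    | zero => simp
    | tmul s y =>
      rw [LinearMap.baseChange_tmul, pairC_tmul, pairC_tmul]
      change _ * φ (h.toFun (a • x) y) = _
      rw [h.smul_left, map_mul]
      ring
    | add x y hx hy => rw [map_add, map_add, hx, hy, mul_add]
  | add x y hx hy =>
    rw [map_add, map_add, map_add, LinearMap.add_apply, LinearMap.add_apply, hx, hy, mul_add]

theorem pairC_scalarEnd_right (a : K) (z w : ℂ ⊗[ℚ] V) :
    h.pairC z ((scalarEnd V a).baseChange ℂ w) = conj (φ a) * h.pairC z w := by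
  induction z using TensorProduct.induction_on with
  | zero => simp
  | tmul r x =>
    induction w using TensorProduct.induction_on with
    | zero => simp
    | tmul s y =>
      rw [LinearMap.baseChange_tmul, pairC_tmul, pairC_tmul]
      change _ * φ (h.toFun x (a • y)) = _
      rw [h.smul_right]
      ring
    | add x y hx hy => rw [map_add, map_add, map_add, hx, hy, mul_add]
  | add x y hx hy => rw [map_add, LinearMap.add_apply, LinearMap.add_apply, hx, hy, mul_add]

theorem exists_conj_ne [NumberField.IsTotallyComplex K] (φ : K →+* ℂ) :
    ∃ a : K, conj (φ a) ≠ φ a := by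
  by_contra! hall
  exact conj_embedding_ne φ (RingHom.ext hall)

variable [NumberField.IsTotallyComplex K]

/-- In the second variable K acts on the pairing through the conjugate embedding, but on V_ℂ through
φ. A scalar that separates the two embeddings kills the value. -/
theorem pairC_VC_right {ζ : ℂ ⊗[ℚ] V} (hζ : ζ ∈ VC φ V) (z : ℂ ⊗[ℚ] V) : h.pairC z ζ = 0 := by
  obtain ⟨a, ha⟩ := exists_conj_ne φ
  have h1 := h.pairC_scalarEnd_right a z ζ
  rw [mem_VC.1 hζ, map_smul, smul_eq_mul] at h1
  have h2 : (conj (φ a) - φ a) * h.pairC z ζ = 0 := by rw [sub_mul, h1, sub_self]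
  exact (mul_eq_zero.1 h2).resolve_left (sub_ne_zero.2 ha)

theorem pairC_VCbar_left {ω : ℂ ⊗[ℚ] V} (hω : ω ∈ VCbar φ V) (z : ℂ ⊗[ℚ] V) :
    h.pairC ω z = 0 := by
  obtain ⟨a, ha⟩ := exists_conj_ne φ
  have h1 := h.pairC_scalarEnd_left a ω z
  rw [mem_VCbar.1 hω, map_smul, LinearMap.smul_apply, smul_eq_mul] at h1
  have h2 : (conj (φ a) - φ a) * h.pairC ω z = 0 := by rw [sub_mul, h1, sub_self]
  exact (mul_eq_zero.1 h2).resolve_left (sub_ne_zero.2 ha)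

end HermitianPairing

variable {κ : Type*} (e : Basis κ ℝ (ℝ ⊗[ℚ] V))

/-- The complex coordinates on `V ⊗ ℂ` with respect to a real basis of `V ⊗ ℝ`. -/
def coordC (k : κ) : (ℂ ⊗[ℚ] V) →ₗ[ℂ] ℂ :=
  LinearMap.liftBaseChange ℂ
    ((Complex.ofRealAm.toLinearMap.restrictScalars ℚ) ∘ₗ ((e.coord k).restrictScalars ℚ)
      ∘ₗ TensorProduct.mk ℚ ℝ V 1)

/-- The real coordinates of a vector of `V`. -/
def coordR (x : V) (k : κ) : ℝ := e.repr ((1 : ℝ) ⊗ₜ x) k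

theorem coordC_tmul (k : κ) (z : ℂ) (x : V) : coordC e k (z ⊗ₜ x) = z * coordR e x k := by
  simp [coordC, coordR]

theorem coordC_toC (k : κ) (x : V) : coordC e k (toC x) = coordR e x k := by
  rw [toC, coordC_tmul, one_mul]

theorem coordC_realToComplex (k : κ) (w : ℝ ⊗[ℚ] V) :
    coordC e k (realToComplex V w) = e.repr w k := by
  induction w using TensorProduct.induction_on with
  | zero => simp
  | tmul r x =>
    rw [realToComplex_tmul, coordC_tmul, coordR, ← Complex.ofReal_mul, ← smul_eq_mul,
      ← Finsupp.smul_apply, ← map_smul, TensorProduct.smul_tmul', smul_eq_mul, mul_one]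
  | add x y hx hy => simp [hx, hy]

section Adapted

variable {m n : Type*} {h : HermitianPairing φ V} {v : GrJ h} {e : Basis (m ⊕ n) ℝ (ℝ ⊗[ℚ] V)}
  (hp : ∀ i, e (Sum.inl i) ∈ v.pos) (hn : ∀ i, e (Sum.inr i) ∈ v.neg)

include hp hn

theorem repr_projection_inl (w : ℝ ⊗[ℚ] V) (i : m) :
    e.repr (Submodule.projection v.pos v.neg v.isCompl w) (Sum.inl i) = e.repr w (Sum.inl i) := by
  have : e.coord (Sum.inl i) ∘ₗ Submodule.projection v.pos v.neg v.isCompl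
      = e.coord (Sum.inl i) := by
    refine e.ext fun k => ?_
    cases k with
    | inl j => simp [Submodule.projection_apply_of_mem_left v.isCompl (hp j)]
    | inr j => simp [(Submodule.projection_apply_eq_zero_iff v.isCompl).2 (hn j)]
  exact LinearMap.congr_fun this w

theorem repr_projection_inr (w : ℝ ⊗[ℚ] V) (i : n) :
    e.repr (Submodule.projection v.pos v.neg v.isCompl w) (Sum.inr i) = 0 := by
  have : e.coord (Sum.inr i) ∘ₗ Submodule.projection v.pos v.neg v.isCompl = 0 := by
    refine e.ext fun k => ?_
    cases k with
    | inl j => simp [Submodule.projection_apply_of_mem_left v.isCompl (hp j)]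
    | inr j => simp [(Submodule.projection_apply_eq_zero_iff v.isCompl).2 (hn j)]
  exact LinearMap.congr_fun this w

theorem coordC_projPos_inl (i : m) (z : ℂ ⊗[ℚ] V) :
    coordC e (Sum.inl i) (v.projPos z) = coordC e (Sum.inl i) z := by
  induction z using TensorProduct.induction_on with
  | zero => simp
  | tmul r x =>
    rw [GrJ.projPos, complexify_tmul, map_smul, coordC_realToComplex,
      repr_projection_inl hp hn, coordC_tmul]
    rfl
  | add x y hx hy => simp [hx, hy]

theorem coordC_projPos_inr (i : n) (z : ℂ ⊗[ℚ] V) :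
    coordC e (Sum.inr i) (v.projPos z) = 0 := by
  induction z using TensorProduct.induction_on with
  | zero => simp
  | tmul r x =>
    rw [GrJ.projPos, complexify_tmul, map_smul, coordC_realToComplex,
      repr_projection_inr hp hn]
    simp
  | add x y hx hy => simp [hx, hy]

theorem coordC_projNeg_inl (i : m) (z : ℂ ⊗[ℚ] V) :
    coordC e (Sum.inl i) (v.projNeg z) = 0 := by
  have h1 := congrArg (coordC e (Sum.inl i)) (v.projPos_add_projNeg z)
  rw [map_add, coordC_projPos_inl hp hn] at h1
  simpa using h1

theorem coordC_projNeg_inr (i : n) (z : ℂ ⊗[ℚ] V) :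
    coordC e (Sum.inr i) (v.projNeg z) = coordC e (Sum.inr i) z := by
  have h1 := congrArg (coordC e (Sum.inr i)) (v.projPos_add_projNeg z)
  rwa [map_add, coordC_projPos_inr hp hn, zero_add] at h1

end Adapted

section Pairing

variable [NumberField.IsTotallyComplex K] (hK : finrank ℚ K = 2)
variable {m n : Type*} [Fintype m] [Fintype n] [DecidableEq m] [DecidableEq n]
variable {h : HermitianPairing φ V} {e : Basis (m ⊕ n) ℝ (ℝ ⊗[ℚ] V)}
  (he : ∀ k l, h.traceForm.baseChange ℝ (e k) (e l) = if k = l then 2 * sgn k else 0)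

include he

theorem coe_traceForm_eq_sum (x y : V) :
    (h.traceForm x y : ℝ) = ∑ k, 2 * sgn k * coordR e x k * coordR e y k := by
  rw [← baseChange_traceForm_tmul]
  conv_lhs => rw [← e.sum_repr ((1 : ℝ) ⊗ₜ x), ← e.sum_repr ((1 : ℝ) ⊗ₜ y)]
  simp only [map_sum, LinearMap.sum_apply, map_smul, LinearMap.smul_apply, smul_eq_mul, he]
  refine Finset.sum_congr rfl fun k _ => ?_
  simp only [mul_ite, mul_zero, Finset.sum_ite_eq', Finset.mem_univ, if_true, coordR]
  ring

include hK

/-- The symmetrized pairing is the complexified trace form, which the basis `e` diagonalizes. -/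
theorem pairC_add_pairC (z w : ℂ ⊗[ℚ] V) :
    h.pairC z w + h.pairC w z = ∑ k, 2 * (sgn k : ℂ) * coordC e k z * coordC e k w := by
  induction z using TensorProduct.induction_on with
  | zero => simp
  | tmul r x =>
    induction w using TensorProduct.induction_on with
    | zero => simp
    | tmul s y =>
      rw [HermitianPairing.pairC_tmul, HermitianPairing.pairC_tmul, mul_comm s r, ← mul_add,
        ← h.coe_traceForm hK]
      have h1 := congrArg (fun t : ℝ => (t : ℂ)) (coe_traceForm_eq_sum he x y)
      simp only [Complex.ofReal_ratCast] at h1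
      rw [h1]
      push_cast
      rw [Finset.mul_sum]
      refine Finset.sum_congr rfl fun k _ => ?_
      rw [coordC_tmul, coordC_tmul]
      ring
    | add x y hx hy =>
      simp only [map_add, LinearMap.add_apply, mul_add, Finset.sum_add_distrib]
      rw [← hx, ← hy]; ring
  | add x y hx hy =>
    simp only [map_add, LinearMap.add_apply, mul_add, add_mul, Finset.sum_add_distrib]
    rw [← hx, ← hy]; ring

theorem pairC_self (z : ℂ ⊗[ℚ] V) :
    h.pairC z z = ∑ k, (sgn k : ℂ) * coordC e k z ^ 2 := by
  have h1 := pairC_add_pairC hK he z z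
  have h2 : h.pairC z z = (1 / 2) * (h.pairC z z + h.pairC z z) := by ring
  rw [h2, h1, Finset.mul_sum]
  exact Finset.sum_congr rfl fun k _ => by ring

end Pairing

end Complexification

set_option linter.unusedSectionVars false

/-! ### The theta series as a Gaussian sum, and its behaviour under τ ↦ -1/τ. -/

section ThetaInversion

open Module

variable {K : Type*} [Field K] [NumberField K] {φ : K →+* ℂ} {O : Subring K}
variable {V : Type*} [AddCommGroup V] [Module K V] [Module ℚ V]

theorem e_add (z w : ℂ) : e (z + w) = e z * e w := by
  rw [e, e, e, ← Complex.exp_add]; ring_nf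

theorem sgn_ne_zero {m n : Type*} (k : m ⊕ n) : sgn k ≠ 0 := by
  cases k <;> simp [sgn]

section Coordinates

variable {κ : Type*} (e : Basis κ ℝ (ℝ ⊗[ℚ] V))

theorem coordR_add (x y : V) : coordR e (x + y) = coordR e x + coordR e y := by
  ext k; simp [coordR, TensorProduct.tmul_add]

theorem coordR_sum_smul {ι : Type*} [Fintype ι] (q : ι → ℚ) (x : ι → V) (k : κ) :
    coordR e (∑ i, q i • x i) k = ∑ i, (q i : ℝ) * coordR e (x i) k := by
  have h1 := map_sum ((e.coord k).restrictScalars ℚ ∘ₗ TensorProduct.mk ℚ ℝ V 1)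
    (fun i => q i • x i) Finset.univ
  simp only [map_smul, LinearMap.comp_apply, TensorProduct.mk_apply,
    LinearMap.coe_restrictScalars, Basis.coord_apply] at h1
  rw [coordR, h1]
  exact Finset.sum_congr rfl fun i _ => by rw [Rat.smul_def]; rfl

theorem coordR_neg (x : V) : coordR e (-x) = -coordR e x := by
  ext k; simp [coordR, TensorProduct.tmul_neg]

variable [Fintype κ] {ι : Type*} [Fintype ι] (b : Basis ι ℚ V)

/-- The change of coordinates on `V ⊗ ℝ` from a rational basis to a real one. -/
def coordEquiv : (ι → ℝ) ≃ₗ[ℝ] (κ → ℝ) :=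
  (b.baseChange ℝ).equivFun.symm ≪≫ₗ e.equivFun

theorem coordEquiv_apply (t : ι → ℝ) (k : κ) :
    coordEquiv e b t k = ∑ i, t i * coordR e (b i) k := by
  simp [coordEquiv, Basis.equivFun_symm_apply, coordR]

theorem coordEquiv_intVec (m : ι → ℤ) :
    coordEquiv e b (intVec m) = coordR e (∑ i, (m i : ℚ) • b i) := by
  ext k
  rw [coordEquiv_apply, coordR_sum_smul]
  simp [intVec]

end Coordinates

/-- The parameter `τ` on the positive, and `conj τ` on the negative coordinates. -/
def tauC {m n : Type*} (τ : ℂ) : m ⊕ n → ℂ := Sum.elim (fun _ => τ) (fun _ => conj τ)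

/-- The quadratic coefficients of the theta series in adapted coordinates. -/
def thetaQuad {m n : Type*} (τ : ℂ) (k : m ⊕ n) : ℂ :=
  -(2 * Real.pi * Complex.I * sgn k * tauC τ k)

theorem thetaQuad_re_pos {m n : Type*} (τ : ℍ) (k : m ⊕ n) : 0 < (thetaQuad (τ : ℂ) k).re := by
  have h1 : 0 < 2 * Real.pi * τ.im := by have := τ.im_pos; positivity
  cases k <;> simpa [thetaQuad, tauC, sgn] using h1

section Term

variable [NumberField.IsTotallyComplex K] (hK : finrank ℚ K = 2)
variable {m n : Type*} [Fintype m] [Fintype n] [DecidableEq m] [DecidableEq n]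
variable {h : HermitianPairing φ V} {v : GrJ h} {e : Basis (m ⊕ n) ℝ (ℝ ⊗[ℚ] V)}
  (hp : ∀ i, e (Sum.inl i) ∈ v.pos) (hn : ∀ i, e (Sum.inr i) ∈ v.neg)
  (he : ∀ k l, h.traceForm.baseChange ℝ (e k) (e l) = if k = l then 2 * sgn k else 0)

include hK hp hn he

theorem pairC_projPos_self (z : ℂ ⊗[ℚ] V) :
    h.pairC (v.projPos z) (v.projPos z) = ∑ i, coordC e (Sum.inl i) z ^ 2 := by
  simp [pairC_self hK he, Fintype.sum_sum_type, coordC_projPos_inl hp hn,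
    coordC_projPos_inr hp hn, sgn]

theorem pairC_projNeg_self (z : ℂ ⊗[ℚ] V) :
    h.pairC (v.projNeg z) (v.projNeg z) = -∑ i, coordC e (Sum.inr i) z ^ 2 := by
  simp [pairC_self hK he, Fintype.sum_sum_type, coordC_projNeg_inl hp hn,
    coordC_projNeg_inr hp hn, sgn]

-- Since V_ℂ vanishes on the right and V_ℂ̄ on the left, both linear terms together form the trace
-- pairing of ζ + ω with x.
omit hp hn in
theorem pairC_add_eq_sum {ζ ω : ℂ ⊗[ℚ] V} (hζ : ζ ∈ VC φ V) (hω : ω ∈ VCbar φ V) (x : V) :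
    h.pairC ζ (toC x) + h.pairC (toC x) ω
      = ∑ k, 2 * (sgn k : ℂ) * coordC e k (ζ + ω) * coordR e x k := by
  have h1 := pairC_add_pairC hK he (ζ + ω) (toC x)
  rw [map_add, map_add, LinearMap.add_apply, h.pairC_VC_right hζ, h.pairC_VCbar_left hω,
    add_zero, zero_add] at h1
  rw [h1]
  simp only [coordC_toC]

/-- On negative coordinates the sign of the form and the conjugation of τ compensate each other, so
every quadratic coefficient has positive real part and the Gaussian sum formulas apply. -/
theorem thetaTerm_eq_gauss (τ : ℍ) {ζ ω : ℂ ⊗[ℚ] V} (hζ : ζ ∈ VC φ V) (hω : ω ∈ VCbar φ V)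
    (x : V) : thetaTerm v τ ζ ω x = gauss (thetaQuad τ)
      (fun k => 4 * Real.pi * Complex.I * sgn k * coordC e k (ζ + ω)) (coordR e x) := by
  rw [thetaTerm, add_assoc, pairC_add_eq_sum hK he hζ hω, pairC_projPos_self hK hp hn he,
    pairC_projNeg_self hK hp hn he, HermitianJacobi.e, gauss, mul_add]
  simp only [coordC_toC]
  congr 2
  · simp only [Fintype.sum_sum_type, thetaQuad, tauC, sgn, Sum.elim_inl, Sum.elim_inr, mul_add,
      Finset.mul_sum, neg_add, ← Finset.sum_neg_distrib]
    congr 1 <;> refine Finset.sum_congr rfl fun i _ => ?_ <;> push_cast <;> ring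
  · rw [Finset.mul_sum]
    exact Finset.sum_congr rfl fun k _ => by ring

/-- Three of the four terms in the self-pairing of (ζ + ω)_{v₊} vanish. This turns the exponent of
the automorphy factor into the one that completing the square produces. -/
theorem pairC_projPos_eq_sum {ζ ω : ℂ ⊗[ℚ] V} (hζ : ζ ∈ VC φ V) (hω : ω ∈ VCbar φ V) :
    h.pairC (v.projPos ζ) (v.projPos ω) = ∑ i, coordC e (Sum.inl i) (ζ + ω) ^ 2 := by
  rw [← pairC_projPos_self hK hp hn he]
  simp only [map_add, LinearMap.add_apply, h.pairC_VC_right (v.projPos_mem_VC hζ),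
    h.pairC_VCbar_left (v.projPos_mem_VCbar hω), add_zero, zero_add]

theorem pairC_projNeg_eq_sum {ζ ω : ℂ ⊗[ℚ] V} (hζ : ζ ∈ VC φ V) (hω : ω ∈ VCbar φ V) :
    h.pairC (v.projNeg ζ) (v.projNeg ω) = -∑ i, coordC e (Sum.inr i) (ζ + ω) ^ 2 := by
  rw [← pairC_projNeg_self hK hp hn he]
  simp only [map_add, LinearMap.add_apply, h.pairC_VC_right (v.projNeg_mem_VC hζ),
    h.pairC_VCbar_left (v.projNeg_mem_VCbar hω), add_zero, zero_add]

end Term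

section Sums

variable {h : HermitianPairing φ V} {M : Submodule O V}

theorem cls_eq_cls_iff {x y : dual h M} : cls h M x = cls h M y ↔ (x : V) - y ∈ M := by
  rw [cls, cls, Submodule.mkQ_apply, Submodule.mkQ_apply, Submodule.Quotient.eq]
  rfl

theorem sum_smul_injective {ι : Type*} [Fintype ι] (b : Basis ι ℚ V) :
    Function.Injective fun m : ι → ℤ => ∑ i, (m i : ℚ) • b i := by
  intro m l hml
  have h1 := congrArg (fun x => ⇑(b.repr x)) hml
  simp only [b.repr_sum_self] at h1
  ext i
  exact_mod_cast congrFun h1 i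

/-- The dual lattice in coordinates. -/
def dualEquiv {n : ℕ} (b' : Basis (Fin n) ℚ V)
    (hb' : ∀ x, x ∈ dual h M ↔ ∃ m : Fin n → ℤ, x = ∑ i, (m i : ℚ) • b' i) :
    (Fin n → ℤ) ≃ dual h M :=
  Equiv.ofBijective (fun m => ⟨∑ i, (m i : ℚ) • b' i, (hb' _).2 ⟨m, rfl⟩⟩) ⟨fun m l hml =>
    sum_smul_injective b' (congrArg Subtype.val hml), fun x => by
      obtain ⟨m, hm⟩ := (hb' x).1 x.2
      exact ⟨m, Subtype.ext hm.symm⟩⟩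

/-- A coset of the lattice in coordinates. -/
def cosetEquiv {n : ℕ} (b : Basis (Fin n) ℚ V) (hle : M ≤ dual h M)
    (hb : ∀ x, x ∈ M ↔ ∃ m : Fin n → ℤ, x = ∑ i, (m i : ℚ) • b i) (x₀ : dual h M) :
    (Fin n → ℤ) ≃ {x : dual h M // cls h M x = cls h M x₀} :=
  Equiv.ofBijective (fun m => ⟨⟨x₀ + ∑ i, (m i : ℚ) • b i,
      add_mem x₀.2 (hle ((hb _).2 ⟨m, rfl⟩))⟩, cls_eq_cls_iff.2 (by
        rw [add_sub_cancel_left]; exact (hb _).2 ⟨m, rfl⟩)⟩) ⟨fun m l hml =>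
    sum_smul_injective b (add_left_cancel
      (congrArg (fun x : {x : dual h M // cls h M x = cls h M x₀} => ((x : dual h M) : V)) hml)),
    fun x => by
      obtain ⟨m, hm⟩ := (hb _).1 (cls_eq_cls_iff.1 x.2)
      exact ⟨m, Subtype.ext (Subtype.ext (by
        change (x₀ : V) + ∑ i, (m i : ℚ) • b i = _
        rw [← hm, add_sub_cancel]))⟩⟩

end Sums

variable [NumberField.IsTotallyComplex K] (hK : finrank ℚ K = 2) (hO : IsQuadraticOrder O)
variable {h : HermitianPairing φ V} {bp bm : ℕ} (hsig : h.HasSignature bp bm)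
variable {M : Submodule O V} (hM : IsEvenLattice h M)

include hK hO hsig hM

theorem summable_norm_thetaTerm (v : GrJ h) (τ : ℍ) {ζ ω : ℂ ⊗[ℚ] V} (hζ : ζ ∈ VC φ V)
    (hω : ω ∈ VCbar φ V) : Summable fun x : dual h M => ‖thetaTerm v τ ζ ω (x : V)‖ := by
  obtain ⟨n, b, b', hb, hb', hbb⟩ := h.exists_lattice_basis hK hsig hO hM
  obtain ⟨e, hp, hn, he⟩ := v.exists_basis hK hsig
  rw [← (dualEquiv b' hb').summable_iff]
  refine (summable_norm_gauss (coordEquiv e b') (thetaQuad_re_pos τ)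
    (fun k => 4 * Real.pi * Complex.I * sgn k * coordC e k (ζ + ω)) 0).congr fun m => ?_
  rw [zero_add, coordEquiv_intVec, Function.comp_apply, thetaTerm_eq_gauss hK hp hn he τ hζ hω]
  rfl

/-- Poisson summation on the coset of x₀. The constant is independent of τ, ζ, ω and x₀, which is
what allows it to be computed at a single point later. -/
theorem exists_thetaInversion (v : GrJ h) : ∃ C : ℝ, 0 < C ∧
    ∀ (τ τ' : ℍ), (τ' : ℂ) = -(τ : ℂ)⁻¹ → ∀ ζ ∈ VC φ V, ∀ ω ∈ VCbar φ V, ∀ x₀ : dual h M,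
      Theta h M v τ'
        ((τ : ℂ)⁻¹ • v.projPos ζ + (conj (τ : ℂ))⁻¹ • v.projNeg ζ)
        ((τ : ℂ)⁻¹ • v.projPos ω + (conj (τ : ℂ))⁻¹ • v.projNeg ω) (cls h M x₀)
      = C * ((τ : ℂ) ^ bp * conj (τ : ℂ) ^ bm
          * e (h.pairC (v.projPos ζ) (v.projPos ω) / τ
            + h.pairC (v.projNeg ζ) (v.projNeg ω) / conj (τ : ℂ)))
        * Complex.I ^ ((bm : ℤ) - (bp : ℤ))
        * ∑' μ : dual h M, e (-(h.traceForm μ x₀ : ℂ)) * thetaTerm v τ ζ ω μ := by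
  obtain ⟨n, b, b', hb, hb', hbb⟩ := h.exists_lattice_basis hK hsig hO hM
  obtain ⟨e, hp, hn, he⟩ := v.exists_basis hK hsig
  let E := coordEquiv e b
  -- The inverse transpose of `E`: the basis `b'` is dual to `b` for the trace form, whose Gram
  -- matrix in the basis `e` is diagonal with entries 2 sgn.
  let E' : (Fin n → ℝ) ≃ₗ[ℝ] (Fin (2 * bp) ⊕ Fin (2 * bm) → ℝ) :=
    coordEquiv e b' ≪≫ₗ LinearEquiv.piCongrRight fun k =>
      LinearEquiv.smulOfNeZero ℝ ℝ (2 * sgn k) (mul_ne_zero two_ne_zero (sgn_ne_zero k))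
  have hE' : ∀ s k, E' s k = 2 * sgn k * coordEquiv e b' s k := fun s k => rfl
  obtain ⟨C, hC, hsum⟩ := exists_tsum_gauss_eq E E' (by
    intro s t
    simp only [hE', E, coordEquiv_apply]
    have h1 : ∀ i j, (∑ k, 2 * sgn k * coordR e (b' i) k * coordR e (b j) k)
        = if j = i then 1 else 0 := by
      intro i j
      rw [← coe_traceForm_eq_sum he, hbb]
      split_ifs <;> simp
    have h2 : ∀ k, 2 * sgn k * (∑ i, s i * coordR e (b' i) k) * ∑ j, t j * coordR e (b j) k
        = ∑ i, ∑ j, s i * t j * (2 * sgn k * coordR e (b' i) k * coordR e (b j) k) := by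
      intro k
      rw [mul_assoc, Finset.sum_mul_sum, Finset.mul_sum]
      refine Finset.sum_congr rfl fun i _ => ?_
      rw [Finset.mul_sum]
      exact Finset.sum_congr rfl fun j _ => by ring
    simp only [h2]
    rw [Finset.sum_comm]
    refine Finset.sum_congr rfl fun i _ => ?_
    rw [Finset.sum_comm]
    simp only [← Finset.mul_sum, h1]
    simp)
  -- The power of 2 compensates the factors 1/2 in π/β, which equals τ/(2i) on positive and i ·
  -- conj(τ)/2 on negative coordinates.
  refine ⟨C * (2 ^ (bp + bm))⁻¹, by positivity, fun τ τ' hτ ζ hζ ω hω x₀ => ?_⟩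
  have hτ0 : (τ : ℂ) ≠ 0 := τ.ne_zero
  have hτc : conj (τ : ℂ) ≠ 0 := (map_ne_zero _).2 hτ0
  have hI := Complex.I_ne_zero
  have hpi : (Real.pi : ℂ) ≠ 0 := by exact_mod_cast Real.pi_ne_zero
  set ζ' := (τ : ℂ)⁻¹ • v.projPos ζ + (conj (τ : ℂ))⁻¹ • v.projNeg ζ with hζ'
  set ω' := (τ : ℂ)⁻¹ • v.projPos ω + (conj (τ : ℂ))⁻¹ • v.projNeg ω with hω'
  have mζ' : ζ' ∈ VC φ V := add_mem (Submodule.smul_mem _ _ (v.projPos_mem_VC hζ))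
    (Submodule.smul_mem _ _ (v.projNeg_mem_VC hζ))
  have mω' : ω' ∈ VCbar φ V := add_mem (Submodule.smul_mem _ _ (v.projPos_mem_VCbar hω))
    (Submodule.smul_mem _ _ (v.projNeg_mem_VCbar hω))
  have hcoord : ∀ k, coordC e k (ζ' + ω') = coordC e k (ζ + ω) / tauC τ k := by
    rintro (k | k)
    · simp only [hζ', hω', map_add, map_smul, coordC_projPos_inl hp hn, coordC_projNeg_inl hp hn,
        tauC, Sum.elim_inl, smul_eq_mul]
      ring
    · simp only [hζ', hω', map_add, map_smul, coordC_projPos_inr hp hn, coordC_projNeg_inr hp hn,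
        tauC, Sum.elim_inr, smul_eq_mul]
      ring
  have htau0 : ∀ k : Fin (2 * bp) ⊕ Fin (2 * bm), tauC (τ : ℂ) k ≠ 0 := by
    rintro (k | k) <;> simp [tauC, hτ0]
  have htau' : ∀ k : Fin (2 * bp) ⊕ Fin (2 * bm), tauC (τ' : ℂ) k = -(tauC (τ : ℂ) k)⁻¹ := by
    rintro (k | k) <;> simp [tauC, hτ]
  have hsgn : ∀ k : Fin (2 * bp) ⊕ Fin (2 * bm), (sgn k : ℂ) ≠ 0 := fun k => by
    exact_mod_cast sgn_ne_zero k
  -- the product of the square roots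
  have hroot : ∀ x : ℂ, (x ^ (1 / 2 : ℂ)) ^ 2 = x := fun x => by simp
  have hprod : ∏ k : Fin (2 * bp) ⊕ Fin (2 * bm), (Real.pi / thetaQuad (τ' : ℂ) k) ^ (1 / 2 : ℂ)
      = ((2 : ℂ) ^ (bp + bm))⁻¹ * ((τ : ℂ) ^ bp * conj (τ : ℂ) ^ bm)
        * Complex.I ^ ((bm : ℤ) - (bp : ℤ)) := by
    rw [Fintype.prod_sum_type]
    simp only [thetaQuad, hτ, map_neg, map_inv₀, tauC, sgn, Sum.elim_inl, Sum.elim_inr,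
      Finset.prod_const, Finset.card_univ, Fintype.card_fin]
    -- The square roots occur with the even multiplicities 2b₊ and 2b₋, so only their squares matter
    -- and the branch disappears.
    rw [pow_mul, pow_mul, hroot, hroot]
    have e1 : (Real.pi : ℂ) / -(2 * Real.pi * Complex.I * ((1 : ℝ) : ℂ) * -(τ : ℂ)⁻¹)
        = 2⁻¹ * τ * Complex.I⁻¹ := by
      push_cast; field_simp
    have e2 : (Real.pi : ℂ) / -(2 * Real.pi * Complex.I * ((-1 : ℝ) : ℂ) * -(conj (τ : ℂ))⁻¹)
        = 2⁻¹ * conj (τ : ℂ) * Complex.I := by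
      push_cast
      field_simp
      rw [Complex.I_sq]
    rw [e1, e2, zpow_sub₀ hI, zpow_natCast, zpow_natCast]
    simp only [mul_pow, inv_pow, pow_add]
    field_simp
  rw [Theta, ← (cosetEquiv b (h.le_dual hK hM) hb x₀).tsum_eq]
  have hterm : ∀ m : Fin n → ℤ, thetaTerm v τ' ζ' ω'
      ((cosetEquiv b (h.le_dual hK hM) hb x₀ m : dual h M) : V)
        = gauss (thetaQuad τ')
          (fun k => 4 * Real.pi * Complex.I * sgn k * coordC e k (ζ' + ω'))
          (coordR e x₀ + E (intVec m)) := by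
    intro m
    rw [thetaTerm_eq_gauss hK hp hn he τ' mζ' mω', coordEquiv_intVec, ← coordR_add]
    rfl
  -- The dual sum is reindexed by -m: this makes the character e(-(μ, x₀)) and gives the linear term
  -- in ζ + ω its correct sign.
  rw [tsum_congr hterm, hsum _ _ _ (thetaQuad_re_pos τ'),
    ← ((Equiv.neg _).trans (dualEquiv b' hb')).tsum_eq, ← tsum_mul_left, ← tsum_mul_left]
  refine tsum_congr fun m => ?_
  set μ : V := ((((Equiv.neg _).trans (dualEquiv b' hb')) m : dual h M) : V) with hμ
  have hμE : ∀ k, (E' (intVec m) k : ℂ) = -(2 * sgn k * coordR e μ k) := by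
    intro k
    rw [hE', coordEquiv_intVec]
    have : μ = -∑ i, (m i : ℚ) • b' i := by
      rw [hμ]
      change ∑ i, ((-m) i : ℚ) • b' i = _
      simp
    rw [this, coordR_neg]
    push_cast
    simp
  have htr : (h.traceForm μ x₀ : ℂ)
      = ∑ k, 2 * (sgn k : ℂ) * coordR e μ k * coordR e (x₀ : V) k := by
    have := congrArg (fun r : ℝ => (r : ℂ)) (coe_traceForm_eq_sum he μ (x₀ : V))
    simpa using this
  have hQ : h.pairC (v.projPos ζ) (v.projPos ω) / τ
      + h.pairC (v.projNeg ζ) (v.projNeg ω) / conj (τ : ℂ)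
      = ∑ k, (sgn k : ℂ) * coordC e k (ζ + ω) ^ 2 / tauC τ k := by
    rw [pairC_projPos_eq_sum hK hp hn he hζ hω, pairC_projNeg_eq_sum hK hp hn he hζ hω,
      Fintype.sum_sum_type, Finset.sum_div, neg_div, Finset.sum_div, ← Finset.sum_neg_distrib]
    simp only [sgn, tauC, Sum.elim_inl, Sum.elim_inr]
    congr 1 <;> refine Finset.sum_congr rfl fun k _ => ?_ <;> push_cast <;> ring
  rw [thetaTerm_eq_gauss hK hp hn he τ hζ hω, hprod, hQ, htr, gauss, HermitianJacobi.e,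
    HermitianJacobi.e]
  have hexp : ∑ k, (4 * Real.pi * Complex.I * sgn k * coordC e k (ζ' + ω')
        - 2 * Real.pi * Complex.I * E' (intVec m) k) ^ 2 / (4 * thetaQuad (τ' : ℂ) k)
      + 2 * Real.pi * Complex.I * ∑ k, (E' (intVec m) k : ℂ) * coordR e (x₀ : V) k
      = 2 * Real.pi * Complex.I * (∑ k, (sgn k : ℂ) * coordC e k (ζ + ω) ^ 2 / tauC τ k)
        + (2 * Real.pi * Complex.I
            * -∑ k, 2 * (sgn k : ℂ) * coordR e μ k * coordR e (x₀ : V) k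
          + (-∑ k, thetaQuad (τ : ℂ) k * (coordR e μ k : ℂ) ^ 2
            + ∑ k, 4 * Real.pi * Complex.I * sgn k * coordC e k (ζ + ω) * coordR e μ k)) := by
    simp only [Finset.mul_sum, ← Finset.sum_neg_distrib, ← Finset.sum_add_distrib]
    refine Finset.sum_congr rfl fun k _ => ?_
    rw [hμE, hcoord, thetaQuad, thetaQuad, htau']
    have h0 := htau0 k
    have h1 := hsgn k
    field_simp
    ring_nf
  rw [hexp, Complex.exp_add, Complex.exp_add]
  push_cast
  ring

end ThetaInversion

/-! ### The group U(1,1)(ℤ): cocycles and the decomposition into scalars and SL₂(ℤ). -/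

namespace U11

variable {K : Type*} [Field K] {φ : K →+* ℂ} {O : Subring K}

/-- The determinant of an element of `U(1,1)(ℤ)`, as a complex number. -/
def det (A : U11 φ O) : ℂ := entry A 0 0 * entry A 1 1 - entry A 0 1 * entry A 1 0

theorem entry_mul (A B : U11 φ O) (i k : Fin 2) :
    entry (A * B) i k = entry A i 0 * entry B 0 k + entry A i 1 * entry B 1 k := by
  simp [entry, Matrix.mul_apply, Fin.sum_univ_two]

theorem relations (A : U11 φ O) :
    entry A 0 1 * conj (entry A 0 0) = entry A 0 0 * conj (entry A 0 1) ∧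
    entry A 0 0 * conj (entry A 1 1) - entry A 0 1 * conj (entry A 1 0) = 1 ∧
    entry A 1 1 * conj (entry A 0 0) - entry A 1 0 * conj (entry A 0 1) = 1 ∧
    entry A 1 1 * conj (entry A 1 0) = entry A 1 0 * conj (entry A 1 1) := by
  have r00 := congrFun (congrFun (mat_relation A) 0) 0
  have r01 := congrFun (congrFun (mat_relation A) 0) 1
  have r10 := congrFun (congrFun (mat_relation A) 1) 0
  have r11 := congrFun (congrFun (mat_relation A) 1) 1
  simp only [Matrix.mul_apply, Fin.sum_univ_two, Jmat, Matrix.conjTranspose_apply, mat_apply,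
    Matrix.of_apply, Matrix.cons_val', Matrix.cons_val_zero, Matrix.cons_val_one,
    Matrix.cons_val_fin_one, RCLike.star_def] at r00 r01 r10 r11
  refine ⟨?_, ?_, ?_, ?_⟩
  · linear_combination r00
  · linear_combination -r01
  · linear_combination r10
  · linear_combination r11

/-- Every 2 × 2 matrix satisfies A J Aᵗ = det A · J. Comparison with A J A^* = J gives A = det A ·
conj A. -/
theorem entry_eq_det_mul_conj (A : U11 φ O) (i k : Fin 2) :
    entry A i k = det A * conj (entry A i k) := by
  obtain ⟨h1, h2, h3, h4⟩ := relations A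
  fin_cases i <;> fin_cases k <;> simp only [det, Fin.zero_eta, Fin.mk_one]
  · linear_combination -entry A 0 0 * h3 + entry A 1 0 * h1
  · linear_combination -entry A 0 1 * h3 + entry A 1 1 * h1
  · linear_combination -entry A 1 0 * h2 - entry A 0 0 * h4
  · linear_combination -entry A 1 1 * h2 - entry A 0 1 * h4

theorem det_mul_conj_det (A : U11 φ O) : det A * conj (det A) = 1 := by
  obtain ⟨-, h2, -, -⟩ := relations A
  have h00 := entry_eq_det_mul_conj A 0 0
  have h01 := entry_eq_det_mul_conj A 0 1
  have : conj (det A) = conj (entry A 0 0) * conj (entry A 1 1)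
      - conj (entry A 0 1) * conj (entry A 1 0) := by simp [det]
  rw [this]
  linear_combination h2 - conj (entry A 1 1) * h00 + conj (entry A 1 0) * h01

theorem det_ne_zero (A : U11 φ O) : det A ≠ 0 := by
  intro h0
  have := det_mul_conj_det A
  rw [h0, zero_mul] at this
  exact zero_ne_one this

theorem j_eq_det_mul_jc (A : U11 φ O) (τ : ℍ) : j A τ = det A * jc A τ := by
  rw [j, jc, mul_add, ← mul_assoc, ← entry_eq_det_mul_conj, ← entry_eq_det_mul_conj]

theorem jc_ne_zero (A : U11 φ O) (τ : ℍ) : jc A τ ≠ 0 := by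
  intro h0
  have := j_eq_det_mul_jc A τ
  rw [h0, mul_zero] at this
  exact j_ne_zero A τ this

theorem coe_act (A : U11 φ O) (τ : ℍ) :
    (act A τ : ℂ) = (entry A 0 0 * τ + entry A 0 1) / j A τ := rfl

theorem j_mul (A B : U11 φ O) (τ : ℍ) : j (A * B) τ = j A (act B τ) * j B τ := by
  have h := j_ne_zero B τ
  rw [j, j, entry_mul, entry_mul, coe_act]
  field_simp
  rw [j]; ring

theorem det_mul (A B : U11 φ O) : det (A * B) = det A * det B := by
  simp only [det, entry_mul]; ring

theorem jc_mul (A B : U11 φ O) (τ : ℍ) : jc (A * B) τ = jc A (act B τ) * jc B τ := by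
  have h1 := j_mul A B τ
  rw [j_eq_det_mul_jc, j_eq_det_mul_jc, j_eq_det_mul_jc, det_mul] at h1
  refine mul_left_cancel₀ (mul_ne_zero (det_ne_zero A) (det_ne_zero B)) ?_
  rw [h1]; ring

theorem act_mul (A B : U11 φ O) (τ : ℍ) : act (A * B) τ = act A (act B τ) := by
  apply UpperHalfPlane.ext
  have h := j_ne_zero B τ
  rw [coe_act, coe_act, div_eq_div_iff (j_ne_zero _ _) (j_ne_zero _ _), j_mul, coe_act]
  simp only [entry_mul]
  have hj : j B τ = entry B 1 0 * τ + entry B 1 1 := rfl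
  field_simp
  rw [j, hj]; ring

/-- The cocycle relation that governs the exponential factor of automorphy. -/
theorem jDeriv_cocycle (A B : U11 φ O) (τ : ℍ) :
    jDeriv (A * B) / j (A * B) τ
      = jDeriv A / (j A (act B τ) * (j B τ * jc B τ)) + jDeriv B / j B τ := by
  -- The identity is the logarithmic derivative in τ of j(AB, τ) = j(A, Bτ) j(B, τ), as Bτ has
  -- derivative det B / j² = 1 / (j · j^c). It is checked here by clearing denominators.
  have h1 := j_ne_zero B τ
  have h2 := jc_ne_zero B τ
  have h3 := j_ne_zero A (act B τ)
  have h4 : j A (act B τ) * j B τ = entry A 1 0 * (entry B 0 0 * τ + entry B 0 1)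
      + entry A 1 1 * j B τ := by
    rw [j, coe_act]; field_simp
  have h5 : det B * jc B τ = entry B 1 0 * τ + entry B 1 1 := (j_eq_det_mul_jc B τ).symm
  rw [j_mul, jDeriv, jDeriv, jDeriv, entry_mul]
  field_simp
  rw [j_eq_det_mul_jc B τ] at h4
  have hd : det B = entry B 0 0 * entry B 1 1 - entry B 0 1 * entry B 1 0 := rfl
  refine mul_left_cancel₀ (det_ne_zero B) ?_
  linear_combination -entry B 1 0 * h4 + entry A 1 0 * entry B 0 0 * h5 - entry A 1 0 * hd

section Decomposition

variable [NumberField K] [NumberField.IsTotallyComplex K]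

/-- The elements of `O` with the same argument, up to sign, as a square root of `u`
form a cyclic group. -/
theorem exists_generator (hK : Module.finrank ℚ K = 2) (hO : IsQuadraticOrder O) {u : ℂ}
    (hu : u ≠ 0) : ∃ l : O, φ l = u * conj (φ l) ∧
      ∀ x : O, φ x = u * conj (φ x) → ∃ n : ℤ, x = n * l := by
  have hfree : Module.Free ℤ O := Module.Free.of_basis hO.some
  have hfin : Module.Finite ℤ O := Module.Finite.of_basis hO.some
  let L : Submodule ℤ O :=
    { carrier := {x | φ x = u * conj (φ x)}
      zero_mem' := by simp
      add_mem' := by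
        intro x y hx hy
        change φ ((x + y : O) : K) = _
        have hx' : φ x = u * conj (φ x) := hx
        have hy' : φ y = u * conj (φ y) := hy
        rw [Subring.coe_add, map_add, map_add, mul_add, ← hx', ← hy']
      smul_mem' := by
        intro n x hx
        change φ ((n • x : O) : K) = _
        have hx' : φ x = u * conj (φ x) := hx
        rw [zsmul_eq_mul, Subring.coe_mul, Subring.coe_intCast, map_mul, map_intCast, map_mul,
          map_intCast, mul_left_comm, ← hx'] }
  have hmem : ∀ x : O, x ∈ L ↔ φ x = u * conj (φ x) := fun x => Iff.rfl
  -- Two elements x and y ≠ 0 with the same ratio to their conjugates have a real, hence rational,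
  -- quotient, so they are dependent over ℤ.
  have hrank : Module.rank ℤ L ≤ 1 := by
    rw [← Nat.cast_one]
    refine rank_le fun s hs => Finset.card_le_one.2 fun x hx y hy => ?_
    by_contra hxy
    have hli : LinearIndependent ℤ ![x, y] := by
      have := hs.comp ![⟨x, hx⟩, ⟨y, hy⟩] (by
        intro i k hik
        fin_cases i <;> fin_cases k <;> simp_all)
      convert this using 1
      ext i
      fin_cases i <;> rfl
    rw [LinearIndependent.pair_iff] at hli
    have hx0 := (hmem x).1 x.2
    have hy0 := (hmem y).1 y.2
    have hyne : ((y : O) : K) ≠ 0 := by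
      intro h0
      have := hli 0 1 (by
        rw [zero_smul, one_smul, zero_add]
        exact Subtype.ext (Subtype.ext h0))
      exact one_ne_zero this.2
    have hφy : φ (y : O) ≠ 0 := (map_ne_zero φ).2 hyne
    have hcy : conj (φ (y : O)) ≠ 0 := (map_ne_zero _).2 hφy
    obtain ⟨q, hq⟩ := exists_rat_of_conj_eq hK φ (x := ((x : O) : K) / (y : O)) (by
      rw [map_div₀, map_div₀, div_eq_div_iff hcy hφy]
      refine mul_left_cancel₀ hu ?_
      linear_combination φ (x : O) * hy0 - φ (y : O) * hx0)
    have hrel := hli q.den (-q.num) (by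
      apply Subtype.ext
      apply Subtype.ext
      have hxq : ((x : O) : K) = q * (y : O) := by rw [← hq, div_mul_cancel₀ _ hyne]
      have hden : (q.den : K) * q = q.num := by
        have := Rat.den_mul_eq_num q
        exact_mod_cast congrArg (fun r : ℚ => (r : K)) this
      push_cast
      simp only [zsmul_eq_mul]
      push_cast
      rw [hxq, ← mul_assoc, hden]
      simp)
    exact q.den_nz (by exact_mod_cast hrel.1)
  rw [L.rank_le_one_iff_isPrincipal] at hrank
  obtain ⟨l, hl⟩ := hrank
  refine ⟨l, (hmem l).1 (by rw [hl]; exact Submodule.mem_span_singleton_self l), fun x hx => ?_⟩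
  have : x ∈ Submodule.span ℤ {l} := hl ▸ (hmem x).2 hx
  obtain ⟨n, hn⟩ := Submodule.mem_span_singleton.1 this
  exact ⟨n, by rw [← hn, zsmul_eq_mul]⟩

/-- Kronecker's theorem: the only other embedding is the complex conjugate one, so all conjugates
have absolute value 1. -/
theorem mem_torsion_of_norm_eq_one (hK : Module.finrank ℚ K = 2) (hO : IsQuadraticOrder O)
    (φ : K →+* ℂ) (ξ : Oˣ) (hξ : ‖φ (ξ : O)‖ = 1) : ξ ∈ CommGroup.torsion Oˣ := by
  obtain ⟨n, hn, h⟩ := NumberField.Embeddings.pow_eq_one_of_norm_eq_one K ℂ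
    (hO.isIntegral (ξ : O)) (fun ψ => by
      rcases embedding_eq_or hK φ ψ with rfl | rfl
      · exact hξ
      · simpa using hξ)
  refine isOfFinOrder_iff_pow_eq_one.2 ⟨n, hn, Units.ext (Subtype.ext ?_)⟩
  push_cast
  exact h

/-- `U(1,1)(ℤ)` is generated by the scalar matrices and `SL₂(ℤ)`. -/
theorem exists_eq_scalar_mul_ofSL2 (hK : Module.finrank ℚ K = 2) (hO : IsQuadraticOrder O)
    (A : U11 φ O) : ∃ (ξ : CommGroup.torsion Oˣ) (B : SL(2, ℤ)),
      A = scalar φ O ξ * ofSL2 φ O B := by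
  -- All entries share the ratio det A to their conjugates, so A is `l` times an integral matrix
  -- `m`.
  obtain ⟨l, hl, hgen⟩ := exists_generator (φ := φ) hK hO (det_ne_zero A)
  have hA : ∀ i k, ∃ n : ℤ, A.val.val i k = n * l := fun i k =>
    hgen _ (entry_eq_det_mul_conj A i k)
  choose m hm using hA
  have hentry : ∀ i k, entry A i k = m i k * φ l := by
    intro i k
    rw [entry, hm]
    simp
  set D : ℤ := m 0 0 * m 1 1 - m 0 1 * m 1 0 with hD
  have hdet : det A = D * φ l ^ 2 := by
    rw [det, hentry, hentry, hentry, hentry, hD]; push_cast; ring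
  have hl0 : φ l ≠ 0 := by
    intro h0
    apply det_ne_zero A
    rw [hdet, h0]; ring
  obtain ⟨c, hc⟩ := hO.exists_conj hK φ l
  obtain ⟨N, hN⟩ := hO.exists_int_of_conj_eq hK φ (x := l * c) (by
    push_cast
    rw [map_mul, map_mul, hc, Complex.conj_conj, mul_comm])
  have hNl : (N : ℂ) = φ l * conj (φ l) := by
    rw [← hc, ← map_mul, ← map_intCast φ, ← hN, Subring.coe_mul]
  -- Substitute det A = D l² into l = det A · conj l. As N = |l|² is a positive integer, both D and
  -- N are 1.
  have hDN : (D : ℂ) * N = 1 := by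
    rw [hdet] at hl
    rw [hNl]
    apply mul_left_cancel₀ hl0
    linear_combination -hl
  have hDN' : D * N = 1 := by exact_mod_cast hDN
  have hNpos : 0 < N := by
    rw [Complex.mul_conj] at hNl
    have h1 : (N : ℝ) = Complex.normSq (φ l) := by exact_mod_cast hNl
    have h2 := Complex.normSq_pos.2 hl0
    rw [← h1] at h2
    exact_mod_cast h2
  have hN1 : N = 1 := by
    rcases Int.eq_one_or_neg_one_of_mul_eq_one' hDN' with h | h <;> omega
  have hD1 : D = 1 := by rw [hN1, mul_one] at hDN'; exact hDN'
  have hlc : l * c = 1 := Subtype.ext (by rw [hN, hN1]; simp)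
  let ξ : Oˣ := ⟨l, c, hlc, by rw [mul_comm]; exact hlc⟩
  have hξ : ξ ∈ CommGroup.torsion Oˣ := by
    refine mem_torsion_of_norm_eq_one hK hO φ ξ ?_
    rw [hN1, Complex.mul_conj, Complex.normSq_eq_norm_sq] at hNl
    have h1 : (1 : ℝ) = ‖φ l‖ ^ 2 := by exact_mod_cast hNl
    exact (pow_eq_one_iff_of_nonneg (norm_nonneg _) two_ne_zero).1 h1.symm
  let B : SL(2, ℤ) := ⟨Matrix.of m, by rw [Matrix.det_fin_two]; exact hD1⟩
  refine ⟨⟨ξ, hξ⟩, B, Subtype.ext (Units.ext ?_)⟩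
  ext i k
  have h1 : (scalar φ O ⟨ξ, hξ⟩ * ofSL2 φ O B).val.val
      = (Matrix.scalar (Fin 2) l) * (Matrix.of m).map (Int.castRingHom O) := rfl
  rw [h1, hm]
  fin_cases i <;> fin_cases k <;> simp [Matrix.scalar, mul_comm]

end Decomposition

end U11

set_option linter.unusedSectionVars false

/-! ### The discriminant group and its characters. -/

section Discriminant

open Module

theorem e_zero : e 0 = 1 := by simp [e]

theorem e_neg (z : ℂ) : e (-z) = (e z)⁻¹ := by
  rw [e, e, ← Complex.exp_neg]; ring_nf

theorem e_ne_zero (z : ℂ) : e z ≠ 0 := Complex.exp_ne_zero _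

theorem e_intCast (n : ℤ) : e (n : ℂ) = 1 :=
  Complex.exp_eq_one_iff.2 ⟨n, by ring⟩

theorem exists_int_of_e_eq_one {z : ℂ} (hz : e z = 1) : ∃ n : ℤ, z = n := by
  obtain ⟨n, hn⟩ := Complex.exp_eq_one_iff.1 hz
  refine ⟨n, ?_⟩
  rw [mul_comm] at hn
  exact mul_right_cancel₀ Complex.two_pi_I_ne_zero hn

variable {K : Type*} [Field K] [NumberField K] {φ : K →+* ℂ} {O : Subring K}
variable {V : Type*} [AddCommGroup V] [Module K V] [Module ℚ V]

section Classes

variable {h : HermitianPairing φ V} {M : Submodule O V}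

theorem cls_surjective : Function.Surjective (cls h M) := Submodule.mkQ_surjective _

theorem cls_add (x y : dual h M) : cls h M (x + y) = cls h M x + cls h M y := rfl

theorem cls_eq_zero_iff {x : dual h M} : cls h M x = 0 ↔ (x : V) ∈ M := by
  have : (0 : Disc h M) = cls h M 0 := rfl
  rw [this, cls_eq_cls_iff]
  simp

end Classes

variable [NumberField.IsTotallyComplex K] (hK : finrank ℚ K = 2) (hO : IsQuadraticOrder O)
variable {h : HermitianPairing φ V} {bp bm : ℕ} (hsig : h.HasSignature bp bm)
variable {M : Submodule O V} (hM : IsEvenLattice h M)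

include hK hO hsig hM

/-- M^* is finitely generated, and a common denominator of the coordinates of the dual basis
multiplies it into M; so the quotient is finitely generated and torsion. -/
theorem finite_disc : Finite (Disc h M) := by
  obtain ⟨n, b, b', hb, hb', -⟩ := h.exists_lattice_basis hK hsig hO hM
  obtain ⟨N, hN⟩ := IsLocalization.exist_integer_multiples_of_finite (nonZeroDivisors ℤ)
    (fun p : Fin n × Fin n => b.repr (b' p.1) p.2)
  have hmem : ∀ x : dual h M, ((N : ℤ) : ℚ) • (x : V) ∈ M := by
    intro x
    obtain ⟨m, hm⟩ := (hb' x).1 x.2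
    choose l hl using hN
    rw [hb]
    refine ⟨fun i => ∑ k, m k * l (k, i), ?_⟩
    apply b.repr.injective
    ext i
    have hl' : ∀ k, (l (k, i) : ℚ) = (N : ℤ) * b.repr (b' k) i := fun k => by
      have := hl (k, i)
      simpa using this
    rw [b.repr_sum_self, hm]
    simp only [map_smul, map_sum, Finsupp.smul_apply, Finsupp.coe_finsetSum, Finset.sum_apply,
      smul_eq_mul]
    push_cast
    rw [Finset.mul_sum]
    exact Finset.sum_congr rfl fun k _ => by rw [hl']; ring
  let f : (Fin n → ℤ) →+ Disc h M := AddMonoidHom.mk' (fun m => cls h M (dualEquiv b' hb' m)) (by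
    intro m l
    rw [← cls_add]
    congr 1
    apply Subtype.ext
    change ∑ i, ((m + l) i : ℚ) • b' i = ∑ i, (m i : ℚ) • b' i + ∑ i, (l i : ℚ) • b' i
    simp [add_smul, Finset.sum_add_distrib])
  have : Module.Finite ℤ (Disc h M) := Module.Finite.of_surjective f.toIntLinearMap
    (cls_surjective.comp (dualEquiv b' hb').surjective)
  refine Module.finite_of_fg_torsion (Disc h M) fun γ => ?_
  obtain ⟨x, rfl⟩ := cls_surjective γ
  refine ⟨N, ?_⟩
  have h1 : (N : ℤ) • cls h M x = cls h M ((N : ℤ) • x) :=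
    (map_zsmul ((M.submoduleOf (dual h M)).mkQ) (N : ℤ) x).symm
  change (N : ℤ) • cls h M x = 0
  rw [h1, cls_eq_zero_iff]
  have h2 := hmem x
  rwa [Int.cast_smul_eq_zsmul] at h2

/-- A vector that pairs integrally with the dual lattice lies in the lattice. -/
theorem mem_of_forall_dual {x : V} (hx : ∀ y ∈ dual h M, ∃ n : ℤ, h.traceForm x y = n) :
    x ∈ M := by
  obtain ⟨n, b, b', hb, hb', hbb⟩ := h.exists_lattice_basis hK hsig hO hM
  have hb'mem : ∀ i, b' i ∈ dual h M := fun i =>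
    (hb' _).2 ⟨Pi.single i 1, by simp [Pi.single_apply]⟩
  choose m hm using fun i => hx (b' i) (hb'mem i)
  refine (hb x).2 ⟨m, ?_⟩
  rw [← b.sum_repr x]
  refine Finset.sum_congr rfl fun i _ => ?_
  have h1 := hm i
  rw [h.traceForm_comm hK, ← b.sum_repr x] at h1
  simp only [map_sum, map_smul, hbb, smul_eq_mul, mul_ite, mul_one, mul_zero, Finset.sum_ite_eq',
    Finset.mem_univ, if_true] at h1
  rw [← h1]

omit hsig hM in
theorem exists_int_traceForm (x : dual h M) {y : V} (hy : y ∈ M) :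
    ∃ n : ℤ, h.traceForm x y = n ∧ h.traceForm y x = n := by
  obtain ⟨n, hn⟩ := (h.mem_dual_iff hK hO M x).1 x.2 y hy
  exact ⟨n, hn, by rw [h.traceForm_comm hK, hn]⟩

omit hsig hM in
theorem e_traceForm_congr {x x' y y' : dual h M} (hx : cls h M x = cls h M x')
    (hy : cls h M y = cls h M y') : e (h.traceForm x y : ℂ) = e (h.traceForm x' y' : ℂ) := by
  obtain ⟨n, -, hn⟩ := exists_int_traceForm hK hO y (cls_eq_cls_iff.1 hx)
  obtain ⟨k, hk, -⟩ := exists_int_traceForm hK hO x' (cls_eq_cls_iff.1 hy)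
  have : (h.traceForm x y : ℂ) = h.traceForm x' y' + ((n + k : ℤ) : ℂ) := by
    simp only [map_sub, LinearMap.sub_apply] at hn hk
    have h1 : h.traceForm x y = h.traceForm x' y' + (n + k) := by linarith
    rw [h1]; push_cast; ring
  rw [this, e_add, e_intCast, mul_one]

/-- The pairing `e(-(γ, δ))` on the discriminant group. -/
def discPair (h : HermitianPairing φ V) (M : Submodule O V) (γ δ : Disc h M) : ℂ :=
  e (-(h.traceForm (cls_surjective γ).choose (cls_surjective δ).choose : ℂ))

omit hsig hM in
theorem discPair_cls (x y : dual h M) :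
    discPair h M (cls h M x) (cls h M y) = e (-(h.traceForm x y : ℂ)) := by
  rw [discPair, e_neg, e_neg, e_traceForm_congr hK hO (cls_surjective (cls h M x)).choose_spec
    (cls_surjective (cls h M y)).choose_spec]

omit hsig hM in
theorem discPair_comm (γ δ : Disc h M) : discPair h M γ δ = discPair h M δ γ := by
  obtain ⟨x, rfl⟩ := cls_surjective γ
  obtain ⟨y, rfl⟩ := cls_surjective δ
  rw [discPair_cls hK hO, discPair_cls hK hO, h.traceForm_comm hK]

omit hsig hM in
theorem discPair_zero_left (δ : Disc h M) : discPair h M 0 δ = 1 := by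
  obtain ⟨y, rfl⟩ := cls_surjective δ
  have : (0 : Disc h M) = cls h M 0 := rfl
  rw [this, discPair_cls hK hO]
  simp [e_zero]

omit hsig hM in
theorem discPair_add_left (γ γ' δ : Disc h M) :
    discPair h M (γ + γ') δ = discPair h M γ δ * discPair h M γ' δ := by
  obtain ⟨x, rfl⟩ := cls_surjective γ
  obtain ⟨x', rfl⟩ := cls_surjective γ'
  obtain ⟨y, rfl⟩ := cls_surjective δ
  rw [← cls_add, discPair_cls hK hO, discPair_cls hK hO, discPair_cls hK hO, ← e_add]
  congr 1
  rw [Submodule.coe_add, map_add, LinearMap.add_apply]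
  push_cast; ring

open Classical in
/-- Orthogonality of the characters of the discriminant group. -/
theorem sum_discPair [Fintype (Disc h M)] (γ : Disc h M) :
    ∑ δ, discPair h M δ γ = if γ = 0 then (Nat.card (Disc h M) : ℂ) else 0 := by
  let ψ : AddChar (Disc h M) ℂ :=
    { toFun := fun δ => discPair h M δ γ
      map_zero_eq_one' := discPair_zero_left hK hO γ
      map_add_eq_mul' := fun δ δ' => discPair_add_left hK hO δ δ' γ }
  have h1 := AddChar.sum_eq_ite ψ
  have h2 : ψ = 0 ↔ γ = 0 := by
    constructor
    -- A trivial character means that x pairs integrally with all of M^*, and the integral dual of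
    -- M^* is M.
    · intro hψ
      obtain ⟨x, rfl⟩ := cls_surjective γ
      rw [cls_eq_zero_iff]
      refine mem_of_forall_dual hK hO hsig hM fun y hy => ?_
      have h3 : ψ (cls h M ⟨y, hy⟩) = 1 := by rw [hψ]; rfl
      have h4 : e (-(h.traceForm y x : ℂ)) = 1 :=
        (discPair_cls hK hO ⟨y, hy⟩ x).symm.trans h3
      obtain ⟨n, hn⟩ := exists_int_of_e_eq_one h4
      refine ⟨-n, ?_⟩
      rw [h.traceForm_comm hK]
      have h5 : (h.traceForm y x : ℂ) = ((-n : ℤ) : ℂ) := by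
        push_cast; rw [← hn, neg_neg]
      exact_mod_cast h5
    · rintro rfl
      ext δ
      change discPair h M δ 0 = 1
      rw [discPair_comm hK hO, discPair_zero_left hK hO]
  simp only [h2] at h1
  rw [Nat.card_eq_fintype_card]
  exact h1

end Discriminant

set_option linter.unusedSectionVars false

/-! ### The transformation law: cocycle property, translations and scalars. -/

section Transformation

open Module

variable {K : Type*} [Field K] [NumberField K] {φ : K →+* ℂ} {O : Subring K}
variable {V : Type*} [AddCommGroup V] [Module K V] [Module ℚ V]
variable {h : HermitianPairing φ V}

/-- The action of `U(1,1)(ℤ)` on the parameter `ζ`. -/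
def zetaAct (v : GrJ h) (A : U11 φ O) (τ : ℍ) (ζ : ℂ ⊗[ℚ] V) : ℂ ⊗[ℚ] V :=
  (U11.j A τ)⁻¹ • v.projPos ζ + (conj (U11.jc A τ))⁻¹ • v.projNeg ζ

/-- The action of `U(1,1)(ℤ)` on the parameter `ω`. -/
def omegaAct (v : GrJ h) (A : U11 φ O) (τ : ℍ) (ω : ℂ ⊗[ℚ] V) : ℂ ⊗[ℚ] V :=
  (U11.jc A τ)⁻¹ • v.projPos ω + (conj (U11.j A τ))⁻¹ • v.projNeg ω

/-- The exponent in the factor of automorphy of the theta function. -/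
def expFactor (v : GrJ h) (A : U11 φ O) (τ : ℍ) (ζ ω : ℂ ⊗[ℚ] V) : ℂ :=
  U11.jDeriv A * h.pairC (v.projPos ζ) (v.projPos ω) / U11.j A τ
    + conj (U11.jDeriv A) * h.pairC (v.projNeg ζ) (v.projNeg ω) / conj (U11.j A τ)

/-- The factor of automorphy of the theta function. -/
def autFactor (bp bm : ℕ) (v : GrJ h) (A : U11 φ O) (τ : ℍ) (ζ ω : ℂ ⊗[ℚ] V) : ℂ :=
  U11.j A τ ^ bp * conj (U11.j A τ) ^ bm * e (expFactor v A τ ζ ω)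

/-- The endomorphism `R` of `ℂ[D_M]` describes the behaviour of the theta function under `A`. -/
def Transforms (h : HermitianPairing φ V) (M : Submodule O V) (bp bm : ℕ) (A : U11 φ O)
    (R : Module.End ℂ (GroupSpace h M)) : Prop :=
  ∀ (v : GrJ h) (τ : ℍ), ∀ ζ ∈ VC φ V, ∀ ω ∈ VCbar φ V,
    Theta h M v (U11.act A τ) (zetaAct v A τ ζ) (omegaAct v A τ ω)
      = autFactor bp bm v A τ ζ ω • R (Theta h M v τ ζ ω)

section Cocycle

variable (v : GrJ h) (A B : U11 φ O) (τ : ℍ)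

theorem projPos_zetaAct (ζ : ℂ ⊗[ℚ] V) :
    v.projPos (zetaAct v A τ ζ) = (U11.j A τ)⁻¹ • v.projPos ζ := by
  simp [zetaAct, v.projPos_projPos, v.projPos_projNeg]

theorem projNeg_zetaAct (ζ : ℂ ⊗[ℚ] V) :
    v.projNeg (zetaAct v A τ ζ) = (conj (U11.jc A τ))⁻¹ • v.projNeg ζ := by
  simp [zetaAct, v.projNeg_projPos, v.projNeg_projNeg]

theorem projPos_omegaAct (ω : ℂ ⊗[ℚ] V) :
    v.projPos (omegaAct v A τ ω) = (U11.jc A τ)⁻¹ • v.projPos ω := by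
  simp [omegaAct, v.projPos_projPos, v.projPos_projNeg]

theorem projNeg_omegaAct (ω : ℂ ⊗[ℚ] V) :
    v.projNeg (omegaAct v A τ ω) = (conj (U11.j A τ))⁻¹ • v.projNeg ω := by
  simp [omegaAct, v.projNeg_projPos, v.projNeg_projNeg]

theorem zetaAct_mem {ζ : ℂ ⊗[ℚ] V} (hζ : ζ ∈ VC φ V) : zetaAct v A τ ζ ∈ VC φ V :=
  add_mem (Submodule.smul_mem _ _ (v.projPos_mem_VC hζ))
    (Submodule.smul_mem _ _ (v.projNeg_mem_VC hζ))

theorem omegaAct_mem {ω : ℂ ⊗[ℚ] V} (hω : ω ∈ VCbar φ V) : omegaAct v A τ ω ∈ VCbar φ V :=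
  add_mem (Submodule.smul_mem _ _ (v.projPos_mem_VCbar hω))
    (Submodule.smul_mem _ _ (v.projNeg_mem_VCbar hω))

theorem zetaAct_mul (ζ : ℂ ⊗[ℚ] V) :
    zetaAct v (A * B) τ ζ = zetaAct v A (U11.act B τ) (zetaAct v B τ ζ) := by
  rw [zetaAct, U11.j_mul, U11.jc_mul, zetaAct, projPos_zetaAct, projNeg_zetaAct, smul_smul,
    smul_smul, mul_inv, map_mul, mul_inv]

theorem omegaAct_mul (ω : ℂ ⊗[ℚ] V) :
    omegaAct v (A * B) τ ω = omegaAct v A (U11.act B τ) (omegaAct v B τ ω) := by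
  rw [omegaAct, U11.j_mul, U11.jc_mul, omegaAct, projPos_omegaAct, projNeg_omegaAct, smul_smul,
    smul_smul, mul_inv, map_mul, mul_inv]

/-- The action of B divides ⟨ζ_{v₊}, ω_{v₊}⟩ by j · j^c, and ⟨ζ_{v₋}, ω_{v₋}⟩ by its conjugate.
These are the denominators in `U11.jDeriv_cocycle` and in its conjugate. -/
theorem expFactor_mul (ζ ω : ℂ ⊗[ℚ] V) :
    expFactor v (A * B) τ ζ ω
      = expFactor v A (U11.act B τ) (zetaAct v B τ ζ) (omegaAct v B τ ω)
        + expFactor v B τ ζ ω := by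
  have h1 := U11.jDeriv_cocycle A B τ
  have h2 := congrArg conj h1
  simp only [map_div₀, map_add, map_mul] at h2
  have h3 : ∀ p q n m : ℂ, p * q / n = p / n * q := fun p q n m => by ring
  simp only [expFactor, projPos_zetaAct, projNeg_zetaAct, projPos_omegaAct, projNeg_omegaAct,
    map_smul, LinearMap.smul_apply, smul_eq_mul]
  rw [mul_div_right_comm, h1, mul_div_right_comm (conj (U11.jDeriv (A * B))), h2]
  simp only [div_eq_mul_inv, mul_inv]
  ring

theorem autFactor_mul (bp bm : ℕ) (ζ ω : ℂ ⊗[ℚ] V) :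
    autFactor bp bm v (A * B) τ ζ ω
      = autFactor bp bm v B τ ζ ω
        * autFactor bp bm v A (U11.act B τ) (zetaAct v B τ ζ) (omegaAct v B τ ω) := by
  rw [autFactor, expFactor_mul, e_add, U11.j_mul, map_mul, mul_pow, mul_pow, autFactor, autFactor]
  ring

theorem autFactor_ne_zero (bp bm : ℕ) (ζ ω : ℂ ⊗[ℚ] V) : autFactor bp bm v A τ ζ ω ≠ 0 :=
  mul_ne_zero (mul_ne_zero (pow_ne_zero _ (U11.j_ne_zero A τ))
    (pow_ne_zero _ ((map_ne_zero _).2 (U11.j_ne_zero A τ)))) (e_ne_zero _)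

theorem Transforms.mul {M : Submodule O V} {bp bm : ℕ} {A B : U11 φ O}
    {R S : Module.End ℂ (GroupSpace h M)} (hA : Transforms h M bp bm A R)
    (hB : Transforms h M bp bm B S) : Transforms h M bp bm (A * B) (R * S) := by
  intro v τ ζ hζ ω hω
  rw [U11.act_mul, zetaAct_mul, omegaAct_mul,
    hA v _ _ (zetaAct_mem v B τ hζ) _ (omegaAct_mem v B τ hω), hB v τ ζ hζ ω hω, map_smul,
    smul_smul, autFactor_mul, mul_comm, Module.End.mul_apply]

end Cocycle

variable {M : Submodule O V} {bp bm : ℕ}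

theorem entry_ofSL2 (B : SL(2, ℤ)) (i k : Fin 2) : U11.entry (U11.ofSL2 φ O B) i k = B i k := by
  have : U11.entry (U11.ofSL2 φ O B) i k = φ ((Int.castRingHom O (B i k) : O) : K) := rfl
  rw [this]
  simp

section Translation

theorem j_ofSL2_T_zpow (n : ℤ) (τ : ℍ) : U11.j (U11.ofSL2 φ O (ModularGroup.T ^ n)) τ = 1 := by
  rw [U11.j, entry_ofSL2, entry_ofSL2, ModularGroup.coe_T_zpow]
  simp

theorem jc_ofSL2_T_zpow (n : ℤ) (τ : ℍ) : U11.jc (U11.ofSL2 φ O (ModularGroup.T ^ n)) τ = 1 := by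
  rw [U11.jc, entry_ofSL2, entry_ofSL2, ModularGroup.coe_T_zpow]
  simp

theorem jDeriv_ofSL2_T_zpow (n : ℤ) :
    U11.jDeriv (U11.ofSL2 φ O (ModularGroup.T ^ n)) = 0 := by
  rw [U11.jDeriv, entry_ofSL2, ModularGroup.coe_T_zpow]
  simp

theorem act_ofSL2_T_zpow (n : ℤ) (τ : ℍ) :
    (U11.act (U11.ofSL2 φ O (ModularGroup.T ^ n)) τ : ℂ) = τ + n := by
  rw [U11.coe_act, j_ofSL2_T_zpow, entry_ofSL2, entry_ofSL2, ModularGroup.coe_T_zpow]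
  simp

/-- The operator `𝔢_γ ↦ e(n γ² / 2) 𝔢_γ`. -/
def weilT (h : HermitianPairing φ V) (M : Submodule O V) (n : ℤ) :
    Module.End ℂ (GroupSpace h M) :=
  LinearMap.pi fun γ => e (n * φ (h.toFun (cls_surjective γ).choose (cls_surjective γ).choose))
    • LinearMap.proj γ

variable [NumberField.IsTotallyComplex K] (hK : finrank ℚ K = 2) (hO : IsQuadraticOrder O)
variable (hsig : h.HasSignature bp bm) (hM : IsEvenLattice h M)

include hK hO hM

/-- The difference |x|² - |y|² is (y, x - y) + |x - y|²: the first term is integral by duality, the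
second because M is even. -/
theorem e_norm_congr (n : ℤ) {x y : dual h M} (hxy : cls h M x = cls h M y) :
    e (n * φ (h.toFun x x)) = e (n * φ (h.toFun y y)) := by
  rw [cls_eq_cls_iff] at hxy
  obtain ⟨a, ha⟩ := hM.even _ hxy
  obtain ⟨b, hb, -⟩ := exists_int_traceForm hK hO y hxy
  have h1 := h.coe_traceForm_self hK (x : V)
  have h2 : (h.traceForm x x : ℂ) = 2 * φ (h.toFun y y) + 2 * b + 2 * a := by
    have h3 := h.coe_traceForm_self hK (y : V)
    have h4 := h.coe_traceForm_self hK ((x : V) - y)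
    rw [ha, map_intCast] at h4
    have h5 : h.traceForm x x = h.traceForm y y + 2 * b
        + h.traceForm ((x : V) - y) ((x : V) - y) := by
      rw [← hb]
      simp only [map_sub, LinearMap.sub_apply]
      rw [h.traceForm_comm hK (x : V) y]
      ring
    rw [h5]
    push_cast
    rw [h3, h4]
  have h6 : φ (h.toFun x x) = φ (h.toFun y y) + b + a := by
    linear_combination (1 / 2) * h2 - (1 / 2) * h1
  have h7 : (n : ℂ) * φ (h.toFun x x) = n * φ (h.toFun y y) + ((n * (b + a) : ℤ) : ℂ) := by
    rw [h6]; push_cast; ring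
  rw [h7, e_add, e_intCast, mul_one]

theorem weilT_apply (n : ℤ) (f : GroupSpace h M) (x : dual h M) :
    weilT h M n f (cls h M x) = e (n * φ (h.toFun x x)) * f (cls h M x) := by
  rw [← e_norm_congr hK hO hM n (cls_surjective (cls h M x)).choose_spec]
  rfl

theorem weilT_basisVec (n : ℤ) (x : dual h M) :
    weilT h M n (basisVec h M (cls h M x))
      = e (n * φ (h.toFun x x)) • basisVec h M (cls h M x) := by
  classical
  ext γ
  obtain ⟨y, rfl⟩ := cls_surjective γ
  rw [weilT_apply hK hO hM, Pi.smul_apply, smul_eq_mul, basisVec, Pi.single_apply]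
  split_ifs with hxy
  · rw [e_norm_congr hK hO hM n hxy]
  · simp

include hsig

omit hO hM in
theorem pairC_proj_self_add (v : GrJ h) (z : ℂ ⊗[ℚ] V) :
    h.pairC (v.projPos z) (v.projPos z) + h.pairC (v.projNeg z) (v.projNeg z) = h.pairC z z := by
  obtain ⟨e, hp, hn, he⟩ := v.exists_basis hK hsig
  rw [pairC_projPos_self hK hp hn he, pairC_projNeg_self hK hp hn he, pairC_self hK he,
    Fintype.sum_sum_type]
  simp [sgn]

omit hO hM in
theorem thetaTerm_add_int (v : GrJ h) {τ τ' : ℍ} {n : ℤ} (hτ : (τ' : ℂ) = τ + n)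
    (ζ ω : ℂ ⊗[ℚ] V) (x : V) :
    thetaTerm v τ' ζ ω x = e (n * φ (h.toFun x x)) * thetaTerm v τ ζ ω x := by
  have h1 : φ (h.toFun x x) = h.pairC (toC x) (toC x) := by simp [toC, h.pairC_tmul]
  rw [h1, ← pairC_proj_self_add hK hsig v, thetaTerm, thetaTerm, ← e_add, hτ]
  congr 1
  simp only [map_add, map_intCast]
  ring

/-- All powers are treated at once because the generation argument also needs T⁻¹. -/
theorem transforms_T_zpow (n : ℤ) :
    Transforms h M bp bm (U11.ofSL2 φ O (ModularGroup.T ^ n)) (weilT h M n) := by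
  intro v τ ζ hζ ω hω
  have h1 : autFactor bp bm v (U11.ofSL2 φ O (ModularGroup.T ^ n)) τ ζ ω = 1 := by
    rw [autFactor, expFactor, j_ofSL2_T_zpow, jDeriv_ofSL2_T_zpow]
    simp [e_zero]
  rw [h1, one_smul, zetaAct, omegaAct, j_ofSL2_T_zpow, jc_ofSL2_T_zpow]
  simp only [map_one, inv_one, one_smul, v.projPos_add_projNeg]
  ext γ
  obtain ⟨x, rfl⟩ := cls_surjective γ
  rw [weilT_apply hK hO hM, Theta, Theta, ← tsum_mul_left]
  refine tsum_congr fun y => ?_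
  rw [thetaTerm_add_int hK hsig v (act_ofSL2_T_zpow n τ), e_norm_congr hK hO hM n y.2]

omit hsig in
theorem transforms_one : Transforms h M bp bm 1 1 := by
  intro v τ ζ _ ω _
  have e10 : U11.entry (1 : U11 φ O) 1 0 = 0 := by simp [U11.entry]
  have e11 : U11.entry (1 : U11 φ O) 1 1 = 1 := by simp [U11.entry]
  have e00 : U11.entry (1 : U11 φ O) 0 0 = 1 := by simp [U11.entry]
  have e01 : U11.entry (1 : U11 φ O) 0 1 = 0 := by simp [U11.entry]
  have hj : U11.j (1 : U11 φ O) τ = 1 := by simp [U11.j, e10, e11]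
  have hjc : U11.jc (1 : U11 φ O) τ = 1 := by simp [U11.jc, e10, e11]
  have hact : U11.act (1 : U11 φ O) τ = τ := UpperHalfPlane.ext (by
    simp [U11.coe_act, hj, e00, e01])
  have h1 : autFactor bp bm v (1 : U11 φ O) τ ζ ω = 1 := by
    simp [autFactor, expFactor, hj, U11.jDeriv, e10, e_zero]
  rw [h1, one_smul, zetaAct, omegaAct, hj, hjc, hact]
  simp only [map_one, inv_one, one_smul, v.projPos_add_projNeg, Module.End.one_apply]

end Translation

section Scalar

variable (ξ : CommGroup.torsion Oˣ)

theorem norm_torsion : φ ((ξ : Oˣ) : O) * conj (φ ((ξ : Oˣ) : O)) = 1 := by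
  obtain ⟨n, hn, hξ⟩ := isOfFinOrder_iff_pow_eq_one.1 ξ.property
  have h1 : φ ((ξ : Oˣ) : O) ^ n = 1 := by
    rw [← map_pow]
    have := congrArg (fun u : Oˣ => ((u : O) : K)) hξ
    simpa using congrArg φ this
  have h2 : ‖φ ((ξ : Oˣ) : O)‖ = 1 := Complex.norm_eq_one_of_pow_eq_one h1 hn.ne'
  rw [Complex.mul_conj, Complex.normSq_eq_norm_sq, h2]
  simp

theorem conj_torsion : conj (φ ((ξ : Oˣ) : O)) = (φ ((ξ : Oˣ) : O))⁻¹ :=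
  eq_inv_of_mul_eq_one_right (norm_torsion ξ)

theorem torsion_ne_zero : φ ((ξ : Oˣ) : O) ≠ 0 := left_ne_zero_of_mul_eq_one (norm_torsion ξ)

theorem entry_scalar (i k : Fin 2) :
    U11.entry (U11.scalar φ O ξ) i k = if i = k then φ ((ξ : Oˣ) : O) else 0 := by
  have : U11.entry (U11.scalar φ O ξ) i k
      = φ ((Matrix.scalar (Fin 2) ((ξ : Oˣ) : O) i k : O) : K) := rfl
  rw [this, Matrix.scalar_apply, Matrix.diagonal_apply]
  split_ifs <;> simp

theorem j_scalar (τ : ℍ) : U11.j (U11.scalar φ O ξ) τ = φ ((ξ : Oˣ) : O) := by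
  simp [U11.j, entry_scalar]

theorem jc_scalar (τ : ℍ) : U11.jc (U11.scalar φ O ξ) τ = conj (φ ((ξ : Oˣ) : O)) := by
  simp [U11.jc, entry_scalar]

theorem act_scalar (τ : ℍ) : U11.act (U11.scalar φ O ξ) τ = τ := by
  apply UpperHalfPlane.ext
  rw [U11.coe_act, j_scalar, entry_scalar, entry_scalar]
  simp [mul_div_cancel_left₀ _ (torsion_ne_zero (φ := φ) ξ)]

theorem toC_smul (a : K) (x : V) : toC (a • x) = (scalarEnd V a).baseChange ℂ (toC x) := rfl

theorem projNeg_scalarEnd (v : GrJ h) (a : K) (z : ℂ ⊗[ℚ] V) :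
    v.projNeg ((scalarEnd V a).baseChange ℂ z) = (scalarEnd V a).baseChange ℂ (v.projNeg z) := by
  have h1 := v.projPos_add_projNeg ((scalarEnd V a).baseChange ℂ z)
  nth_rewrite 3 [← v.projPos_add_projNeg z] at h1
  rw [map_add, v.projPos_scalarEnd] at h1
  exact add_left_cancel h1

/-- Multiplication by ξ is an isometry commuting with the projections, so the quadratic terms agree;
the linear ones agree since conj ξ = ξ⁻¹. -/
theorem thetaTerm_torsion (v : GrJ h) (τ : ℍ) (ζ ω : ℂ ⊗[ℚ] V) (x : V) :
    thetaTerm v τ ((φ ((ξ : Oˣ) : O))⁻¹ • ζ) ((conj (φ ((ξ : Oˣ) : O)))⁻¹ • ω) x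
      = thetaTerm v τ ζ ω ((((ξ : Oˣ) : O) : K) • x) := by
  have h1 := norm_torsion (φ := φ) ξ
  rw [thetaTerm, thetaTerm, toC_smul, v.projPos_scalarEnd, projNeg_scalarEnd]
  simp only [h.pairC_scalarEnd_left, h.pairC_scalarEnd_right, map_smul, LinearMap.smul_apply,
    smul_eq_mul]
  rw [conj_torsion, inv_inv]
  rw [conj_torsion] at h1
  congr 1
  linear_combination -(τ * h.pairC (v.projPos (toC x)) (v.projPos (toC x))
    + conj (τ : ℂ) * h.pairC (v.projNeg (toC x)) (v.projNeg (toC x))) * h1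

/-- The operator `𝔢_γ ↦ ξ ^ (bm - bp) 𝔢_{ξ⁻¹ γ}`. -/
def weilScalar (h : HermitianPairing φ V) (M : Submodule O V) (bp bm : ℕ)
    (ξ : CommGroup.torsion Oˣ) : Module.End ℂ (GroupSpace h M) :=
  LinearMap.pi fun γ => φ ((ξ : Oˣ) : O) ^ ((bm : ℤ) - (bp : ℤ))
    • LinearMap.proj (((ξ : Oˣ) : O) • γ)

theorem weilScalar_apply (f : GroupSpace h M) (γ : Disc h M) :
    weilScalar h M bp bm ξ f γ
      = φ ((ξ : Oˣ) : O) ^ ((bm : ℤ) - (bp : ℤ)) * f (((ξ : Oˣ) : O) • γ) := rfl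

theorem weilScalar_basisVec (x : dual h M) :
    weilScalar h M bp bm ξ (basisVec h M (cls h M x))
      = φ ((ξ : Oˣ) : O) ^ ((bm : ℤ) - (bp : ℤ))
        • basisVec h M (cls h M ((((ξ : Oˣ)⁻¹ : Oˣ) : O) • x)) := by
  classical
  ext γ
  have h1 : cls h M ((((ξ : Oˣ)⁻¹ : Oˣ) : O) • x) = (((ξ : Oˣ)⁻¹ : Oˣ) : O) • cls h M x := rfl
  have h2 : ((ξ : Oˣ) : O) • γ = cls h M x ↔ γ = (((ξ : Oˣ)⁻¹ : Oˣ) : O) • cls h M x := by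
    constructor
    · intro h3
      rw [← h3, smul_smul, Units.inv_mul, one_smul]
    · rintro rfl
      rw [smul_smul, Units.mul_inv, one_smul]
  rw [weilScalar_apply, Pi.smul_apply, smul_eq_mul, basisVec, basisVec, Pi.single_apply,
    Pi.single_apply, h1]
  simp only [h2]

/-- The automorphy factor is ξ^{b₊ - b₋}, which cancels the scalar in `weilScalar`; what remains is
the substitution x ↦ ξx, a permutation of M^*. -/
theorem transforms_scalar :
    Transforms h M bp bm (U11.scalar φ O ξ) (weilScalar h M bp bm ξ) := by
  intro v τ ζ _ ω _
  have hj := j_scalar (φ := φ) ξ τ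
  have hjc := jc_scalar (φ := φ) ξ τ
  have h0 := torsion_ne_zero (φ := φ) ξ
  have h1 : autFactor bp bm v (U11.scalar φ O ξ) τ ζ ω
      * φ ((ξ : Oˣ) : O) ^ ((bm : ℤ) - (bp : ℤ)) = 1 := by
    have h2 : expFactor v (U11.scalar φ O ξ) τ ζ ω = 0 := by
      simp [expFactor, U11.jDeriv, entry_scalar]
    rw [autFactor, h2, e_zero, mul_one, hj, conj_torsion, zpow_sub₀ h0, inv_pow, zpow_natCast,
      zpow_natCast]
    field_simp
  ext γ
  rw [Pi.smul_apply, weilScalar_apply, smul_eq_mul, ← mul_assoc, h1, one_mul, act_scalar,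
    zetaAct, omegaAct, hj, hjc, Complex.conj_conj, ← smul_add, ← smul_add,
    v.projPos_add_projNeg, v.projPos_add_projNeg, Theta, Theta]
  let E : dual h M ≃ dual h M := MulAction.toPerm (ξ : Oˣ)
  have hE : ∀ x : dual h M, cls h M x = γ ↔ cls h M (E x) = ((ξ : Oˣ) : O) • γ := by
    intro x
    have h3 : cls h M (E x) = ((ξ : Oˣ) : O) • cls h M x := rfl
    rw [h3]
    exact (smul_left_cancel_iff (ξ : Oˣ) (x := cls h M x) (y := γ)).symm
  rw [← (E.subtypeEquiv hE).tsum_eq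
    fun x : {x : dual h M // cls h M x = ((ξ : Oˣ) : O) • γ} => thetaTerm v τ ζ ω (x : dual h M)]
  exact tsum_congr fun x => thetaTerm_torsion ξ v τ ζ ω x

end Scalar

end Transformation

set_option linter.unusedSectionVars false

/-! ### The transformation under S, its constant, and rigidity. -/

section Inversion

open Module

variable {K : Type*} [Field K] [NumberField K] {φ : K →+* ℂ} {O : Subring K}
variable {V : Type*} [AddCommGroup V] [Module K V] [Module ℚ V]
variable {h : HermitianPairing φ V} {M : Submodule O V} {bp bm : ℕ}

theorem j_ofSL2_S (τ : ℍ) : U11.j (U11.ofSL2 φ O ModularGroup.S) τ = τ := by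
  rw [U11.j, entry_ofSL2, entry_ofSL2, ModularGroup.coe_S]
  simp

theorem jc_ofSL2_S (τ : ℍ) : U11.jc (U11.ofSL2 φ O ModularGroup.S) τ = τ := by
  rw [U11.jc, entry_ofSL2, entry_ofSL2, ModularGroup.coe_S]
  simp

theorem jDeriv_ofSL2_S : U11.jDeriv (U11.ofSL2 φ O ModularGroup.S) = 1 := by
  rw [U11.jDeriv, entry_ofSL2, ModularGroup.coe_S]
  simp

theorem act_ofSL2_S (τ : ℍ) : (U11.act (U11.ofSL2 φ O ModularGroup.S) τ : ℂ) = -(τ : ℂ)⁻¹ := by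
  rw [U11.coe_act, j_ofSL2_S, entry_ofSL2, entry_ofSL2, ModularGroup.coe_S]
  simp [neg_div]

/-- The operator by which `S` acts in the Weil representation. -/
def weilS (h : HermitianPairing φ V) (M : Submodule O V) (bp bm : ℕ) [Fintype (Disc h M)] :
    Module.End ℂ (GroupSpace h M) :=
  LinearMap.pi fun δ => (Complex.I ^ ((bm : ℤ) - (bp : ℤ)) / (Real.sqrt (Nat.card (Disc h M)) : ℂ))
    • ∑ γ, discPair h M γ δ • LinearMap.proj γ

theorem weilS_apply [Fintype (Disc h M)] (f : GroupSpace h M) (δ : Disc h M) :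
    weilS h M bp bm f δ = Complex.I ^ ((bm : ℤ) - (bp : ℤ)) / (Real.sqrt (Nat.card (Disc h M)) : ℂ)
      * ∑ γ, discPair h M γ δ * f γ := by
  simp [weilS]

theorem weilS_basisVec [Fintype (Disc h M)] (γ δ : Disc h M) :
    weilS h M bp bm (basisVec h M γ) δ
      = Complex.I ^ ((bm : ℤ) - (bp : ℤ)) / (Real.sqrt (Nat.card (Disc h M)) : ℂ)
        * discPair h M γ δ := by
  classical
  rw [weilS_apply, basisVec]
  simp [Pi.single_apply]

theorem exists_eq_add_smul (hK : finrank ℚ K = 2) {a : K} (ha : conj (φ a) ≠ φ a) (c : K) :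
    ∃ p q : ℚ, c = p • (1 : K) + q • a := by
  have hli : LinearIndependent ℚ ![(1 : K), a] := by
    rw [LinearIndependent.pair_iff]
    intro s t hst
    have ht : t = 0 := by
      by_contra ht
      apply ha
      have h1 : a = ((-(t⁻¹ * s) : ℚ) : K) := by
        have h2 := congrArg (fun x => t⁻¹ • x) hst
        simp only [smul_add, smul_smul, inv_mul_cancel₀ ht, one_smul, smul_zero] at h2
        rw [Rat.smul_one_eq_cast] at h2
        push_cast at h2 ⊢
        linear_combination h2
      rw [h1, map_ratCast, map_ratCast]
    subst ht
    rw [zero_smul, add_zero, Rat.smul_one_eq_cast] at hst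
    exact ⟨by exact_mod_cast hst, rfl⟩
  have htop := hli.span_eq_top_of_card_eq_finrank (by simp [hK])
  have hc : c ∈ Submodule.span ℚ (Set.range ![(1 : K), a]) := htop ▸ Submodule.mem_top
  rw [Matrix.range_cons, Matrix.range_cons, Matrix.range_empty, Set.union_empty,
    Set.singleton_union, Submodule.mem_span_pair] at hc
  obtain ⟨p, q, hpq⟩ := hc
  exact ⟨p, q, hpq.symm⟩

theorem toC_rat_smul (q : ℚ) (x : V) : toC (q • x) = (q : ℂ) • toC x := by
  rw [toC, TensorProduct.tmul_smul, toC, Rat.cast_smul_eq_qsmul]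

theorem toC_add (x y : V) : toC (x + y) = toC x + toC y := TensorProduct.tmul_add _ _ _

/-- The decomposition of `V ⊗ ℂ` into the eigenspaces of the action of `K`. -/
theorem exists_toC_eq_add [NumberField.IsTotallyComplex K] (hK : finrank ℚ K = 2) (x : V) :
    ∃ ζ ∈ VC φ V, ∃ ω ∈ VCbar φ V, toC x = ζ + ω := by
  obtain ⟨a, ha⟩ := HermitianPairing.exists_conj_ne φ
  obtain ⟨r, s, hrs⟩ := exists_eq_add_smul hK ha (a * a)
  have hα : φ a * φ a = r + s * φ a := by
    have h1 := congrArg φ hrs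
    rw [map_mul, Rat.smul_one_eq_cast, map_add, map_rat_smul, map_ratCast] at h1
    rw [h1, Rat.smul_def]
  have hβ : conj (φ a) * conj (φ a) = r + s * conj (φ a) := by
    have h1 := congrArg conj hα
    simpa using h1
  have hs : (s : ℂ) = φ a + conj (φ a) := by
    have h0 : φ a - conj (φ a) ≠ 0 := sub_ne_zero.2 ha.symm
    apply mul_left_cancel₀ h0
    linear_combination hβ - hα
  have hr : (r : ℂ) = -(φ a * conj (φ a)) := by
    rw [hs] at hα
    linear_combination -hα
  have hx : ∀ (p q : ℚ) (y : V), toC ((p • (1 : K) + q • a) • y)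
      = (p : ℂ) • toC y + (q : ℂ) • toC (a • y) := by
    intro p q y
    rw [add_smul, toC_add, ← toC_rat_smul, ← toC_rat_smul]
    congr 2
    · rw [Rat.smul_one_eq_cast, Rat.cast_smul_eq_qsmul]
    · rw [Rat.smul_def, mul_smul, Rat.cast_smul_eq_qsmul]
  have haa : toC (a • a • x) = (r : ℂ) • toC x + (s : ℂ) • toC (a • x) := by
    rw [smul_smul, hrs, hx]
  have h0 : φ a - conj (φ a) ≠ 0 := sub_ne_zero.2 ha.symm
  -- Interpolation: the action of `a` satisfies a quadratic equation with the distinct roots φ a and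
  -- conj (φ a), and these are the components of x in its two eigenspaces.
  refine ⟨(φ a - conj (φ a))⁻¹ • (toC (a • x) - conj (φ a) • toC x), ?_,
    -(φ a - conj (φ a))⁻¹ • (toC (a • x) - φ a • toC x), ?_, ?_⟩
  · refine Submodule.smul_mem _ _ (mem_VC.2 fun c => ?_)
    obtain ⟨p, q, rfl⟩ := exists_eq_add_smul hK ha c
    rw [map_sub, map_smul, ← toC_smul, ← toC_smul, hx, hx, haa, hr, hs, map_add, map_rat_smul,
      map_rat_smul, map_one, Rat.smul_def, Rat.smul_def]
    module
  · refine Submodule.smul_mem _ _ (mem_VCbar.2 fun c => ?_)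
    obtain ⟨p, q, rfl⟩ := exists_eq_add_smul hK ha c
    rw [map_sub, map_smul, ← toC_smul, ← toC_smul, hx, hx, haa, hr, hs, map_add, map_rat_smul,
      map_rat_smul, map_one, Rat.smul_def, Rat.smul_def]
    simp only [map_add, map_mul, map_one, map_ratCast]
    module
  · rw [neg_smul, ← sub_eq_add_neg, ← smul_sub, sub_sub_sub_cancel_left, ← sub_smul, smul_smul,
      inv_mul_cancel₀ h0, one_smul]

variable [NumberField.IsTotallyComplex K] (hK : finrank ℚ K = 2) (hO : IsQuadraticOrder O)
variable (hsig : h.HasSignature bp bm) (hM : IsEvenLattice h M)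

include hK hsig

/-- At τ = i the exponent is -2π times the positive definite majorant of the form. The positivity
serves both for the constant of the inversion formula and for rigidity. -/
theorem exists_thetaTerm_I_eq (v : GrJ h) (x : V) :
    ∃ r : ℝ, 0 < r ∧ thetaTerm v UpperHalfPlane.I 0 0 x = r := by
  obtain ⟨b, hp, hn, hb⟩ := v.exists_basis hK hsig
  refine ⟨Real.exp (-(2 * Real.pi * (∑ i, coordR b x (Sum.inl i) ^ 2
    + ∑ i, coordR b x (Sum.inr i) ^ 2))), Real.exp_pos _, ?_⟩
  rw [thetaTerm, pairC_projPos_self hK hp hn hb, pairC_projNeg_self hK hp hn hb, e,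
    Complex.ofReal_exp]
  simp only [coordC_toC, map_zero, LinearMap.zero_apply, add_zero, UpperHalfPlane.coe_I,
    Complex.conj_I]
  congr 1
  push_cast
  linear_combination (2 * Real.pi * (∑ i, (coordR b x (Sum.inl i) : ℂ) ^ 2
    + ∑ i, (coordR b x (Sum.inr i) : ℂ) ^ 2)) * Complex.I_sq

include hO hM

theorem exists_Theta_I_eq (v : GrJ h) (γ : Disc h M) :
    ∃ r : ℝ, 0 < r ∧ Theta h M v UpperHalfPlane.I 0 0 γ = r := by
  choose r hr hθ using exists_thetaTerm_I_eq hK hsig v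
  refine ⟨∑' x : {x : dual h M // cls h M x = γ}, r (x : dual h M), ?_, ?_⟩
  · have hs := summable_norm_thetaTerm hK hO hsig hM v UpperHalfPlane.I
      (zero_mem (VC φ V)) (zero_mem (VCbar φ V))
    have hs' : Summable fun x : dual h M => r x := by
      refine hs.congr fun x => ?_
      rw [hθ, Complex.norm_real, Real.norm_of_nonneg (hr x).le]
    obtain ⟨x, hx⟩ := cls_surjective γ
    exact (hs'.subtype {x | cls h M x = γ}).tsum_pos (fun x => (hr _).le) ⟨x, hx⟩ (hr _)
  · rw [Theta, Complex.ofReal_tsum]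
    exact tsum_congr fun x => hθ x

theorem tsum_dual_eq_sum [Fintype (Disc h M)] (v : GrJ h) (τ : ℍ) {ζ ω : ℂ ⊗[ℚ] V}
    (hζ : ζ ∈ VC φ V) (hω : ω ∈ VCbar φ V) (x₀ : dual h M) :
    ∑' μ : dual h M, e (-(h.traceForm μ x₀ : ℂ)) * thetaTerm v τ ζ ω μ
      = ∑ γ, discPair h M γ (cls h M x₀) * Theta h M v τ ζ ω γ := by
  have hnorm : ∀ q : ℚ, ‖e (-(q : ℂ))‖ = 1 := by
    intro q
    have : (2 * Real.pi * Complex.I * (-(q : ℂ)) : ℂ)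
        = ((-(2 * Real.pi * q) : ℝ) : ℂ) * Complex.I := by
      push_cast; ring
    rw [e, this, Complex.norm_exp_ofReal_mul_I]
  have hs : Summable fun μ : dual h M => e (-(h.traceForm μ x₀ : ℂ)) * thetaTerm v τ ζ ω μ := by
    refine Summable.of_norm ((summable_norm_thetaTerm hK hO hsig hM v τ hζ hω).congr fun μ => ?_)
    rw [norm_mul, hnorm, one_mul]
  have hs' := (Equiv.sigmaFiberEquiv (cls h M)).summable_iff.2 hs
  rw [← (Equiv.sigmaFiberEquiv (cls h M)).tsum_eq]
  refine hs'.tsum_sigma.trans ?_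
  rw [tsum_fintype]
  refine Finset.sum_congr rfl fun γ _ => ?_
  rw [Theta, ← tsum_mul_left]
  refine tsum_congr fun x => ?_
  obtain ⟨x, rfl⟩ := x
  rw [discPair_cls hK hO]
  rfl

theorem transforms_S [Fintype (Disc h M)] :
    Transforms h M bp bm (U11.ofSL2 φ O ModularGroup.S) (weilS h M bp bm) := by
  intro v
  obtain ⟨C, hC, hinv⟩ := exists_thetaInversion hK hO hsig hM v
  have hcard : (0 : ℝ) < Nat.card (Disc h M) := by exact_mod_cast Nat.card_pos
  -- Let r be the positive vector Θ(i, 0, 0). Inversion at the fixed point i reads r_δ = C ∑_γ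
  -- e(-(γ, δ)) r_γ. Setting δ = 0 gives r_0 = C ∑ r; summing over δ gives ∑ r = C |D_M| r_0. Hence
  -- C² |D_M| = 1.
  have hCeq : (C : ℂ) = ((Real.sqrt (Nat.card (Disc h M)) : ℝ) : ℂ)⁻¹ := by
    choose r hr hθ using exists_Theta_I_eq hK hO hsig hM v
    have hrel : ∀ δ, (r δ : ℂ) = C * ∑ γ, discPair h M γ δ * r γ := by
      intro δ
      obtain ⟨x, rfl⟩ := cls_surjective δ
      have h1 := hinv UpperHalfPlane.I UpperHalfPlane.I (by simp) 0 (zero_mem _) 0 (zero_mem _) x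
      rw [tsum_dual_eq_sum hK hO hsig hM v _ (zero_mem _) (zero_mem _)] at h1
      simp only [map_zero, smul_zero, add_zero, zero_div, e_zero, mul_one, UpperHalfPlane.coe_I,
        Complex.conj_I, hθ] at h1
      -- The phase of the Weil representation cancels the automorphy factor at τ = i, leaving a
      -- relation between real numbers.
      have h2 : Complex.I ^ bp * (-Complex.I) ^ bm * Complex.I ^ ((bm : ℤ) - (bp : ℤ)) = 1 := by
        rw [← Complex.inv_I, zpow_sub₀ Complex.I_ne_zero, inv_pow, zpow_natCast, zpow_natCast]
        have := pow_ne_zero bp Complex.I_ne_zero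
        have := pow_ne_zero bm Complex.I_ne_zero
        field_simp
      rw [h1]
      linear_combination (C * ∑ γ, discPair h M γ (cls h M x) * r γ) * h2
    have hsum : (0 : ℝ) < ∑ γ, r γ := Finset.sum_pos (fun γ _ => hr γ) ⟨0, Finset.mem_univ 0⟩
    have h0 : (r 0 : ℂ) = C * ∑ γ, (r γ : ℂ) := by
      rw [hrel 0]
      congr 1
      refine Finset.sum_congr rfl fun γ _ => ?_
      rw [discPair_comm hK hO, discPair_zero_left hK hO, one_mul]
    have h1 : ∑ δ, (r δ : ℂ) = C * (Nat.card (Disc h M) * r 0) := by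
      classical
      calc ∑ δ, (r δ : ℂ) = ∑ δ, C * ∑ γ, discPair h M γ δ * r γ :=
            Finset.sum_congr rfl fun δ _ => hrel δ
        _ = C * ∑ γ, (∑ δ, discPair h M δ γ) * r γ := by
            rw [← Finset.mul_sum, Finset.sum_comm]
            simp only [Finset.sum_mul]
            congr 1
            refine Finset.sum_congr rfl fun γ _ => Finset.sum_congr rfl fun δ _ => ?_
            rw [discPair_comm hK hO]
        _ = C * (Nat.card (Disc h M) * r 0) := by
            simp [sum_discPair hK hO hsig hM]
    rw [h0] at h1
    have h2 : (∑ γ, r γ) * 1 = (∑ γ, r γ) * (C ^ 2 * Nat.card (Disc h M)) := by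
      have h3 : ((∑ γ, r γ : ℝ) : ℂ) = C * (Nat.card (Disc h M) * (C * (∑ γ, r γ : ℝ))) := by
        push_cast; exact h1
      have h4 : (∑ γ, r γ : ℝ) = C * (Nat.card (Disc h M) * (C * (∑ γ, r γ : ℝ))) := by
        exact_mod_cast h3
      linarith
    have h3 := mul_left_cancel₀ hsum.ne' h2
    have h4 : C = (Real.sqrt (Nat.card (Disc h M)))⁻¹ := by
      refine eq_inv_of_mul_eq_one_left ?_
      refine (pow_eq_one_iff_of_nonneg (by positivity) two_ne_zero).1 ?_
      rw [mul_pow, Real.sq_sqrt hcard.le, ← h3]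
    rw [h4, Complex.ofReal_inv]
  intro τ ζ hζ ω hω
  ext δ
  obtain ⟨x, rfl⟩ := cls_surjective δ
  rw [zetaAct, omegaAct, j_ofSL2_S, jc_ofSL2_S, hinv τ _ (act_ofSL2_S τ) ζ hζ ω hω x,
    tsum_dual_eq_sum hK hO hsig hM v τ hζ hω, Pi.smul_apply, weilS_apply, autFactor, expFactor,
    j_ofSL2_S, jDeriv_ofSL2_S, hCeq, smul_eq_mul]
  simp only [map_one, one_mul]
  ring

-- Splitting x = ζ + ω into eigencomponents turns the two linear terms into the trace pairing (x,
-- y). For x ∈ M^* this twists the components of Θ by a character of D_M.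
omit hO hM in
theorem exists_thetaTerm_eq_mul (v : GrJ h) (x : V) : ∃ ζ ∈ VC φ V, ∃ ω ∈ VCbar φ V,
    ∀ (τ : ℍ) (y : V), thetaTerm v τ ζ ω y = e (h.traceForm x y : ℂ) * thetaTerm v τ 0 0 y := by
  obtain ⟨ζ, hζ, ω, hω, hx⟩ := exists_toC_eq_add (φ := φ) hK x
  refine ⟨ζ, hζ, ω, hω, fun τ y => ?_⟩
  have h1 : h.pairC ζ (toC y) = φ (h.toFun x y) := by
    have : h.pairC (toC x) (toC y) = φ (h.toFun x y) := by simp [toC, h.pairC_tmul]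
    rw [← this, hx, map_add, LinearMap.add_apply, h.pairC_VCbar_left hω, add_zero]
  have h2 : h.pairC (toC y) ω = φ (h.toFun y x) := by
    have : h.pairC (toC y) (toC x) = φ (h.toFun y x) := by simp [toC, h.pairC_tmul]
    rw [← this, hx, map_add, h.pairC_VC_right hζ, zero_add]
  rw [thetaTerm, thetaTerm, h1, h2, ← e_add, h.coe_traceForm hK]
  simp only [map_zero, LinearMap.zero_apply]
  congr 1
  ring

/-- The values of the theta function determine an endomorphism of `ℂ[D_M]`. -/
theorem Transforms.unique {A : U11 φ O} {R R' : Module.End ℂ (GroupSpace h M)}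
    (hR : Transforms h M bp bm A R) (hR' : Transforms h M bp bm A R') : R = R' := by
  classical
  have hfin := finite_disc hK hO hsig hM
  have := Fintype.ofFinite (Disc h M)
  obtain ⟨v, -, -⟩ := exists_grJ h hK hsig
  choose r hr hθ using exists_Theta_I_eq hK hO hsig hM v
  have hex : ∀ γ : Disc h M, ∃ f : GroupSpace h M, R f = R' f ∧
      ∀ δ, f δ = discPair h M γ δ * r δ := by
    intro γ
    obtain ⟨x, rfl⟩ := cls_surjective γ
    -- The minus sign matches the sign in the definition of `discPair`.
    obtain ⟨ζ, hζ, ω, hω, hxy⟩ := exists_thetaTerm_eq_mul hK hsig v (-(x : V))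
    refine ⟨Theta h M v UpperHalfPlane.I ζ ω, ?_, fun δ => ?_⟩
    · have h1 := (hR v UpperHalfPlane.I ζ hζ ω hω).symm.trans (hR' v UpperHalfPlane.I ζ hζ ω hω)
      exact smul_right_injective _ (autFactor_ne_zero v A _ bp bm ζ ω) h1
    · rw [← hθ, Theta, Theta, ← tsum_mul_left]
      refine tsum_congr fun y => ?_
      obtain ⟨y, rfl⟩ := y
      rw [hxy, discPair_cls hK hO]
      simp
  choose f hf hfδ using hex
  have hcard : (Nat.card (Disc h M) : ℂ) ≠ 0 := by exact_mod_cast Nat.card_pos.ne'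
  refine (Pi.basisFun ℂ (Disc h M)).ext fun δ₀ => ?_
  -- Fourier inversion on D_M: this combination of theta values isolates the basis vector at δ₀,
  -- with a coefficient that is nonzero by positivity.
  have h1 : ∑ γ, discPair h M γ (-δ₀) • f γ
      = ((Nat.card (Disc h M) : ℂ) * r δ₀) • Pi.basisFun ℂ (Disc h M) δ₀ := by
    ext δ
    have h2 : ∀ γ, discPair h M γ (-δ₀) * (discPair h M γ δ * r δ)
        = discPair h M γ (δ - δ₀) * r δ := by
      intro γ
      rw [sub_eq_add_neg, discPair_comm hK hO γ (δ + -δ₀), discPair_add_left hK hO,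
        discPair_comm hK hO δ, discPair_comm hK hO (-δ₀)]
      ring
    simp only [Finset.sum_apply, Pi.smul_apply, smul_eq_mul, hfδ, h2, Pi.basisFun_apply]
    rw [← Finset.sum_mul, sum_discPair hK hO hsig hM, Pi.single_apply]
    by_cases hδ : δ = δ₀
    · simp [hδ]
    · simp [hδ, sub_eq_zero]
  have h3 : R (((Nat.card (Disc h M) : ℂ) * r δ₀) • Pi.basisFun ℂ (Disc h M) δ₀)
      = R' (((Nat.card (Disc h M) : ℂ) * r δ₀) • Pi.basisFun ℂ (Disc h M) δ₀) := by
    rw [← h1, map_sum, map_sum]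
    exact Finset.sum_congr rfl fun γ _ => by rw [map_smul, map_smul, hf]
  rw [map_smul, map_smul] at h3
  have hr0 : (r δ₀ : ℂ) ≠ 0 := by exact_mod_cast (hr δ₀).ne'
  exact smul_right_injective _ (mul_ne_zero hcard hr0) h3

end Inversion

set_option linter.unusedSectionVars false

/-! ### Existence and uniqueness of the Weil representation. -/

section WeilRepresentation

open Module

variable {K : Type*} [Field K] [NumberField K] {φ : K →+* ℂ} {O : Subring K}
variable {V : Type*} [AddCommGroup V] [Module K V] [Module ℚ V]
variable {h : HermitianPairing φ V} {M : Submodule O V} {bp bm : ℕ}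
variable [NumberField.IsTotallyComplex K] (hK : finrank ℚ K = 2) (hO : IsQuadraticOrder O)
variable (hsig : h.HasSignature bp bm) (hM : IsEvenLattice h M)

include hK hO hsig hM

theorem exists_transforms_ofSL2 (B : SL(2, ℤ)) :
    ∃ R : Module.End ℂ (GroupSpace h M), Transforms h M bp bm (U11.ofSL2 φ O B) R := by
  have hfin := finite_disc hK hO hsig hM
  have := Fintype.ofFinite (Disc h M)
  have hS := transforms_S hK hO hsig hM
  have hT := transforms_T_zpow hK hO hsig hM
  have hB : B ∈ Subgroup.closure {ModularGroup.S, ModularGroup.T} := by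
    rw [SpecialLinearGroup.SL2Z_generators]
    exact Subgroup.mem_top B
  induction hB using Subgroup.closure_induction'' with
  | mem x hx =>
    rcases hx with rfl | rfl
    · exact ⟨_, hS⟩
    · exact ⟨_, zpow_one ModularGroup.T ▸ hT 1⟩
  -- The transformation law does not pass to inverses formally, as R is not known to be invertible;
  -- S⁻¹ = S³, and T⁻¹ is a power of T already treated.
  | inv_mem x hx =>
    rcases hx with rfl | rfl
    · have hinv : ModularGroup.S⁻¹ = ModularGroup.S * (ModularGroup.S * ModularGroup.S) :=
        inv_eq_of_mul_eq_one_right (by ext i k; fin_cases i <;> fin_cases k <;> rfl)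
      rw [hinv, map_mul, map_mul]
      exact ⟨_, hS.mul (hS.mul hS)⟩
    · exact ⟨_, zpow_neg_one ModularGroup.T ▸ hT (-1)⟩
  | one => exact ⟨1, by rw [map_one]; exact transforms_one hK hO hM⟩
  | mul x y _ _ hx hy =>
    obtain ⟨R, hR⟩ := hx
    obtain ⟨R', hR'⟩ := hy
    exact ⟨_, by rw [map_mul]; exact hR.mul hR'⟩

theorem exists_transforms (A : U11 φ O) :
    ∃ R : Module.End ℂ (GroupSpace h M), Transforms h M bp bm A R := by
  obtain ⟨ξ, B, rfl⟩ := U11.exists_eq_scalar_mul_ofSL2 hK hO A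
  obtain ⟨R, hR⟩ := exists_transforms_ofSL2 hK hO hsig hM B
  exact ⟨_, (transforms_scalar ξ).mul hR⟩

/-- The theta function transforms under a representation of `U(1,1)(ℤ)`. -/
theorem exists_representation_transforms :
    ∃ ρ : Representation ℂ (U11 φ O) (GroupSpace h M), ∀ A, Transforms h M bp bm A (ρ A) := by
  choose R hR using exists_transforms hK hO hsig hM
  -- By rigidity the chosen operators are multiplicative: R(A) R(B) and R(AB) both transform AB.
  exact ⟨{ toFun := R
           map_one' := (hR 1).unique hK hO hsig hM (transforms_one hK hO hM)
           map_mul' := fun A B => (hR _).unique hK hO hsig hM ((hR A).mul (hR B)) }, hR⟩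

theorem isWeilRep_of_transforms {ρ : Representation ℂ (U11 φ O) (GroupSpace h M)}
    (hρ : ∀ A, Transforms h M bp bm A (ρ A)) : IsWeilRep h M bp bm ρ where
  map_T x := by
    have h1 := transforms_T_zpow hK hO hsig hM 1
    rw [zpow_one] at h1
    rw [(hρ _).unique hK hO hsig hM h1, weilT_basisVec hK hO hM, Int.cast_one, one_mul]
  map_S x y := by
    have hfin := finite_disc hK hO hsig hM
    have := Fintype.ofFinite (Disc h M)
    rw [(hρ _).unique hK hO hsig hM (transforms_S hK hO hsig hM), weilS_basisVec,
      discPair_cls hK hO]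
  map_scalar ξ x := by
    rw [(hρ _).unique hK hO hsig hM (transforms_scalar ξ), weilScalar_basisVec]

/-- S and T generate SL₂(ℤ), and with the scalar matrices they generate the whole group, so the
prescribed values leave no freedom. -/
theorem IsWeilRep.unique {ρ ρ' : Representation ℂ (U11 φ O) (GroupSpace h M)}
    (hρ : IsWeilRep h M bp bm ρ) (hρ' : IsWeilRep h M bp bm ρ') : ρ = ρ' := by
  have hfin := finite_disc hK hO hsig hM
  have := Fintype.ofFinite (Disc h M)
  have hext : ∀ R R' : Module.End ℂ (GroupSpace h M),
      (∀ x, R (basisVec h M (cls h M x)) = R' (basisVec h M (cls h M x))) → R = R' := by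
    classical
    intro R R' hRR'
    refine (Pi.basisFun ℂ (Disc h M)).ext fun γ => ?_
    obtain ⟨x, rfl⟩ := cls_surjective γ
    convert hRR' x using 2 <;> rw [Pi.basisFun_apply, basisVec]
  have hSL2 : ρ.comp (U11.ofSL2 φ O) = ρ'.comp (U11.ofSL2 φ O) := by
    refine MonoidHom.eq_of_eqOn_dense SpecialLinearGroup.SL2Z_generators ?_
    rintro B (rfl | rfl)
    · refine hext _ _ fun x => ?_
      ext γ
      obtain ⟨y, rfl⟩ := cls_surjective γ
      exact (hρ.map_S x y).trans (hρ'.map_S x y).symm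
    · exact hext _ _ fun x => (hρ.map_T x).trans (hρ'.map_T x).symm
  ext1 A
  obtain ⟨ξ, B, rfl⟩ := U11.exists_eq_scalar_mul_ofSL2 hK hO A
  rw [map_mul, map_mul, hext _ _ fun x => (hρ.map_scalar ξ x).trans (hρ'.map_scalar ξ x).symm]
  congr 1
  exact DFunLike.congr_fun hSL2 B

end WeilRepresentation

end

end HermitianJacobi

open HermitianJacobi in
theorem mainTheorem4 {K : Type*} [Field K] [NumberField K] [NumberField.IsTotallyComplex K]
    (hK : Module.finrank ℚ K = 2) (φ : K →+* ℂ) (O : Subring K) (hO : IsQuadraticOrder O)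
    {V : Type*} [AddCommGroup V] [Module K V] [Module ℚ V]
    (h : HermitianPairing φ V) (bp bm : ℕ) (hsig : h.HasSignature bp bm)
    (M : Submodule O V) (hM : IsEvenLattice h M) :
    ∃ ρ : Representation ℂ (U11 φ O) (GroupSpace h M),
      IsWeilRep h M bp bm ρ ∧
      (∀ ρ' : Representation ℂ (U11 φ O) (GroupSpace h M), IsWeilRep h M bp bm ρ' → ρ' = ρ) ∧
      (∀ (v : GrJ h) (τ : ℍ), ∀ ζ ∈ VC φ V, ∀ ω ∈ VCbar φ V,
        Summable fun x : dual h M => ‖thetaTerm v τ ζ ω (x : V)‖) ∧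
      ∀ (A : U11 φ O) (v : GrJ h) (τ : ℍ), ∀ ζ ∈ VC φ V, ∀ ω ∈ VCbar φ V,
        Theta h M v (U11.act A τ)
            ((U11.j A τ)⁻¹ • v.projPos ζ + (conj (U11.jc A τ))⁻¹ • v.projNeg ζ)
            ((U11.jc A τ)⁻¹ • v.projPos ω + (conj (U11.j A τ))⁻¹ • v.projNeg ω)
          = (U11.j A τ ^ bp * conj (U11.j A τ) ^ bm *
              e (U11.jDeriv A * h.pairC (v.projPos ζ) (v.projPos ω) / U11.j A τ
                + conj (U11.jDeriv A) * h.pairC (v.projNeg ζ) (v.projNeg ω) / conj (U11.j A τ)))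
            • ρ A (Theta h M v τ ζ ω) := by
  obtain ⟨ρ, hρ⟩ := exists_representation_transforms hK hO hsig hM
  have hW := isWeilRep_of_transforms hK hO hsig hM hρ
  exact ⟨ρ, hW, fun ρ' hρ' => hρ'.unique hK hO hsig hM hW,
    fun v τ ζ hζ ω hω => summable_norm_thetaTerm hK hO hsig hM v τ hζ hω, hρ⟩
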